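/- Conventions. Let $G$ be a compact (Hausdorff) group with normalized Haar measure and let $\lambda_g f(h)=f(g^{-1}h)$, $r_gf(h)=f(hg)$ be the regular representations on $L^2(G)$. A C$^*$-dynamical system $(\mathcal A,G,\alpha)$ consists of a unital C$^*$-algebra $\mathcal A$ and an action $\alpha$ of $G$ by $^*$-automorphisms such that $(g,x)\mapsto\alpha_g(x)$ is continuous; $\mathcal B=\mathcal A^G$ is its fixed point algebra. It is *free* if the span of the functions $g\mapsto x\,\alpha_g(y)$, $x,y\in\mathcal A$, is dense in $C(G,\mathcal A)$. A covariant representation on a Hilbert space $\mathfrak H_{\mathcal A}$ is a pair $(\pi,u)$ of a unital $^*$-representation $\pi$ of $\mathcal A$ and a strongly continuous unitary representation $u$ of $G$ with $\pi(\alpha_g(x))=u_g\pi(x)u_g^*$; it is faithful if $\pi$ is injective. Its trivial isotypic component is $\mathfrak H_{\mathcal A}(1)=\{\eta: u_g\eta=\eta\ \forall g\}$, a representation space of $\mathcal B$ via $\pi$. On $\mathfrak H_{\mathcal A}\otimes L^2(G)=L^2(G,\mathfrak H_{\mathcal A})$ let $j_\alpha(x)$ be multiplication by $h\mapsto \pi(\alpha_{h^{-1}}(x))$.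 For a strongly continuous unitary representation $\mu$ of $G$ on a Hilbert space $\mathfrak H$, consider isometries $s:\mathfrak H_{\mathcal A}\otimes L^2(G)\to\mathfrak H_{\mathcal A}\otimes\mathfrak H$ with $$ s\,\bigl(\pi(\mathcal A)\otimes\mathcal K(L^2(G))\bigr)\subseteq \pi(\mathcal A)\otimes\mathcal K(L^2(G),\mathfrak H),\qquad (u_g\otimes 1)s=s(u_g\otimes r_g),\qquad (1\otimes\mu_g)s=s(1\otimes\lambda_g)\quad(g\in G), \tag{$*$}$$ where the tensor products with compact operators are norm closed. Call $s$ normalized if the fixed space of $\mu$ is $\mathbb C e$ for a unit vector $e$ and $s(\eta\otimes 1)=\eta\otimes e$ for all $\eta\in\mathfrak H_{\mathcal A}$. Put $\pi_s(x)=s\,j_\alpha(x)\,s^*$. For a unital $^*$-representation $\pi_{\mathcal B}$ of $\mathcal B$ on $\mathfrak H_{\mathcal B}$ and an operator $T$ on $\mathfrak H_{\mathcal A}\otimes\mathfrak H$ all of whose matrix entries $(1\otimes\langle\xi|)T(1\otimes|\zeta\rangle)$, $\xi,\zeta\in\mathfrak H$, lie in $\pi(\mathcal B)\cong\mathcal B$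 ($\pi$ faithful), $(\pi_{\mathcal B}\otimes\mathrm{id})(T)$ denotes the bounded operator on $\mathfrak H_{\mathcal B}\otimes\mathfrak H$, if it exists, obtained by applying $\pi_{\mathcal B}$ to each matrix entry. Theorem. Let $(\mathcal A,G,\alpha)$ be a free C$^*$-dynamical system with fixed point algebra $\mathcal B$. (1) There is a strongly continuous unitary representation $\mu:G\to\mathcal U(\mathfrak H)$ with finite-dimensional multiplicity spaces such that for every faithful covariant representation of $(\mathcal A,G,\alpha)$ there is a normalized isometry $s$ satisfying $(*)$. (2) Let $\mu:G\to\mathcal U(\mathfrak H)$ be any strongly continuous unitary representation with finite-dimensional multiplicity spaces, let $s$ be any isometry satisfying $(*)$ for some faithful covariant representation, and let $\pi_{\mathcal B}:\mathcal B\to\mathcal L(\mathfrak H_{\mathcal B})$ be any unital $^*$-representation. Then $p:=(\pi_{\mathcal B}\otimes\mathrm{id})(ss^*)$ exists and is an orthogonal projection, and, with $\pi_p(x):=(\pi_{\mathcal B}\otimes\mathrm{id})(\pi_s(x))|_{p(\mathfrak H_{\mathcal B}\otimes\mathfrak H)}$, the triple $$\bigl(p(\mathfrak H_{\mathcal B}\otimes\mathfrak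 H),\ \pi_p,\ 1\otimes\mu\bigr)$$ is a well-defined covariant representation of $(\mathcal A,G,\alpha)$. Every faithful covariant representation $(\pi,u)$ of $(\mathcal A,G,\alpha)$ on a Hilbert space $\mathfrak H_{\mathcal A}$ whose trivial isotypic component $\mathfrak H_{\mathcal A}(1)$ is isomorphic (unitarily, as a representation space of $\mathcal B$) to $\mathfrak H_{\mathcal B}$ is unitarily equivalent to it. -/

import Mathlib

open MeasureTheory TopologicalSpace
open scoped TensorProduct InnerProductSpace

universe uG uA uH u₀ uB u₁

noncomputable section

/-! ### Hilbert space tensor products -/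

section HilbertTensor

variable {E E' F F' : Type*}
  [NormedAddCommGroup E] [InnerProductSpace ℂ E] [NormedAddCommGroup E'] [InnerProductSpace ℂ E']
  [NormedAddCommGroup F] [InnerProductSpace ℂ F] [NormedAddCommGroup F'] [InnerProductSpace ℂ F']

/-- The Hilbert space tensor product: the completion of the algebraic tensor product for
`⟪e ⊗ f, e' ⊗ f'⟫ = ⟪e, e'⟫ * ⟪f, f'⟫`. -/
abbrev HTensor (E F : Type*) [NormedAddCommGroup E] [InnerProductSpace ℂ E]
    [NormedAddCommGroup F] [InnerProductSpace ℂ F] : Type _ :=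
  UniformSpace.Completion (E ⊗[ℂ] F)

/-- The elementary tensor `e ⊗ f` in the Hilbert space tensor product. -/
def htmul (e : E) (f : F) : HTensor E F := ((e ⊗ₜ[ℂ] f : E ⊗[ℂ] F) : HTensor E F)

/-- The tensor product `S ⊗ T` of two isometries, see `hmap_htmul`. -/
def hmap (S : E →ₗᵢ[ℂ] E') (T : F →ₗᵢ[ℂ] F') : HTensor E F →L[ℂ] HTensor E' F' :=
  (UniformSpace.Completion.toComplL ∘L
    (TensorProduct.mapIsometry S T).toContinuousLinearMap).extend
      (UniformSpace.Completion.toComplL : E ⊗[ℂ] F →L[ℂ] HTensor E F)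

theorem hmap_htmul (S : E →ₗᵢ[ℂ] E') (T : F →ₗᵢ[ℂ] F') (e : E) (f : F) :
    hmap S T (htmul e f) = htmul (S e) (T f) :=
  ContinuousLinearMap.extend_eq _ UniformSpace.Completion.denseRange_coe
    (UniformSpace.Completion.isUniformInducing_coe _) (e ⊗ₜ[ℂ] f)

end HilbertTensor

/-! ### Ranges of projections -/

section ProjRange

variable {K : Type*} [NormedAddCommGroup K] [InnerProductSpace ℂ K]

/-- The closed subspace `{ζ | p ζ = ζ}`; it is the range of `p` when `p` is a projection. -/
def projRange (p : K →L[ℂ] K) : Submodule ℂ K :=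
  LinearMap.ker ((ContinuousLinearMap.id ℂ K - p : K →L[ℂ] K) : K →ₗ[ℂ] K)

theorem mem_projRange {p : K →L[ℂ] K} {ζ : K} : ζ ∈ projRange p ↔ p ζ = ζ := by
  rw [projRange, LinearMap.mem_ker]
  exact sub_eq_zero.trans eq_comm

theorem projRange_eq_range {p : K →L[ℂ] K} (hp : IsIdempotentElem p) :
    (projRange p : Set K) = Set.range p := by
  ext ζ
  constructor
  · exact fun h => ⟨ζ, mem_projRange.1 h⟩
  · rintro ⟨ξ, rfl⟩
    exact mem_projRange.2 (DFunLike.congr_fun hp ξ)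

instance projRange_completeSpace [CompleteSpace K] (p : K →L[ℂ] K) :
    CompleteSpace (projRange p) :=
  (ContinuousLinearMap.isClosed_ker (ContinuousLinearMap.id ℂ K - p)).completeSpace_coe

end ProjRange

/-! ### Unitary representations -/

/-- A (strongly continuous) unitary representation of `G` on `H`. -/
structure UnitaryRepr (G H : Type*) [Group G] [TopologicalSpace G]
    [NormedAddCommGroup H] [InnerProductSpace ℂ H] where
  /-- The unitary operators. -/
  op : G →* (H ≃ₗᵢ[ℂ] H)
  continuous_op : ∀ η : H, Continuous fun g => op g η

namespace UnitaryRepr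

variable {G H V : Type*} [Group G] [TopologicalSpace G]
  [NormedAddCommGroup H] [InnerProductSpace ℂ H] [NormedAddCommGroup V] [InnerProductSpace ℂ V]

/-- The trivial isotypic component: the vectors fixed by `G`. -/
def trivialComponent (u : UnitaryRepr G H) : Submodule ℂ H where
  carrier := {η | ∀ g, u.op g η = η}
  add_mem' ha hb g := by rw [map_add, ha g, hb g]
  zero_mem' g := map_zero _
  smul_mem' c η h g := by rw [map_smul, h g]

/-- Irreducibility: nonzero, without proper nonzero closed invariant subspace. -/
def IsIrreducible (σ : UnitaryRepr G V) : Prop :=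
  Nontrivial V ∧ ∀ W : Submodule ℂ V, IsClosed (W : Set V) →
    (∀ g, ∀ v ∈ W, σ.op g v ∈ W) → W = ⊥ ∨ W = ⊤

/-- The multiplicity space of `σ` in `u`: the intertwiners `V → H`. -/
def multiplicitySpace (u : UnitaryRepr G H) (σ : UnitaryRepr G V) :
    Submodule ℂ (V →L[ℂ] H) where
  carrier := {T | ∀ g v, T (σ.op g v) = u.op g (T v)}
  add_mem' ha hb g v := by
    simp only [add_apply, ha g v, hb g v, map_add]
  zero_mem' g v := by simp
  smul_mem' c T h g v := by
    simp only [smul_apply, h g v, map_smul]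

/-- All multiplicity spaces are finite-dimensional. For compact `G` each irreducible unitary
representation is equivalent to one on some `ℂⁿ`. -/
def HasFiniteMultiplicities (u : UnitaryRepr G H) : Prop :=
  ∀ (n : ℕ) (σ : UnitaryRepr G (EuclideanSpace ℂ (Fin n))), σ.IsIrreducible →
    FiniteDimensional ℂ (u.multiplicitySpace σ)

end UnitaryRepr

/-! ### The spaces `L²(G, E) = E ⊗ L²(G)` of a compact group -/

section LTwo

variable (G : Type*) [Group G] [TopologicalSpace G] [IsTopologicalGroup G] [CompactSpace G]
  [T2Space G] [MeasurableSpace G] [BorelSpace G]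

/-- The normalized Haar measure of a compact group. -/
def haarP : Measure G := Measure.haarMeasure (⊤ : PositiveCompacts G)

instance haarP_isHaarMeasure : (haarP G).IsHaarMeasure :=
  inferInstanceAs (Measure.haarMeasure (⊤ : PositiveCompacts G)).IsHaarMeasure

instance haarP_isProbabilityMeasure : IsProbabilityMeasure (haarP G) where
  measure_univ := Measure.haarMeasure_self (K₀ := (⊤ : PositiveCompacts G))

instance haarP_isMulRightInvariant : (haarP G).IsMulRightInvariant where
  map_mul_right_eq_self g :=
    haveI : IsProbabilityMeasure ((haarP G).map (· * g)) :=
      Measure.isProbabilityMeasure_map (measurable_mul_const g).aemeasurable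
    Measure.isHaarMeasure_eq_of_isProbabilityMeasure _ _

/-- `L²(G, E)` for the normalized Haar measure. For a Hilbert space `E` this is the Hilbert space
tensor product `E ⊗ L²(G)`, with elementary tensors `ltmul`. -/
abbrev LTwo (E : Type*) [NormedAddCommGroup E] : Type _ := Lp E 2 (haarP G)

variable {G} {E : Type*} [NormedAddCommGroup E] [InnerProductSpace ℂ E]

/-- The elementary tensor `η ⊗ f`, that is, the function `h ↦ f h • η`. -/
def ltmul (η : E) (f : LTwo G ℂ) : LTwo G E :=
  (ContinuousLinearMap.toSpanSingleton ℂ η).compLp f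

/-- `1 ⊗ λ_g`, where `λ` is the left regular representation: `h ↦ f (g⁻¹ * h)`. -/
def leftTranslate (g : G) (f : LTwo G E) : LTwo G E :=
  Lp.compMeasurePreserving (fun h => g⁻¹ * h) (measurePreserving_mul_left (haarP G) g⁻¹) f

/-- `1 ⊗ r_g`, where `r` is the right regular representation: `h ↦ f (h * g)`. -/
def rightTranslate (g : G) (f : LTwo G E) : LTwo G E :=
  Lp.compMeasurePreserving (fun h => h * g) (measurePreserving_mul_right (haarP G) g) f

/-- `T ⊗ r_g`, that is, `h ↦ T (f (h * g))`. -/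
def twistedRightTranslate (T : E ≃ₗᵢ[ℂ] E) (g : G) (f : LTwo G E) : LTwo G E :=
  (T.toContinuousLinearEquiv : E →L[ℂ] E).compLp (rightTranslate g f)

/-- Pointwise multiplication of `L²(G, E)` by a continuous operator valued function. -/
def mulOp (φ : C(G, E →L[ℂ] E)) : LTwo G E →L[ℂ] LTwo G E :=
  (ContinuousLinearMap.id ℂ (E →L[ℂ] E)).holderL (haarP G) ⊤ 2 2
    (MemLp.toLp φ (memLp_top_of_bound
      (φ.continuous.stronglyMeasurable_of_hasCompactSupport
        (HasCompactSupport.of_compactSpace φ)).aestronglyMeasurable ‖φ‖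
      (Filter.Eventually.of_forall φ.norm_coe_le_norm)))

end LTwo

/-! ### C*-dynamical systems -/

/-- A C*-dynamical system: a strongly continuous action of `G` on the unital C*-algebra `A` by
*-automorphisms. -/
structure CStarDynamics (G A : Type*) [Group G] [TopologicalSpace G] [CStarAlgebra A] where
  /-- The action. -/
  act : G →* (A ≃⋆ₐ[ℂ] A)
  continuous_act : Continuous fun q : G × A => act q.1 q.2

namespace CStarDynamics

section Basic

variable {G A : Type*} [Group G] [TopologicalSpace G] [CStarAlgebra A] (α : CStarDynamics G A)

/-- The fixed point algebra. -/
def fixedAlgebra : StarSubalgebra ℂ A where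
  carrier := {x | ∀ g, α.act g x = x}
  mul_mem' ha hb g := by rw [map_mul, ha g, hb g]
  add_mem' ha hb g := by rw [map_add, ha g, hb g]
  algebraMap_mem' c g := by
    rw [Algebra.algebraMap_eq_smul_one, map_smul, map_one]
  star_mem' ha g := by rw [map_star, ha g]

/-- The Ellwood map `A ⊗ A → C(G, A)`, `x ⊗ y ↦ (g ↦ x * α_g y)`. -/
def ellwood : A ⊗[ℂ] A →ₗ[ℂ] C(G, A) :=
  TensorProduct.lift <| LinearMap.mk₂ ℂ
    (fun x y => (⟨fun g => x * α.act g y, continuous_const.mul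
      (α.continuous_act.comp (continuous_id.prodMk continuous_const))⟩ : C(G, A)))
    (fun x x' y => by ext g; simp [add_mul])
    (fun c x y => by ext g; simp)
    (fun x y y' => by ext g; simp [mul_add])
    (fun c x y => by ext g; simp)

theorem ellwood_tmul (x y : A) (g : G) : α.ellwood (x ⊗ₜ[ℂ] y) g = x * α.act g y := rfl

/-- Freeness: the Ellwood map has dense range (`C(G, A)` has the compact-open topology, which is
that of the supremum norm as soon as `G` is compact). -/
def IsFree : Prop := DenseRange α.ellwood

/-- A covariant representation `(π, u)` of `(A, G, α)` on the Hilbert space `H`. -/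
structure CovRep (H : Type*) [NormedAddCommGroup H] [InnerProductSpace ℂ H]
    [CompleteSpace H] where
  /-- The (unital) *-representation of the algebra. -/
  π : A →⋆ₐ[ℂ] (H →L[ℂ] H)
  /-- The unitary representation of the group. -/
  u : UnitaryRepr G H
  covariant : ∀ g x η, π (α.act g x) (u.op g η) = u.op g (π x η)

variable {α}

/-- A covariant representation is faithful if its *-representation is. -/
def CovRep.IsFaithful {H : Type*} [NormedAddCommGroup H] [InnerProductSpace ℂ H]
    [CompleteSpace H] (ρ : α.CovRep H) : Prop := Function.Injective ρ.π

/-- Unitary equivalence of covariant representations. -/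
def CovRep.UnitarilyEquivalent {H H' : Type*} [NormedAddCommGroup H] [InnerProductSpace ℂ H]
    [CompleteSpace H] [NormedAddCommGroup H'] [InnerProductSpace ℂ H'] [CompleteSpace H']
    (ρ : α.CovRep H) (ρ' : α.CovRep H') : Prop :=
  ∃ Φ : H ≃ₗᵢ[ℂ] H', (∀ x η, Φ (ρ.π x η) = ρ'.π x (Φ η)) ∧
    ∀ g η, Φ (ρ.u.op g η) = ρ'.u.op g (Φ η)

/-- The trivial isotypic component of `ρ`, with its action of the fixed point algebra `B`, is
isomorphic to the representation `πB` of `B`. -/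
def CovRep.TrivialComponentIso {H HB : Type*} [NormedAddCommGroup H] [InnerProductSpace ℂ H]
    [CompleteSpace H] [NormedAddCommGroup HB] [InnerProductSpace ℂ HB] [CompleteSpace HB]
    (ρ : α.CovRep H) (πB : α.fixedAlgebra →⋆ₐ[ℂ] (HB →L[ℂ] HB)) : Prop :=
  ∃ U : HB ≃ₗᵢ[ℂ] ρ.u.trivialComponent, ∀ (b : α.fixedAlgebra) (ξ : HB),
    (U (πB b ξ) : H) = ρ.π (b : A) (U ξ)

end Basic

section Frames

variable {G A : Type*} [Group G] [TopologicalSpace G] [IsTopologicalGroup G] [CompactSpace G]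
  [T2Space G] [MeasurableSpace G] [BorelSpace G] [CStarAlgebra A] {α : CStarDynamics G A}
  {H HA HB : Type*} [NormedAddCommGroup H] [InnerProductSpace ℂ H] [CompleteSpace H]
  [NormedAddCommGroup HA] [InnerProductSpace ℂ HA] [CompleteSpace HA]
  [NormedAddCommGroup HB] [InnerProductSpace ℂ HB] [CompleteSpace HB]

/-- The operator `j_α(x)` on `HA ⊗ L²(G) = L²(G, HA)`: multiplication by the function
`h ↦ π(α_{h⁻¹}(x))`. -/
def CovRep.jOp (ρ : α.CovRep HA) (x : A) : LTwo G HA →L[ℂ] LTwo G HA :=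
  mulOp ⟨fun h => ρ.π (α.act h⁻¹ x),
    (AddMonoidHomClass.continuous_of_bound ρ.π 1 fun a => by
      simpa only [one_mul] using NonUnitalStarAlgHom.norm_apply_le ρ.π a).comp
      (α.continuous_act.comp (continuous_inv.prodMk continuous_const))⟩

/-- `A ⊗ K(L²(G))`, as operators on `HA ⊗ L²(G)`: the norm closed linear span of the operators
`π(a) ⊗ k` with `k` compact. -/
def CovRep.compactsL (ρ : α.CovRep HA) : Submodule ℂ (LTwo G HA →L[ℂ] LTwo G HA) :=
  (Submodule.span ℂ {T | ∃ (a : A) (k : LTwo G ℂ →L[ℂ] LTwo G ℂ), IsCompactOperator k ∧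
    ∀ η f, T (ltmul η f) = ltmul (ρ.π a η) (k f)}).topologicalClosure

/-- `A ⊗ K(L²(G), H)`, as operators `HA ⊗ L²(G) → HA ⊗ H`: the norm closed linear span of the
operators `π(a) ⊗ k` with `k` compact. -/
def CovRep.compactsLH (ρ : α.CovRep HA) (H : Type*) [NormedAddCommGroup H]
    [InnerProductSpace ℂ H] : Submodule ℂ (LTwo G HA →L[ℂ] HTensor HA H) :=
  (Submodule.span ℂ {T | ∃ (a : A) (k : LTwo G ℂ →L[ℂ] H), IsCompactOperator k ∧
    ∀ η f, T (ltmul η f) = htmul (ρ.π a η) (k f)}).topologicalClosure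

/-- The isometries `s : HA ⊗ L²(G) → HA ⊗ H` which express freeness in the covariant
representation `(π, u)`, relative to a unitary representation `μ` of `G` on `H`. -/
structure IsFreenessIsometry (μ : UnitaryRepr G H) (ρ : α.CovRep HA)
    (s : LTwo G HA →ₗᵢ[ℂ] HTensor HA H) : Prop where
  /-- `s (A ⊗ K(L²(G))) ⊆ A ⊗ K(L²(G), H)` -/
  compacts : ∀ T ∈ ρ.compactsL, s.toContinuousLinearMap ∘L T ∈ ρ.compactsLH H
  /-- `(u_g ⊗ 1) s = s (u_g ⊗ r_g)` -/
  equivariant : ∀ g f, hmap (ρ.u.op g).toLinearIsometry LinearIsometry.id (s f) =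
    s (twistedRightTranslate (ρ.u.op g) g f)
  /-- `(1 ⊗ μ_g) s = s (1 ⊗ λ_g)` -/
  commuting : ∀ g f, hmap LinearIsometry.id (μ.op g).toLinearIsometry (s f) =
    s (leftTranslate g f)

/-- `s` is normalized: the trivial isotypic component of `μ` is spanned by one unit vector `e`,
and `s (η ⊗ 1) = η ⊗ e`. -/
def IsNormalizedIsometry (μ : UnitaryRepr G H) (s : LTwo G HA →ₗᵢ[ℂ] HTensor HA H) : Prop :=
  ∃ e : H, ‖e‖ = 1 ∧ μ.trivialComponent = Submodule.span ℂ {e} ∧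
    ∀ η : HA, s (ltmul η (Lp.const 2 (haarP G) (1 : ℂ))) = htmul η e

/-- `T' = (πB ⊗ id)(T)`, where `B` acts on `HA` by `π`. Every matrix entry
`(1 ⊗ ⟨ξ|) T (1 ⊗ |ζ⟩)` of the operator `T` on `HA ⊗ H` is `π(b)` for some `b` in `B`, and the
corresponding entry of the operator `T'` on `HB ⊗ H` is `πB(b)`. If `π` is faithful, `T`
determines `T'`; on multipliers of `B ⊗ K(H)` this is the canonical extension of `πB ⊗ id`. -/
def IsAmplification (ρ : α.CovRep HA) (πB : α.fixedAlgebra →⋆ₐ[ℂ] (HB →L[ℂ] HB))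
    (T : HTensor HA H →L[ℂ] HTensor HA H) (T' : HTensor HB H →L[ℂ] HTensor HB H) : Prop :=
  ∀ ξ ζ : H, ∃ b : α.fixedAlgebra,
    (∀ η' η : HA, ⟪htmul η' ξ, T (htmul η ζ)⟫_ℂ = ⟪η', ρ.π (b : A) η⟫_ℂ) ∧
    (∀ η' η : HB, ⟪htmul η' ξ, T' (htmul η ζ)⟫_ℂ = ⟪η', πB b η⟫_ℂ)

/-- The operator `s s*` on `HA ⊗ H`. -/
def rangeProj (s : LTwo G HA →ₗᵢ[ℂ] HTensor HA H) : HTensor HA H →L[ℂ] HTensor HA H :=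
  s.toContinuousLinearMap ∘L s.toContinuousLinearMap.adjoint

/-- The operator `π_s(x) = s j_α(x) s*` on `HA ⊗ H`. -/
def CovRep.piS (ρ : α.CovRep HA) (s : LTwo G HA →ₗᵢ[ℂ] HTensor HA H) (x : A) :
    HTensor HA H →L[ℂ] HTensor HA H :=
  s.toContinuousLinearMap ∘L ρ.jOp x ∘L s.toContinuousLinearMap.adjoint

/-- The covariant representation `τ` is `(p (HB ⊗ H), π_p, 1 ⊗ μ)`: here `p = (πB ⊗ id)(s s*)` is a
projection on `HB ⊗ H`, the group acts by the restriction of `1 ⊗ μ`, and `π_p(x)` is the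
restriction of `(πB ⊗ id)(π_s(x))`. -/
structure IsModel (μ : UnitaryRepr G H) (ρ : α.CovRep HA) (s : LTwo G HA →ₗᵢ[ℂ] HTensor HA H)
    (πB : α.fixedAlgebra →⋆ₐ[ℂ] (HB →L[ℂ] HB)) (p : HTensor HB H →L[ℂ] HTensor HB H)
    (τ : α.CovRep (projRange p)) : Prop where
  isStarProjection : IsStarProjection p
  isAmplification : IsAmplification ρ πB (rangeProj s) p
  pi_eq : ∀ x, ∃ T : HTensor HB H →L[ℂ] HTensor HB H, IsAmplification ρ πB (ρ.piS s x) T ∧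
    ∀ ζ : projRange p, (τ.π x ζ : HTensor HB H) = T ζ
  u_eq : ∀ g (ζ : projRange p), (τ.u.op g ζ : HTensor HB H) =
    hmap LinearIsometry.id (μ.op g).toLinearIsometry (ζ : HTensor HB H)

end Frames

end CStarDynamics

end

/-!
Both parts work with operators `T : E ⊗ K → E ⊗ K'` through their columns `T (1 ⊗ |k⟩)`. For a
representation `π` of a C*-algebra `D` on `E`, the closed span `HTensor.col π K` of the operators
`η ↦ π(d) η ⊗ k` is the Hilbert module `D ⊗ K` when `π` is injective. Its elements can therefore be
moved to any other representation of `D` (`HTensor.exists_mem_colPair`), and `HTensor.IsAmp` says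
that `T'` arises from `T` in this way, column by column.

**Existence of the isometry.** `L²(G)` is the Hilbert sum of finite-dimensional spaces `W` of
continuous functions which are invariant under left and right translations (`exists_blocks`). They
are spanned by the left translates of eigenspaces of compact convolution operators; irreducibility
is not needed. On such a block the conjugate matrix coefficients of the left regular
representation form a Parseval frame (`IsBlock.frame`).
For a matrix representation `R` of `G` call a row `y` over `A` equivariant if `α_h(y) = y R(h)`;
averages `∫ R(h⁻¹) α_h(y) dh` provide such rows. By freeness the left ideal
generated by the square matrices with equivariant rows is dense in the matrices over `A`, so some
finite sum `S = ∑ t* t` of them is invertible, and the rows of the matrices `t S^(-1/2)` form a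
Parseval frame `∑ y_r* y_r = 1` of equivariant rows (`exists_frame`). The space `H` is the Hilbert
sum of the blocks, each repeated once for every row of its frame. The isometry sends a function `f`
of a block to the column whose entries are the coefficients of `f` combined with the rows
(`blockCol`); the two Parseval identities make it isometric. Space and rows do not depend on the
representation of `A`, and the choice of the single row `1` for the constants normalizes it
(`BlockFrames.exists_freenessIsometry`). Each irreducible representation occurs in finitely many
blocks only (`finite_blocks_of_repr`), so the multiplicity spaces are finite-dimensional.

**The model.** The condition on compact operators says that the columns of `s` are columns over `A`;
hence `s` has a counterpart `s'` in every other covariant representation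
(`CStarDynamics.IsFreenessIsometry.exists_transport`). The columns of `s*` are columns over `A` as
well: a vector `ζ` of `H` is a limit of averages `μ(ψ) ζ` over the group, and
`s* (1 ⊗ |μ(ψ) ζ⟩) = (1 ⊗ λ(ψ)) s* (1 ⊗ |ζ⟩)` with the compact operator `λ(ψ)`
(`HTensor.IsAmp.adjoint`). So `π_s(x) = s j_α(x) s*` has columns over `A`, its entries are
fixed by `G`, and its columns are therefore columns over the fixed point algebra `B`
(`comp_ket_mem_col_fixedRep`). With the square root `y` of `‖x‖² - x* x` the identity
`j_α(x)* j_α(x) + j_α(y)² = ‖x‖²` bounds the amplified columns, so `(π_B ⊗ id)(π_s(x))` exists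
for every representation `π_B` (`exists_isAmp_piS`), and uniqueness of amplifications makes it a
covariant *-representation.

**Uniqueness.** Let `s'` be the counterpart of `s` in a covariant representation on `H_A` whose
trivial isotypic component is `H_B`. The vectors of `L²(G, H_A)` fixed by `u ⊗ r` are exactly the
functions `h ↦ u_{h⁻¹} η` (`exists_fixedEmb_eq`), and those of `H_A ⊗ H` fixed by `u ⊗ 1` are
`H_B ⊗ H` (`exists_hmap_eq`). Since `s'` intertwines `u ⊗ r` with `u ⊗ 1`, the map
`η ↦ s' (h ↦ u_{h⁻¹} η)` is a unitary from `H_A` onto the range of `p` in `H_B ⊗ H`, and it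
intertwines the actions of `A` and of `G`
(`CStarDynamics.IsFreenessIsometry.exists_model`).
-/

noncomputable section

set_option linter.unusedSectionVars false

/-! ### Operators on Hilbert space tensor products -/

namespace HTensor

section Basic

variable {E E' F F' X : Type*}
  [NormedAddCommGroup E] [InnerProductSpace ℂ E] [NormedAddCommGroup E'] [InnerProductSpace ℂ E']
  [NormedAddCommGroup F] [InnerProductSpace ℂ F] [NormedAddCommGroup F'] [InnerProductSpace ℂ F']
  [NormedAddCommGroup X] [InnerProductSpace ℂ X]

/-! Shortcuts for the type class search. -/

scoped instance : NormedAddCommGroup (HTensor E F) := inferInstance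
scoped instance : SeminormedAddCommGroup (HTensor E F) := inferInstance
scoped instance : AddCommGroup (HTensor E F) := inferInstance
scoped instance : AddCommMonoid (HTensor E F) := inferInstance
scoped instance : InnerProductSpace ℂ (HTensor E F) := inferInstance
scoped instance : NormedSpace ℂ (HTensor E F) := inferInstance
scoped instance : Module ℂ (HTensor E F) := inferInstance
scoped instance : TopologicalSpace (HTensor E F) := inferInstance
scoped instance : IsTopologicalAddGroup (HTensor E F) := inferInstance
scoped instance : ContinuousConstSMul ℂ (HTensor E F) := inferInstance
scoped instance : AddCommMonoid (X →L[ℂ] HTensor E F) := inferInstance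
scoped instance : Module ℂ (X →L[ℂ] HTensor E F) := inferInstance
scoped instance : NormedAddCommGroup (X →L[ℂ] HTensor E F) := inferInstance
scoped instance : SeminormedAddCommGroup (X →L[ℂ] HTensor E F) := inferInstance
scoped instance : NormedSpace ℂ (X →L[ℂ] HTensor E F) := inferInstance
scoped instance : TopologicalSpace (X →L[ℂ] HTensor E F) := inferInstance

/-- The operator `1 ⊗ |k⟩ : E → E ⊗ F`, depending linearly and continuously on `k`. -/
def ket : F →L[ℂ] E →L[ℂ] HTensor E F :=
  (ContinuousLinearMap.compL ℂ E (E ⊗[ℂ] F) (HTensor E F)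
    (UniformSpace.Completion.toComplL : E ⊗[ℂ] F →L[ℂ] HTensor E F)) ∘L
    (TensorProduct.mkL ℂ E F).flip

theorem ket_apply (k : F) (e : E) : ket k e = htmul e k := rfl

theorem htmul_add (e : E) (f f' : F) : htmul e (f + f') = htmul e f + htmul e f' := by
  rw [← ket_apply, map_add]; rfl

theorem htmul_smul (c : ℂ) (e : E) (f : F) : htmul e (c • f) = c • htmul e f := by
  rw [← ket_apply, map_smul]; rfl

theorem smul_htmul (c : ℂ) (e : E) (f : F) : htmul (c • e) f = c • htmul e f :=
  map_smul (ket f) c e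

theorem inner_htmul (e e' : E) (f f' : F) :
    ⟪htmul e f, htmul e' f'⟫_ℂ = ⟪e, e'⟫_ℂ * ⟪f, f'⟫_ℂ := by
  rw [htmul, htmul, UniformSpace.Completion.inner_coe, TensorProduct.inner_tmul]

theorem ext_clm {Y : Type*} [NormedAddCommGroup Y] [NormedSpace ℂ Y]
    {S T : HTensor E F →L[ℂ] Y} (h : ∀ e f, S (htmul e f) = T (htmul e f)) : S = T := by
  refine ContinuousLinearMap.ext fun x => ?_
  refine UniformSpace.Completion.induction_on x (isClosed_eq S.continuous T.continuous) fun a => ?_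
  induction a using TensorProduct.induction_on with
  | zero => rw [UniformSpace.Completion.coe_zero, map_zero, map_zero]
  | tmul e f => exact h e f
  | add x y hx hy => rw [UniformSpace.Completion.coe_add, map_add, map_add, hx, hy]

theorem ext_ket {Y : Type*} [NormedAddCommGroup Y] [NormedSpace ℂ Y]
    {S T : HTensor E F →L[ℂ] Y} (h : ∀ k, S ∘L ket k = T ∘L ket k) : S = T :=
  ext_clm fun e f => DFunLike.congr_fun (h f) e

theorem dense_span_htmul :
    Dense (Submodule.span ℂ {v : HTensor E F | ∃ e f, v = htmul e f} : Set (HTensor E F)) := by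
  have h : Set.range ((↑) : E ⊗[ℂ] F → HTensor E F) ⊆
      (Submodule.span ℂ {v : HTensor E F | ∃ e f, v = htmul e f} : Set (HTensor E F)) := by
    rintro _ ⟨a, rfl⟩
    induction a using TensorProduct.induction_on with
    | zero =>
      rw [UniformSpace.Completion.coe_zero]
      exact Submodule.zero_mem _
    | tmul e f => exact Submodule.subset_span ⟨e, f, rfl⟩
    | add x y hx hy =>
      rw [UniformSpace.Completion.coe_add]
      exact Submodule.add_mem _ hx hy
  exact UniformSpace.Completion.denseRange_coe.mono h

theorem ext_inner {x y : HTensor E F} (h : ∀ e f, ⟪htmul e f, x⟫_ℂ = ⟪htmul e f, y⟫_ℂ) :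
    x = y := by
  refine ext_inner_left ℂ fun v => ?_
  refine UniformSpace.Completion.induction_on v (isClosed_eq (by fun_prop) (by fun_prop)) fun a => ?_
  induction a using TensorProduct.induction_on with
  | zero => rw [UniformSpace.Completion.coe_zero, inner_zero_left, inner_zero_left]
  | tmul e f => exact h e f
  | add x y hx hy => rw [UniformSpace.Completion.coe_add, inner_add_left, inner_add_left, hx, hy]

/-- The tensor product `b ⊗ k` of two bounded operators. -/
def map (b : E →L[ℂ] E') (k : F →L[ℂ] F') : HTensor E F →L[ℂ] HTensor E' F' :=
  (UniformSpace.Completion.toComplL ∘L TensorProduct.mapL b k).extend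
      (UniformSpace.Completion.toComplL : E ⊗[ℂ] F →L[ℂ] HTensor E F)

@[simp]
theorem map_htmul (b : E →L[ℂ] E') (k : F →L[ℂ] F') (e : E) (f : F) :
    map b k (htmul e f) = htmul (b e) (k f) :=
  ContinuousLinearMap.extend_eq _ UniformSpace.Completion.denseRange_coe
    (UniformSpace.Completion.isUniformInducing_coe _) (e ⊗ₜ[ℂ] f)

theorem norm_map_le (b : E →L[ℂ] E') (k : F →L[ℂ] F') : ‖map b k‖ ≤ ‖b‖ * ‖k‖ := by
  refine ContinuousLinearMap.opNorm_le_bound _ (by positivity) fun x => ?_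
  refine UniformSpace.Completion.induction_on x
    (isClosed_le (by fun_prop) (by fun_prop)) fun a => ?_
  have : map b k (a : HTensor E F) = ((TensorProduct.mapL b k a : E' ⊗[ℂ] F') : HTensor E' F') :=
    ContinuousLinearMap.extend_eq _ UniformSpace.Completion.denseRange_coe
      (UniformSpace.Completion.isUniformInducing_coe _) a
  rw [this, UniformSpace.Completion.norm_coe, UniformSpace.Completion.norm_coe]
  exact (ContinuousLinearMap.le_opNorm _ _).trans
    (mul_le_mul_of_nonneg_right (TensorProduct.norm_mapL_le b k) (norm_nonneg _))

theorem hmap_eq_map (S : E →ₗᵢ[ℂ] E') (T : F →ₗᵢ[ℂ] F') :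
    hmap S T = map S.toContinuousLinearMap T.toContinuousLinearMap :=
  ext_clm fun e f => by simp [hmap_htmul]

theorem map_comp_ket (b : E →L[ℂ] E') (k : F →L[ℂ] F') (f : F) :
    map b k ∘L ket f = ket (k f) ∘L b := by
  ext e; simp [ket_apply]

/-- `k ↦ b ⊗ k` as a continuous linear map. -/
def mapRightL (b : E →L[ℂ] E') : (F →L[ℂ] F') →L[ℂ] HTensor E F →L[ℂ] HTensor E' F' :=
  LinearMap.mkContinuous
    { toFun := map b
      map_add' := fun k k' => ext_clm fun e f => by
        simp [htmul_add]
      map_smul' := fun c k => ext_clm fun e f => by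
        simp [htmul_smul] }
    ‖b‖ (norm_map_le b)

/-- A bounded operator on `E ⊗ F` is obtained from a linear family `c f` of operators on `E`,
`f ∈ F`, as soon as the estimate holds on the algebraic tensor product. -/
theorem exists_clm [CompleteSpace X] (c : F →ₗ[ℂ] E →L[ℂ] X) (C : ℝ)
    (hc : ∀ v : E ⊗[ℂ] F, ‖TensorProduct.lift (((ContinuousLinearMap.coeLM ℂ).comp c).flip) v‖
      ≤ C * ‖v‖) :
    ∃ T : HTensor E F →L[ℂ] X, ∀ k, T ∘L ket k = c k := by
  have hd : DenseRange (UniformSpace.Completion.toComplL : E ⊗[ℂ] F →L[ℂ] HTensor E F) :=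
    UniformSpace.Completion.denseRange_coe
  refine ⟨(TensorProduct.lift (((ContinuousLinearMap.coeLM ℂ).comp c).flip)).extendOfNorm
    ((UniformSpace.Completion.toComplL : E ⊗[ℂ] F →L[ℂ] HTensor E F) :
      E ⊗[ℂ] F →ₗ[ℂ] HTensor E F), fun k => ?_⟩
  ext e
  refine (LinearMap.extendOfNorm_eq hd ⟨C, fun x => ?_⟩ (e ⊗ₜ[ℂ] k)).trans ?_
  · refine (hc x).trans_eq ?_
    change _ = C * ‖(x : HTensor E F)‖
    rw [UniformSpace.Completion.norm_coe]
  · simp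

/-- A linear family of operators `c f : E → X` with `(c f)† (c f') = ⟪f, f'⟫` is the family of
columns of an isometry `E ⊗ F → X`. -/
theorem exists_isometry [CompleteSpace X] (c : F →ₗ[ℂ] E →L[ℂ] X)
    (hc : ∀ e e' f f', ⟪c f e, c f' e'⟫_ℂ = ⟪e, e'⟫_ℂ * ⟪f, f'⟫_ℂ) :
    ∃ J : HTensor E F →ₗᵢ[ℂ] X, ∀ e f, J (htmul e f) = c f e := by
  let τ := TensorProduct.lift (((ContinuousLinearMap.coeLM ℂ).comp c).flip)
  have hτ (e : E) (k : F) : τ (e ⊗ₜ k) = c k e := rfl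
  have key (v w : E ⊗[ℂ] F) : ⟪τ v, τ w⟫_ℂ = ⟪v, w⟫_ℂ := by
    induction v using TensorProduct.induction_on with
    | zero => simp
    | add v v' hv hv' => rw [map_add, inner_add_left, inner_add_left, hv, hv']
    | tmul e k =>
      induction w using TensorProduct.induction_on with
      | zero => simp
      | add v v' hv hv' => rw [map_add, inner_add_right, inner_add_right, hv, hv']
      | tmul e' l => rw [hτ, hτ, hc, TensorProduct.inner_tmul]
  have hnorm (v : E ⊗[ℂ] F) : ‖τ v‖ = ‖v‖ := (τ.isometryOfInner key).norm_map v
  obtain ⟨T, hT⟩ := exists_clm c 1 (fun v => by rw [one_mul]; exact (hnorm v).le)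
  have hT' (v : E ⊗[ℂ] F) : T (v : HTensor E F) = τ v := by
    induction v using TensorProduct.induction_on with
    | zero => rw [UniformSpace.Completion.coe_zero, map_zero, map_zero]
    | add v v' hv hv' => rw [UniformSpace.Completion.coe_add, map_add, map_add, hv, hv']
    | tmul e k => exact DFunLike.congr_fun (hT k) e
  have hiso (v : HTensor E F) : ‖T v‖ = ‖v‖ := by
    refine UniformSpace.Completion.induction_on v
      (isClosed_eq (by fun_prop) (by fun_prop)) fun a => ?_
    rw [hT', hnorm, UniformSpace.Completion.norm_coe]
  exact ⟨⟨T, hiso⟩, fun η f => DFunLike.congr_fun (hT f) η⟩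

variable [CompleteSpace E]

/-- The operator `1 ⊗ ⟨k| : E ⊗ F → E`. -/
def bra (k : F) : HTensor E F →L[ℂ] E := (ket k : E →L[ℂ] HTensor E F).adjoint

theorem bra_htmul (k : F) (e : E) (f : F) : bra k (htmul e f) = ⟪k, f⟫_ℂ • e := by
  refine ext_inner_left ℂ fun e' => ?_
  rw [bra, ContinuousLinearMap.adjoint_inner_right, ket_apply, inner_htmul, inner_smul_right,
    mul_comm]

theorem inner_bra (k : F) (e : E) (v : HTensor E F) : ⟪e, bra k v⟫_ℂ = ⟪htmul e k, v⟫_ℂ := by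
  rw [bra, ContinuousLinearMap.adjoint_inner_right, ket_apply]

theorem adjoint_bra (k : F) : (bra k : HTensor E F →L[ℂ] E).adjoint = ket k := by
  rw [bra, ContinuousLinearMap.adjoint_adjoint]

theorem bra_comp_ket (k l : F) : (bra k ∘L ket l : E →L[ℂ] E) = ⟪k, l⟫_ℂ • 1 := by
  ext e; simp [ket_apply, bra_htmul]

theorem ket_comp_bra (k : F') (l : F) :
    (ket k ∘L bra l : HTensor E F →L[ℂ] HTensor E F') =
      map (ContinuousLinearMap.id ℂ E) (InnerProductSpace.rankOne ℂ k l) :=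
  ext_clm fun e f => by
    simp [ket_apply, bra_htmul, htmul_smul]

theorem bra_ext {x y : HTensor E F} (h : ∀ k, bra k x = bra k y) : x = y :=
  ext_inner fun e f => by rw [← inner_bra, ← inner_bra, h f]

end Basic

end HTensor

open scoped HTensor

/-! ### Columns over a C*-algebra and their amplifications -/

namespace HTensor

section Columns

variable {D : Type*} [CStarAlgebra D]
  {E E' K K₂ K₃ : Type*}
  [NormedAddCommGroup E] [InnerProductSpace ℂ E] [CompleteSpace E]
  [NormedAddCommGroup E'] [InnerProductSpace ℂ E'] [CompleteSpace E']
  [NormedAddCommGroup K] [InnerProductSpace ℂ K]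
  [NormedAddCommGroup K₂] [InnerProductSpace ℂ K₂]
  [NormedAddCommGroup K₃] [InnerProductSpace ℂ K₃]
  (π : D →⋆ₐ[ℂ] (E →L[ℂ] E)) (π' : D →⋆ₐ[ℂ] (E' →L[ℂ] E'))

/-- The column space `π(D) ⊗ K`: the closed span of the operators `η ↦ π(d) η ⊗ k`. If `π` is
faithful, it is the Hilbert `D`-module `D ⊗ K`. -/
def col (K : Type*) [NormedAddCommGroup K] [InnerProductSpace ℂ K] :
    Submodule ℂ (E →L[ℂ] HTensor E K) :=
  (Submodule.span ℂ {c | ∃ d k, c = ket k ∘L π d}).topologicalClosure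

/-- Pairs of columns which represent the same element of `D ⊗ K` in the two representations. -/
def colPair (K : Type*) [NormedAddCommGroup K] [InnerProductSpace ℂ K] :
    Submodule ℂ ((E →L[ℂ] HTensor E K) × (E' →L[ℂ] HTensor E' K)) :=
  (Submodule.span ℂ {c | ∃ d k, c = (ket k ∘L π d, ket k ∘L π' d)}).topologicalClosure

variable {π π'}

theorem isClosed_colPair : IsClosed
    (colPair π π' K : Set ((E →L[ℂ] HTensor E K) × (E' →L[ℂ] HTensor E' K))) :=
  Submodule.isClosed_topologicalClosure _

theorem ket_comp_mem_col (d : D) (k : K) : ket k ∘L π d ∈ col π K :=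
  Submodule.le_topologicalClosure _ (Submodule.subset_span ⟨d, k, rfl⟩)

theorem ket_mem_col (k : K) : ket k ∈ col π K := by
  simpa [ContinuousLinearMap.one_def] using ket_comp_mem_col (π := π) 1 k

theorem ket_comp_mem_colPair (d : D) (k : K) :
    (ket k ∘L π d, ket k ∘L π' d) ∈ colPair π π' K :=
  Submodule.le_topologicalClosure _ (Submodule.subset_span ⟨d, k, rfl⟩)

theorem ket_mem_colPair (k : K) : (ket k, ket k) ∈ colPair π π' K := by
  simpa [ContinuousLinearMap.one_def] using ket_comp_mem_colPair (π := π) (π' := π') 1 k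

/-- A pair of continuous linear maps which preserves generators preserves pairs of columns. -/
theorem map_mem_colPair {D₂ E₂ E₂' : Type*} [CStarAlgebra D₂]
    [NormedAddCommGroup E₂] [InnerProductSpace ℂ E₂] [CompleteSpace E₂]
    [NormedAddCommGroup E₂'] [InnerProductSpace ℂ E₂'] [CompleteSpace E₂']
    {π₂ : D₂ →⋆ₐ[ℂ] (E₂ →L[ℂ] E₂)} {π₂' : D₂ →⋆ₐ[ℂ] (E₂' →L[ℂ] E₂')}
    (Φ : (E →L[ℂ] HTensor E K) →L[ℂ] (E₂ →L[ℂ] HTensor E₂ K₂))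
    (Φ' : (E' →L[ℂ] HTensor E' K) →L[ℂ] (E₂' →L[ℂ] HTensor E₂' K₂))
    (h : ∀ d k, (Φ (ket k ∘L π d), Φ' (ket k ∘L π' d)) ∈ colPair π₂ π₂' K₂)
    {x : (E →L[ℂ] HTensor E K) × (E' →L[ℂ] HTensor E' K)} (hx : x ∈ colPair π π' K) :
    (Φ x.1, Φ' x.2) ∈ colPair π₂ π₂' K₂ := by
  have hle : colPair π π' K ≤ (colPair π₂ π₂' K₂).comap
      ((Φ.prodMap Φ' : _ →L[ℂ] _) : _ →ₗ[ℂ] _) := by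
    refine Submodule.topologicalClosure_minimal _ (Submodule.span_le.2 ?_) ?_
    · rintro _ ⟨d, k, rfl⟩
      exact h d k
    · exact (Submodule.isClosed_topologicalClosure _).preimage (Φ.prodMap Φ').continuous
  exact hle hx

theorem mem_col_of_mem_colPair {x : (E →L[ℂ] HTensor E K) × (E' →L[ℂ] HTensor E' K)}
    (hx : x ∈ colPair π π' K) : x.1 ∈ col π K := by
  have hle : colPair π π' K ≤ (col π K).comap (LinearMap.fst ℂ _ _) := by
    refine Submodule.topologicalClosure_minimal _ (Submodule.span_le.2 ?_) ?_
    · rintro _ ⟨d, k, rfl⟩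
      exact ket_comp_mem_col d k
    · exact (Submodule.isClosed_topologicalClosure _).preimage continuous_fst
  exact hle hx

theorem comp_mem_colPair {x : (E →L[ℂ] HTensor E K) × (E' →L[ℂ] HTensor E' K)}
    (hx : x ∈ colPair π π' K) (d : D) : (x.1 ∘L π d, x.2 ∘L π' d) ∈ colPair π π' K :=
  map_mem_colPair ((ContinuousLinearMap.compL ℂ E E (HTensor E K)).flip (π d))
    ((ContinuousLinearMap.compL ℂ E' E' (HTensor E' K)).flip (π' d))
    (fun d' k => by
      simpa [ContinuousLinearMap.comp_assoc, ContinuousLinearMap.mul_def] using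
        ket_comp_mem_colPair (π := π) (π' := π') (d' * d) k) hx

theorem norm_apply_le_norm_apply (hπ : Function.Injective π) (d : D) : ‖π' d‖ ≤ ‖π d‖ :=
  (NonUnitalStarAlgHom.norm_apply_le π' d).trans_eq (NonUnitalStarAlgHom.norm_map π hπ d).symm

theorem isClosed_range_prod (hπ : Function.Injective π) :
    IsClosed (Set.range fun d => (π d, π' d)) := by
  have : Isometry fun d => (π d, π' d) := by
    refine Isometry.of_dist_eq fun a b => ?_
    rw [Prod.dist_eq, dist_eq_norm, dist_eq_norm, dist_eq_norm, ← map_sub, ← map_sub,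
      max_eq_left (norm_apply_le_norm_apply hπ _)]
    exact NonUnitalStarAlgHom.norm_map π hπ _
  exact this.isClosedEmbedding.isClosed_range

theorem adjoint_ket_comp (d d' : D) (k k' : K) :
    (ket k ∘L π d).adjoint ∘L (ket k' ∘L π d') = π (⟪k, k'⟫_ℂ • (star d * d')) := by
  have h (v : E) : (ket k).adjoint (ket k' v) = ⟪k, k'⟫_ℂ • v := bra_htmul k v k'
  ext v
  rw [ContinuousLinearMap.adjoint_comp, map_smul, map_mul, map_star,
    ContinuousLinearMap.star_eq_adjoint]
  change (π d).adjoint ((ket k).adjoint (ket k' (π d' v))) = _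
  rw [h, map_smul]
  rfl

/-- The `D`-valued inner product of two columns, computed in both representations. -/
theorem exists_adjoint_comp_eq (hπ : Function.Injective π)
    {x y : (E →L[ℂ] HTensor E K) × (E' →L[ℂ] HTensor E' K)}
    (hx : x ∈ colPair π π' K) (hy : y ∈ colPair π π' K) :
    ∃ d, x.1.adjoint ∘L y.1 = π d ∧ x.2.adjoint ∘L y.2 = π' d := by
  have key : (x.1.adjoint ∘L y.1, x.2.adjoint ∘L y.2) ∈
      closure (Set.range fun d => (π d, π' d)) := by
    refine map_mem_closure₂
      (f := fun x y : (E →L[ℂ] HTensor E K) × (E' →L[ℂ] HTensor E' K) =>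
        (x.1.adjoint ∘L y.1, x.2.adjoint ∘L y.2)) ?_ hx hy ?_
    · have h1 := (ContinuousLinearMap.adjoint (𝕜 := ℂ) (E := E) (F := HTensor E K)).continuous
      have h2 := (ContinuousLinearMap.adjoint (𝕜 := ℂ) (E := E') (F := HTensor E' K)).continuous
      exact ((h1.comp (continuous_fst.comp continuous_fst)).clm_comp
        (continuous_fst.comp continuous_snd)).prodMk
        ((h2.comp (continuous_snd.comp continuous_fst)).clm_comp
        (continuous_snd.comp continuous_snd))
    · intro a ha b hb
      induction ha using Submodule.span_induction with
      | mem a ha =>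
        obtain ⟨d, k, rfl⟩ := ha
        induction hb using Submodule.span_induction with
        | mem b hb =>
          obtain ⟨d', k', rfl⟩ := hb
          refine ⟨⟪k, k'⟫_ℂ • (star d * d'), ?_⟩
          exact Prod.ext (adjoint_ket_comp d d' k k').symm (adjoint_ket_comp d d' k k').symm
        | zero => exact ⟨0, by simp⟩
        | add b b' _ _ hb hb' =>
          obtain ⟨d, hd⟩ := hb
          obtain ⟨d', hd'⟩ := hb'
          simp only [Prod.mk.injEq] at hd hd'
          refine ⟨d + d', Prod.ext ?_ ?_⟩
          · simp only [map_add, hd.1, hd'.1, Prod.fst_add, ContinuousLinearMap.comp_add]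
          · simp only [map_add, hd.2, hd'.2, Prod.snd_add, ContinuousLinearMap.comp_add]
        | smul c b _ hb =>
          obtain ⟨d, hd⟩ := hb
          simp only [Prod.mk.injEq] at hd
          refine ⟨c • d, Prod.ext ?_ ?_⟩
          · simp only [map_smul, hd.1, Prod.smul_fst, ContinuousLinearMap.comp_smul]
          · simp only [map_smul, hd.2, Prod.smul_snd, ContinuousLinearMap.comp_smul]
      | zero => exact ⟨0, by simp⟩
      | add a a' _ _ ha ha' =>
        obtain ⟨d, hd⟩ := ha
        obtain ⟨d', hd'⟩ := ha'
        simp only [Prod.mk.injEq] at hd hd'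
        refine ⟨d + d', Prod.ext ?_ ?_⟩
        · simp only [map_add, hd.1, hd'.1, Prod.fst_add, ContinuousLinearMap.add_comp]
        · simp only [map_add, hd.2, hd'.2, Prod.snd_add, ContinuousLinearMap.add_comp]
      | smul c a _ ha =>
        obtain ⟨d, hd⟩ := ha
        simp only [Prod.mk.injEq] at hd
        refine ⟨(starRingEnd ℂ) c • d, Prod.ext ?_ ?_⟩
        · simp only [map_smul, hd.1, Prod.smul_fst, map_smulₛₗ, ContinuousLinearMap.smul_comp]
        · simp only [map_smul, hd.2, Prod.smul_snd, map_smulₛₗ, ContinuousLinearMap.smul_comp]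
  rw [(isClosed_range_prod hπ).closure_eq] at key
  obtain ⟨d, hd⟩ := key
  exact ⟨d, (Prod.mk.inj hd).1.symm, (Prod.mk.inj hd).2.symm⟩

/-- The norm of a column is that of its inner square in `D`, and representations do not increase
norms. -/
theorem norm_snd_le (hπ : Function.Injective π)
    {x : (E →L[ℂ] HTensor E K) × (E' →L[ℂ] HTensor E' K)} (hx : x ∈ colPair π π' K) :
    ‖x.2‖ ≤ ‖x.1‖ := by
  obtain ⟨d, h1, h2⟩ := exists_adjoint_comp_eq hπ hx hx
  refine (mul_self_le_mul_self_iff (norm_nonneg x.2) (norm_nonneg x.1)).2 ?_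
  rw [← ContinuousLinearMap.norm_adjoint_comp_self x.2,
    ← ContinuousLinearMap.norm_adjoint_comp_self x.1, h1, h2]
  exact norm_apply_le_norm_apply hπ d

theorem snd_eq_of_fst_eq (hπ : Function.Injective π) {c : E →L[ℂ] HTensor E K}
    {c₁ c₂ : E' →L[ℂ] HTensor E' K} (h₁ : (c, c₁) ∈ colPair π π' K)
    (h₂ : (c, c₂) ∈ colPair π π' K) : c₁ = c₂ := by
  have h := norm_snd_le hπ (Submodule.sub_mem _ h₁ h₂)
  simp only [Prod.mk_sub_mk, sub_self] at h
  rw [norm_zero] at h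
  exact sub_eq_zero.1 (norm_le_zero_iff.1 h)

/-- Every column over `D` has a counterpart in every other representation of `D`. -/
theorem exists_mem_colPair (hπ : Function.Injective π) {c : E →L[ℂ] HTensor E K}
    (hc : c ∈ col π K) : ∃ c' : E' →L[ℂ] HTensor E' K, (c, c') ∈ colPair π π' K := by
  have : CompleteSpace (colPair π π' K) :=
    (Submodule.isClosed_topologicalClosure _).completeSpace_coe
  let f : colPair π π' K →ₗᵢ[ℂ] (E →L[ℂ] HTensor E K) :=
    { toLinearMap := (LinearMap.fst ℂ _ _) ∘ₗ (colPair π π' K).subtype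
      norm_map' := fun x => by
        change ‖x.1.1‖ = ‖x.1‖
        rw [Prod.norm_def, max_eq_left (norm_snd_le hπ x.2)] }
  have hle : col π K ≤ LinearMap.range f.toLinearMap := by
    refine Submodule.topologicalClosure_minimal _ (Submodule.span_le.2 ?_) ?_
    · rintro _ ⟨d, k, rfl⟩
      exact ⟨⟨_, ket_comp_mem_colPair (π := π) (π' := π') d k⟩, rfl⟩
    · exact f.isometry.isUniformInducing.isComplete_range.isClosed
  obtain ⟨x, hx⟩ := hle hc
  refine ⟨x.1.2, ?_⟩
  have : c = x.1.1 := hx.symm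
  rw [this]
  exact x.2

end Columns
end HTensor

namespace HTensor

section Amp

variable {D : Type*} [CStarAlgebra D]
  {E E' K K₂ K₃ : Type*}
  [NormedAddCommGroup E] [InnerProductSpace ℂ E] [CompleteSpace E]
  [NormedAddCommGroup E'] [InnerProductSpace ℂ E'] [CompleteSpace E']
  [NormedAddCommGroup K] [InnerProductSpace ℂ K]
  [NormedAddCommGroup K₂] [InnerProductSpace ℂ K₂]
  [NormedAddCommGroup K₃] [InnerProductSpace ℂ K₃]
  (π : D →⋆ₐ[ℂ] (E →L[ℂ] E)) (π' : D →⋆ₐ[ℂ] (E' →L[ℂ] E'))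

/-- `T'` is obtained from `T` by passing from the representation `π` to `π'`: all columns of `T`
are columns over `D`, and the columns of `T'` represent the same elements of `D ⊗ K₂`. -/
def IsAmp (T : HTensor E K →L[ℂ] HTensor E K₂) (T' : HTensor E' K →L[ℂ] HTensor E' K₂) : Prop :=
  ∀ k, (T ∘L ket k, T' ∘L ket k) ∈ colPair π π' K₂

variable {π π'}

theorem IsAmp.comp_mem {T : HTensor E K →L[ℂ] HTensor E K₂} {T' : HTensor E' K →L[ℂ] HTensor E' K₂}
    (hT : IsAmp π π' T T') {x : (E →L[ℂ] HTensor E K) × (E' →L[ℂ] HTensor E' K)}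
    (hx : x ∈ colPair π π' K) : (T ∘L x.1, T' ∘L x.2) ∈ colPair π π' K₂ := by
  have h := map_mem_colPair (π₂ := π) (π₂' := π')
    (ContinuousLinearMap.compL ℂ E (HTensor E K) (HTensor E K₂) T)
    (ContinuousLinearMap.compL ℂ E' (HTensor E' K) (HTensor E' K₂) T')
    (fun d k => by
      have := comp_mem_colPair (hT k) d
      simpa only [ContinuousLinearMap.compL_apply, ContinuousLinearMap.comp_assoc] using this) hx
  simpa only [ContinuousLinearMap.compL_apply] using h

theorem IsAmp.comp {T : HTensor E K →L[ℂ] HTensor E K₂} {T' : HTensor E' K →L[ℂ] HTensor E' K₂}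
    {S : HTensor E K₂ →L[ℂ] HTensor E K₃} {S' : HTensor E' K₂ →L[ℂ] HTensor E' K₃}
    (hS : IsAmp π π' S S') (hT : IsAmp π π' T T') : IsAmp π π' (S ∘L T) (S' ∘L T') :=
  fun k => hS.comp_mem (hT k)

theorem IsAmp.map (F : K →L[ℂ] K₂) :
    IsAmp π π' (map (ContinuousLinearMap.id ℂ E) F) (map (ContinuousLinearMap.id ℂ E') F) :=
  fun k => by
    rw [map_comp_ket, map_comp_ket, ContinuousLinearMap.comp_id, ContinuousLinearMap.comp_id]
    exact ket_mem_colPair _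

theorem IsAmp.id : IsAmp π π' (ContinuousLinearMap.id ℂ (HTensor E K))
    (ContinuousLinearMap.id ℂ (HTensor E' K)) := fun k => ket_mem_colPair k

theorem IsAmp.add {T S : HTensor E K →L[ℂ] HTensor E K₂} {T' S' : HTensor E' K →L[ℂ] HTensor E' K₂}
    (hT : IsAmp π π' T T') (hS : IsAmp π π' S S') : IsAmp π π' (T + S) (T' + S') :=
  fun k => Submodule.add_mem _ (hT k) (hS k)

theorem IsAmp.smul (c : ℂ) {T : HTensor E K →L[ℂ] HTensor E K₂}
    {T' : HTensor E' K →L[ℂ] HTensor E' K₂}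
    (hT : IsAmp π π' T T') : IsAmp π π' (c • T) (c • T') :=
  fun k => Submodule.smul_mem _ c (hT k)

theorem IsAmp.unique (hπ : Function.Injective π) {T : HTensor E K →L[ℂ] HTensor E K₂}
    {T' T'' : HTensor E' K →L[ℂ] HTensor E' K₂}
    (h : IsAmp π π' T T') (h' : IsAmp π π' T T'') : T' = T'' :=
  ext_ket fun k => snd_eq_of_fst_eq hπ (h k) (h' k)

theorem IsAmp.exists_entry_eq (hπ : Function.Injective π) {T : HTensor E K →L[ℂ] HTensor E K₂}
    {T' : HTensor E' K →L[ℂ] HTensor E' K₂} (h : IsAmp π π' T T') (k : K₂) (l : K) :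
    ∃ d, bra k ∘L T ∘L ket l = π d ∧ bra k ∘L T' ∘L ket l = π' d := by
  have := exists_adjoint_comp_eq hπ (ket_mem_colPair (π := π) (π' := π') k) (h l)
  exact this

theorem bra_comp_adjoint_comp_ket {F : Type*} [NormedAddCommGroup F] [InnerProductSpace ℂ F]
    [CompleteSpace F] (T : HTensor F K →L[ℂ] HTensor F K₂) (k : K) (l : K₂) :
    (bra k ∘L T.adjoint ∘L ket l : F →L[ℂ] F) = (bra l ∘L T ∘L ket k).adjoint := by
  rw [ContinuousLinearMap.adjoint_comp, ContinuousLinearMap.adjoint_comp, adjoint_bra,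
    ContinuousLinearMap.comp_assoc]
  rfl

theorem ext_entry {F : Type*} [NormedAddCommGroup F] [InnerProductSpace ℂ F]
    [CompleteSpace F] {S T : HTensor F K →L[ℂ] HTensor F K₂}
    (h : ∀ k l, (bra k ∘L S ∘L ket l : F →L[ℂ] F) = bra k ∘L T ∘L ket l) : S = T :=
  ext_clm fun e l => bra_ext fun k => DFunLike.congr_fun (h k l) e

/-- An amplification of the adjoint is the adjoint of an amplification. -/
theorem IsAmp.adjoint_eq (hπ : Function.Injective π) {T : HTensor E K →L[ℂ] HTensor E K₂}
    {T' : HTensor E' K →L[ℂ] HTensor E' K₂} {S' : HTensor E' K₂ →L[ℂ] HTensor E' K}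
    (h : IsAmp π π' T T') (hS : IsAmp π π' T.adjoint S') : S' = T'.adjoint := by
  refine ext_entry fun k l => ?_
  obtain ⟨d, h1, h2⟩ := h.exists_entry_eq hπ l k
  obtain ⟨d', h3, h4⟩ := hS.exists_entry_eq hπ k l
  rw [bra_comp_adjoint_comp_ket, h1, ← ContinuousLinearMap.star_eq_adjoint, ← map_star] at h3
  rw [h4, bra_comp_adjoint_comp_ket, h2, ← hπ h3, map_star, ContinuousLinearMap.star_eq_adjoint]

/-- A family of columns `T ∘ ket k` over `D` can be transported to any other representation if
`T` is bounded in the strong sense `T* T + R* R = C` with another operator `R` of this kind. -/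
theorem exists_isAmp (hπ : Function.Injective π) (T : HTensor E K →L[ℂ] HTensor E K₂)
    (R : HTensor E K →L[ℂ] HTensor E K₃) (hT : ∀ k, T ∘L ket k ∈ col π K₂)
    (hR : ∀ k, R ∘L ket k ∈ col π K₃) (C : ℝ)
    (h : T.adjoint ∘L T + R.adjoint ∘L R = (C : ℂ) • ContinuousLinearMap.id ℂ _) :
    ∃ T' : HTensor E' K →L[ℂ] HTensor E' K₂, IsAmp π π' T T' := by
  choose t ht using fun k => exists_mem_colPair (π' := π') hπ (hT k)
  choose r hr using fun k => exists_mem_colPair (π' := π') hπ (hR k)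
  let tl : K →ₗ[ℂ] E' →L[ℂ] HTensor E' K₂ :=
    { toFun := t
      map_add' := fun k l => snd_eq_of_fst_eq hπ (ht (k + l)) (by
        simpa [ContinuousLinearMap.comp_add] using Submodule.add_mem _ (ht k) (ht l))
      map_smul' := fun c k => snd_eq_of_fst_eq hπ (ht (c • k)) (by
        simpa [ContinuousLinearMap.comp_smul] using Submodule.smul_mem _ c (ht k)) }
  let rl : K →ₗ[ℂ] E' →L[ℂ] HTensor E' K₃ :=
    { toFun := r
      map_add' := fun k l => snd_eq_of_fst_eq hπ (hr (k + l)) (by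
        simpa [ContinuousLinearMap.comp_add] using Submodule.add_mem _ (hr k) (hr l))
      map_smul' := fun c k => snd_eq_of_fst_eq hπ (hr (c • k)) (by
        simpa [ContinuousLinearMap.comp_smul] using Submodule.smul_mem _ c (hr k)) }
  let τ := TensorProduct.lift (((ContinuousLinearMap.coeLM ℂ).comp tl).flip)
  let σ := TensorProduct.lift (((ContinuousLinearMap.coeLM ℂ).comp rl).flip)
  have hτ (e : E') (k : K) : τ (e ⊗ₜ k) = t k e := rfl
  have hσ (e : E') (k : K) : σ (e ⊗ₜ k) = r k e := rfl
  have entry (k l : K) : (t k).adjoint ∘L t l + (r k).adjoint ∘L r l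
      = ((C : ℂ) * ⟪k, l⟫_ℂ) • ContinuousLinearMap.id ℂ E' := by
    obtain ⟨d, h1, h2⟩ := exists_adjoint_comp_eq hπ (ht k) (ht l)
    obtain ⟨d', h3, h4⟩ := exists_adjoint_comp_eq hπ (hr k) (hr l)
    have h5 : π (d + d') = π (((C : ℂ) * ⟪k, l⟫_ℂ) • 1) := by
      have := congrArg (fun Z => bra k ∘L Z ∘L (ket l : E →L[ℂ] HTensor E K)) h
      simp only [ContinuousLinearMap.add_comp, ContinuousLinearMap.comp_add,
        ContinuousLinearMap.smul_comp, ContinuousLinearMap.comp_smul,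
        ContinuousLinearMap.id_comp, bra_comp_ket] at this
      rw [map_add, ← h1, ← h3, map_smul, map_one, mul_smul, ← this,
        ContinuousLinearMap.adjoint_comp, ContinuousLinearMap.adjoint_comp]
      rfl
    rw [h2, h4, ← map_add, hπ h5, map_smul, map_one]
    rfl
  have key (v w : E' ⊗[ℂ] K) : ⟪τ v, τ w⟫_ℂ + ⟪σ v, σ w⟫_ℂ = C * ⟪v, w⟫_ℂ := by
    induction v using TensorProduct.induction_on with
    | zero => simp
    | add v v' hv hv' =>
      rw [map_add, map_add, inner_add_left, inner_add_left, inner_add_left, mul_add, ← hv, ← hv']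
      ring
    | tmul e k =>
      induction w using TensorProduct.induction_on with
      | zero => simp
      | add v v' hv hv' =>
        rw [map_add, map_add, inner_add_right, inner_add_right, inner_add_right, mul_add,
          ← hv, ← hv']
        ring
      | tmul e' l =>
        have := congrArg (fun Z : E' →L[ℂ] E' => ⟪e, Z e'⟫_ℂ) (entry k l)
        simp only [add_apply, ContinuousLinearMap.comp_apply, inner_add_right,
          ContinuousLinearMap.adjoint_inner_right, smul_apply, ContinuousLinearMap.id_apply,
          inner_smul_right] at this
        rw [hτ, hτ, hσ, hσ, this, TensorProduct.inner_tmul]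
        ring
  obtain ⟨T', hT'⟩ := exists_clm (X := HTensor E' K₂) tl (Real.sqrt C) (fun v => by
    have h1 := key v v
    have hvv : ⟪v, v⟫_ℂ = (‖v‖ : ℂ) ^ 2 := inner_self_eq_norm_sq_to_K v
    rw [inner_self_eq_norm_sq_to_K, inner_self_eq_norm_sq_to_K, hvv] at h1
    have h2 : ‖τ v‖ ^ 2 + ‖σ v‖ ^ 2 = C * ‖v‖ ^ 2 :=
      Complex.ofReal_injective (by push_cast; exact h1)
    change ‖τ v‖ ≤ _
    by_cases hv : ‖v‖ = 0
    · have : ‖τ v‖ ^ 2 = 0 := by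
        rw [hv] at h2
        nlinarith [sq_nonneg ‖τ v‖, sq_nonneg ‖σ v‖]
      rw [hv, mul_zero, pow_eq_zero_iff two_ne_zero |>.1 this]
    · have hC : 0 ≤ C := by
        by_contra hC
        have : 0 < ‖v‖ ^ 2 := by positivity
        nlinarith [sq_nonneg ‖τ v‖, sq_nonneg ‖σ v‖]
      refine abs_le_of_sq_le_sq' ?_ (by positivity) |>.2
      rw [mul_pow, Real.sq_sqrt hC]
      nlinarith [sq_nonneg ‖σ v‖])
  exact ⟨T', fun k => by rw [hT' k]; exact ht k⟩

/-- An amplification of an isometry is an isometry. -/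
theorem IsAmp.adjoint_comp_self_eq_id (hπ : Function.Injective π)
    {T : HTensor E K →L[ℂ] HTensor E K₂} {T' : HTensor E' K →L[ℂ] HTensor E' K₂}
    (h : IsAmp π π' T T') (hT : T.adjoint ∘L T = ContinuousLinearMap.id ℂ _) :
    T'.adjoint ∘L T' = ContinuousLinearMap.id ℂ _ := by
  refine ext_entry fun k l => ?_
  obtain ⟨d, h1, h2⟩ := exists_adjoint_comp_eq hπ (h k) (h l)
  have h3 : π d = π (⟪k, l⟫_ℂ • 1) := by
    rw [← h1, map_smul, map_one, ← bra_comp_ket, ContinuousLinearMap.adjoint_comp,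
      ContinuousLinearMap.comp_assoc, ← ContinuousLinearMap.comp_assoc T.adjoint, hT]
    rfl
  rw [ContinuousLinearMap.id_comp, bra_comp_ket]
  rw [hπ h3, map_smul, map_one, ContinuousLinearMap.adjoint_comp] at h2
  exact h2

/-- Operators in the closed span of the operators of rank one. -/
def finiteRankClosure (K K₂ : Type*) [NormedAddCommGroup K] [InnerProductSpace ℂ K]
    [NormedAddCommGroup K₂] [InnerProductSpace ℂ K₂] : Submodule ℂ (K →L[ℂ] K₂) :=
  (Submodule.span ℂ {F | ∃ k l, F = InnerProductSpace.rankOne ℂ k l}).topologicalClosure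

/-- The adjoint of an operator all of whose columns are columns over `D` may fail to have this
property, but it is recovered by multiplication with a compact operator on the second factor. -/
theorem IsAmp.map_comp_adjoint (hπ : Function.Injective π)
    {T : HTensor E K →L[ℂ] HTensor E K₂} {T' : HTensor E' K →L[ℂ] HTensor E' K₂}
    (h : IsAmp π π' T T') {F : K →L[ℂ] K₃} (hF : F ∈ finiteRankClosure K K₃) :
    IsAmp π π' (HTensor.map (ContinuousLinearMap.id ℂ E) F ∘L T.adjoint)
      (HTensor.map (ContinuousLinearMap.id ℂ E') F ∘L T'.adjoint) := by
  intro k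
  let Φ := (ContinuousLinearMap.compL ℂ E (HTensor E K) (HTensor E K₃)).flip
    (T.adjoint ∘L ket k) ∘L mapRightL (F := K) (F' := K₃) (ContinuousLinearMap.id ℂ E)
  let Φ' := (ContinuousLinearMap.compL ℂ E' (HTensor E' K) (HTensor E' K₃)).flip
    (T'.adjoint ∘L ket k) ∘L mapRightL (F := K) (F' := K₃) (ContinuousLinearMap.id ℂ E')
  have hle : finiteRankClosure K K₃ ≤ (colPair π π' K₃).comap
      ((Φ.prod Φ' : _ →L[ℂ] _) : _ →ₗ[ℂ] _) := by
    refine Submodule.topologicalClosure_minimal _ (Submodule.span_le.2 ?_) ?_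
    · rintro _ ⟨l, m, rfl⟩
      obtain ⟨d, h1, h2⟩ := exists_adjoint_comp_eq hπ (h m) (ket_mem_colPair k)
      have := ket_comp_mem_colPair (π := π) (π' := π') d l
      rw [← h1, ← h2] at this
      simp only [ContinuousLinearMap.adjoint_comp] at this
      change (HTensor.map (ContinuousLinearMap.id ℂ E) (InnerProductSpace.rankOne ℂ l m) ∘L
          T.adjoint ∘L ket k, HTensor.map (ContinuousLinearMap.id ℂ E')
          (InnerProductSpace.rankOne ℂ l m) ∘L T'.adjoint ∘L ket k) ∈ colPair π π' K₃
      rw [← ket_comp_bra, ← ket_comp_bra]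
      exact this
    · exact (Submodule.isClosed_topologicalClosure _).preimage (Φ.prod Φ').continuous
  exact hle hF

end Amp
end HTensor

/-! ### The spaces `L²(G, E)` -/

section LTwoBasic

variable {G : Type*} [Group G] [TopologicalSpace G] [IsTopologicalGroup G] [CompactSpace G]
  [T2Space G] [MeasurableSpace G] [BorelSpace G]

instance haarP_regular : (haarP G).Regular :=
  inferInstanceAs (Measure.haarMeasure (⊤ : PositiveCompacts G)).Regular

instance haarP_isInvInvariant : (haarP G).IsInvInvariant where
  inv_eq_self := by
    have : IsProbabilityMeasure (haarP G).inv :=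
      Measure.isProbabilityMeasure_map measurable_inv.aemeasurable
    have h := Measure.isMulInvariant_eq_smul_of_compactSpace (haarP G).inv (haarP G)
    have h1 := congrArg (fun m : Measure G => m Set.univ) h
    simp only [measure_univ, Measure.smul_apply] at h1
    rw [h]
    have h2 : (haarP G).inv.haarScalarFactor (haarP G) = 1 := by
      have h3 : (((haarP G).inv.haarScalarFactor (haarP G) : NNReal) : ENNReal) = 1 := by
        simpa [ENNReal.smul_def] using h1.symm
      exact_mod_cast h3
    rw [h2, one_smul]

theorem stronglyMeasurable_continuousMap {X : Type*} [TopologicalSpace X]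
    [PseudoMetrizableSpace X] [Zero X] (f : C(G, X)) : StronglyMeasurable f :=
  f.continuous.stronglyMeasurable_of_hasCompactSupport (HasCompactSupport.of_compactSpace f)

theorem integrable_of_continuous {X : Type*} [NormedAddCommGroup X] {f : G → X}
    (hf : Continuous f) : Integrable f (haarP G) :=
  hf.integrable_of_hasCompactSupport (HasCompactSupport.of_compactSpace f)

theorem norm_integral_haarP_le {X : Type*} [NormedAddCommGroup X] [NormedSpace ℝ X] {f : G → X}
    {C : ℝ} (h : ∀ g, ‖f g‖ ≤ C) : ‖∫ g, f g ∂haarP G‖ ≤ C := by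
  simpa using norm_integral_le_of_norm_le_const (μ := haarP G) (Filter.Eventually.of_forall h)

variable {E E' : Type*} [NormedAddCommGroup E] [InnerProductSpace ℂ E]
  [NormedAddCommGroup E'] [InnerProductSpace ℂ E']

theorem memLp_continuousMap (f : C(G, E)) : MemLp f 2 (haarP G) :=
  MemLp.of_bound (stronglyMeasurable_continuousMap f).aestronglyMeasurable ‖f‖
    (Filter.Eventually.of_forall f.norm_coe_le_norm)

/-- The inclusion of the continuous functions into `L²(G, E)`. -/
def ctsL : C(G, E) →L[ℂ] LTwo G E :=
  LinearMap.mkContinuous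
    { toFun := fun f => (memLp_continuousMap f).toLp f
      map_add' := fun _ _ => rfl
      map_smul' := fun _ _ => rfl } 1 (fun f => by
    rw [one_mul]
    refine (Lp.norm_le_of_ae_bound (norm_nonneg f) (C := ‖f‖) ?_).trans ?_
    · filter_upwards [MemLp.coeFn_toLp (memLp_continuousMap f)] with h hh
      exact (congrArg norm hh).trans_le (f.norm_coe_le_norm h)
    · simp [measureUnivNNReal])

theorem coeFn_ctsL (f : C(G, E)) : ctsL f =ᵐ[haarP G] f :=
  MemLp.coeFn_toLp (memLp_continuousMap f)

theorem ctsL_injective : Function.Injective (ctsL : C(G, E) →L[ℂ] LTwo G E) := by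
  intro f f' h
  have h1 : (f : G → E) =ᵐ[haarP G] f' :=
    (coeFn_ctsL f).symm.trans ((congrArg (fun v : LTwo G E => (v : G → E)) h) ▸ coeFn_ctsL f')
  exact DFunLike.coe_injective ((Continuous.ae_eq_iff_eq (haarP G) f.continuous f'.continuous).1 h1)

theorem coeFn_ltmul (η : E) (f : LTwo G ℂ) : ltmul η f =ᵐ[haarP G] fun h => f h • η := by
  filter_upwards [ContinuousLinearMap.coeFn_compLp (ContinuousLinearMap.toSpanSingleton ℂ η) f]
    with h hh
  rw [ltmul, hh, ContinuousLinearMap.toSpanSingleton_apply]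

theorem inner_ltmul (η η' : E) (f f' : LTwo G ℂ) :
    ⟪ltmul η f, ltmul η' f'⟫_ℂ = ⟪η, η'⟫_ℂ * ⟪f, f'⟫_ℂ := by
  rw [L2.inner_def, L2.inner_def, ← integral_const_mul]
  refine integral_congr_ae ?_
  filter_upwards [coeFn_ltmul η f, coeFn_ltmul η' f'] with h h1 h2
  rw [h1, h2, inner_smul_left, inner_smul_right]
  simp only [RCLike.inner_apply]
  ring

theorem norm_ltmul (η : E) (f : LTwo G ℂ) : ‖ltmul η f‖ = ‖η‖ * ‖f‖ := by
  have h := inner_ltmul η η f f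
  rw [inner_self_eq_norm_sq_to_K, inner_self_eq_norm_sq_to_K, inner_self_eq_norm_sq_to_K,
    ← mul_pow] at h
  have h2 : ‖ltmul η f‖ ^ 2 = (‖η‖ * ‖f‖) ^ 2 := Complex.ofReal_injective (by push_cast; exact h)
  exact (pow_left_inj₀ (norm_nonneg _) (by positivity) two_ne_zero).1 h2

/-- `ltmul` as a continuous bilinear map, with the arguments exchanged. -/
def ltmulL : LTwo G ℂ →L[ℂ] E →L[ℂ] LTwo G E :=
  LinearMap.mkContinuous₂ (LinearMap.mk₂ ℂ (fun f η => ltmul η f)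
    (fun f f' η => by
      refine Lp.ext ?_
      filter_upwards [coeFn_ltmul η f, coeFn_ltmul η f', coeFn_ltmul η (f + f'), Lp.coeFn_add f f',
        Lp.coeFn_add (ltmul η f) (ltmul η f')] with h h1 h2 h3 h4 h5
      rw [h5, Pi.add_apply, h3, h4, Pi.add_apply, h1, h2, add_smul])
    (fun c f η => by
      refine Lp.ext ?_
      filter_upwards [coeFn_ltmul η f, coeFn_ltmul η (c • f), Lp.coeFn_smul c f,
        Lp.coeFn_smul c (ltmul η f)] with h h1 h2 h3 h4
      rw [h4, Pi.smul_apply, h2, h3, Pi.smul_apply, h1, smul_eq_mul, mul_smul])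
    (fun f η η' => by
      refine Lp.ext ?_
      filter_upwards [coeFn_ltmul η f, coeFn_ltmul η' f, coeFn_ltmul (η + η') f,
        Lp.coeFn_add (ltmul η f) (ltmul η' f)] with h h1 h2 h3 h4
      rw [h4, Pi.add_apply, h3, h1, h2, smul_add])
    (fun c f η => by
      refine Lp.ext ?_
      filter_upwards [coeFn_ltmul η f, coeFn_ltmul (c • η) f,
        Lp.coeFn_smul c (ltmul η f)] with h h1 h2 h3
      rw [h3, Pi.smul_apply, h1, h2, smul_comm]))
    1 (fun f η => by
      rw [LinearMap.mk₂_apply, norm_ltmul, one_mul, mul_comm])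

theorem ltmulL_apply (f : LTwo G ℂ) (η : E) : ltmulL f η = ltmul η f := rfl

theorem ltmul_ctsL (η : E) (φ : C(G, ℂ)) :
    ltmul η (ctsL φ) = ctsL (⟨fun h => φ h • η, by fun_prop⟩ : C(G, E)) := by
  refine Lp.ext ?_
  filter_upwards [coeFn_ltmul η (ctsL φ), coeFn_ctsL φ,
    coeFn_ctsL (⟨fun h => φ h • η, by fun_prop⟩ : C(G, E))] with h h1 h2 h3
  rw [h1, h2, h3]
  rfl

theorem denseRange_ctsL : DenseRange (ctsL : C(G, ℂ) →L[ℂ] LTwo G ℂ) := by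
  have h := ContinuousMap.toLp_denseRange ℂ (haarP G) ℂ (p := 2) (by simp)
  refine h.mono ?_
  rintro _ ⟨f, rfl⟩
  refine ⟨f, Lp.ext ?_⟩
  exact (coeFn_ctsL f).trans (ContinuousMap.coeFn_toLp (haarP G) f).symm

/-- A closed subspace of `L²(G, E)` which contains all elementary tensors is everything. -/
theorem mem_of_ltmul_mem (S : Submodule ℂ (LTwo G E)) (hS : IsClosed (S : Set (LTwo G E)))
    (h : ∀ η f, ltmul η f ∈ S) (v : LTwo G E) : v ∈ S := by
  refine Lp.induction (by simp) (fun v => v ∈ S) (fun c s hs hμs => ?_)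
    (fun f g _ _ _ h1 h2 => S.add_mem h1 h2) hS v
  convert h c (indicatorConstLp 2 hs hμs.ne 1)
  refine Lp.ext ?_
  rw [Lp.simpleFunc.coe_indicatorConst]
  filter_upwards [indicatorConstLp_coeFn (p := 2) (hs := hs) (hμs := hμs.ne) (c := c),
    indicatorConstLp_coeFn (p := 2) (hs := hs) (hμs := hμs.ne) (c := (1 : ℂ)),
    coeFn_ltmul c (indicatorConstLp 2 hs hμs.ne (1 : ℂ))] with x h1 h2 h3
  rw [h1, h3, h2]
  by_cases hx : x ∈ s <;> simp [hx]

theorem mem_of_ltmul_ctsL_mem (S : Submodule ℂ (LTwo G E)) (hS : IsClosed (S : Set (LTwo G E)))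
    (h : ∀ η φ, ltmul η (ctsL φ) ∈ S) (v : LTwo G E) : v ∈ S := by
  refine mem_of_ltmul_mem S hS (fun η f => ?_) v
  refine denseRange_ctsL.induction_on (p := fun f => ltmul η f ∈ S) f ?_ (h η)
  exact hS.preimage (by exact ((ltmulL (G := G) (E := E)).flip η).continuous)

theorem LTwo.ext_clm {Y : Type*} [NormedAddCommGroup Y] [NormedSpace ℂ Y]
    {S T : LTwo G E →L[ℂ] Y} (h : ∀ η φ, S (ltmul η (ctsL φ)) = T (ltmul η (ctsL φ))) :
    S = T := by
  refine ContinuousLinearMap.ext fun v => ?_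
  exact mem_of_ltmul_ctsL_mem (LinearMap.eqLocus (S : LTwo G E →ₗ[ℂ] Y) (T : LTwo G E →ₗ[ℂ] Y))
    (isClosed_eq S.continuous T.continuous) h v

theorem exists_tensorIsometry [CompleteSpace E] :
    ∃ J : HTensor E (LTwo G ℂ) ≃ₗᵢ[ℂ] LTwo G E, ∀ η f, J (htmul η f) = ltmul η f := by
  obtain ⟨J, hJ⟩ := HTensor.exists_isometry
    ((ltmulL : LTwo G ℂ →L[ℂ] E →L[ℂ] LTwo G E) : LTwo G ℂ →ₗ[ℂ] E →L[ℂ] LTwo G E)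
    fun η η' f f' => inner_ltmul η η' f f'
  have hsurj : Function.Surjective J := fun v =>
    mem_of_ltmul_mem (LinearMap.range J.toLinearMap)
      (J.isometry.isUniformInducing.isComplete_range.isClosed) (fun η f => ⟨_, hJ η f⟩) v
  exact ⟨LinearIsometryEquiv.ofSurjective J hsurj, hJ⟩

/-- The identification `E ⊗ L²(G) = L²(G, E)`. -/
def tensorIso [CompleteSpace E] : HTensor E (LTwo G ℂ) ≃ₗᵢ[ℂ] LTwo G E :=
  exists_tensorIsometry.choose

theorem tensorIso_htmul [CompleteSpace E] (η : E) (f : LTwo G ℂ) :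
    tensorIso (htmul η f) = ltmul η f :=
  exists_tensorIsometry.choose_spec η f

end LTwoBasic

/-! ### Unitary representations and their smoothing operators -/

section Constructions

variable {X H : Type*} [TopologicalSpace X] [NormedAddCommGroup H] [InnerProductSpace ℂ H]

/-- The vectors on which a family of isometries is strongly continuous. -/
def continuityVectors (U : X → H →ₗᵢ[ℂ] H) : Submodule ℂ H where
  carrier := {v | Continuous fun x => U x v}
  add_mem' ha hb := by
    simp only [Set.mem_ofPred_eq, map_add] at *
    exact ha.add hb
  zero_mem' := by simpa using continuous_const
  smul_mem' c v hv := by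
    simp only [Set.mem_ofPred_eq, map_smul] at *
    exact hv.const_smul c

theorem isClosed_continuityVectors (U : X → H →ₗᵢ[ℂ] H) :
    IsClosed (continuityVectors U : Set H) := by
  refine isClosed_of_closure_subset fun v hv => ?_
  refine continuous_of_uniform_approx_of_continuous fun s hs => ?_
  obtain ⟨ε, hε, hεs⟩ := Metric.mem_uniformity_dist.1 hs
  obtain ⟨w, hw, hvw⟩ := Metric.mem_closure_iff.1 hv ε hε
  exact ⟨fun x => U x w, hw, fun x => hεs (by rwa [(U x).dist_map])⟩

/-- A unitary representation given by isometries `U g` with `U 1 = 1` and `U (gh) = U g U h`. -/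
def UnitaryRepr.ofIsometries {G : Type*} [Group G] [TopologicalSpace G] (U : G → H →ₗᵢ[ℂ] H)
    (h1 : ∀ v, U 1 v = v) (hmul : ∀ g h v, U (g * h) v = U g (U h v))
    (hc : ∀ v, Continuous fun g => U g v) : UnitaryRepr G H where
  op :=
    { toFun := fun g =>
        { (U g) with
          invFun := U g⁻¹
          left_inv := fun v => by
            change U g⁻¹ (U g v) = v
            rw [← hmul, inv_mul_cancel, h1]
          right_inv := fun v => by
            change U g (U g⁻¹ v) = v
            rw [← hmul, mul_inv_cancel, h1] }
      map_one' := LinearIsometryEquiv.ext h1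
      map_mul' := fun g h => LinearIsometryEquiv.ext (hmul g h) }
  continuous_op := hc

theorem UnitaryRepr.op_mul_apply {G : Type*} [Group G] [TopologicalSpace G] (u : UnitaryRepr G H)
    (g h : G) (v : H) : u.op (g * h) v = u.op g (u.op h v) := by rw [map_mul]; rfl

theorem UnitaryRepr.op_one_apply {G : Type*} [Group G] [TopologicalSpace G] (u : UnitaryRepr G H)
    (v : H) : u.op 1 v = v := by rw [map_one]; rfl

theorem UnitaryRepr.op_inv_op {G : Type*} [Group G] [TopologicalSpace G] (u : UnitaryRepr G H)
    (g : G) (v : H) : u.op g⁻¹ (u.op g v) = v := by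
  rw [← u.op_mul_apply, inv_mul_cancel, u.op_one_apply]

theorem UnitaryRepr.op_op_inv {G : Type*} [Group G] [TopologicalSpace G] (u : UnitaryRepr G H)
    (g : G) (v : H) : u.op g (u.op g⁻¹ v) = v := by
  rw [← u.op_mul_apply, mul_inv_cancel, u.op_one_apply]

theorem UnitaryRepr.inner_op_left {G : Type*} [Group G] [TopologicalSpace G] (u : UnitaryRepr G H)
    (g : G) (v w : H) : ⟪u.op g v, w⟫_ℂ = ⟪v, u.op g⁻¹ w⟫_ℂ := by
  rw [← (u.op g).inner_map_map v, u.op_op_inv]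

end Constructions

/-- A continuous function on a compact space is uniformly close to finite sums of products of
scalar functions with its own values. -/
theorem exists_sum_smul_norm_sub_le {X V : Type*} [TopologicalSpace X] [CompactSpace X] [T2Space X]
    [NormedAddCommGroup V] [NormedSpace ℂ V] (Φ : C(X, V)) {ε : ℝ} (hε : 0 < ε) :
    ∃ (s : Finset X) (ρ : s → C(X, ℂ)), ∀ x, ‖Φ x - ∑ y, ρ y x • Φ y‖ ≤ ε := by
  let U : X → Set X := fun y => Φ ⁻¹' Metric.ball (Φ y) ε
  have hU : ∀ y, IsOpen (U y) := fun y => Metric.isOpen_ball.preimage Φ.continuous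
  obtain ⟨s, hs⟩ := isCompact_univ.elim_finite_subcover U hU
    (fun y _ => Set.mem_iUnion.2 ⟨y, Metric.mem_ball_self hε⟩)
  obtain ⟨f, hf⟩ := PartitionOfUnity.exists_isSubordinate isClosed_univ
    (fun y : s => U y) (fun y => hU y) (by
      intro x hx
      obtain ⟨y, hy, hxy⟩ := Set.mem_iUnion₂.1 (hs hx)
      exact Set.mem_iUnion.2 ⟨⟨y, hy⟩, hxy⟩)
  refine ⟨s, fun y => ⟨fun x => (f y x : ℂ), by fun_prop⟩, fun x => ?_⟩
  have hsum : ∑ y, f y x = 1 := by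
    rw [← finsum_eq_sum_of_fintype]
    exact f.sum_eq_one (Set.mem_univ x)
  have hsumC : ∑ y, (f y x : ℂ) = 1 := by rw [← Complex.ofReal_sum, hsum, Complex.ofReal_one]
  have h1 : Φ x - ∑ y, (f y x : ℂ) • Φ y = ∑ y, (f y x : ℂ) • (Φ x - Φ y) := by
    simp only [smul_sub, Finset.sum_sub_distrib, ← Finset.sum_smul, hsumC, one_smul]
  change ‖Φ x - ∑ y, (f y x : ℂ) • Φ y‖ ≤ ε
  rw [h1]
  calc ‖∑ y, (f y x : ℂ) • (Φ x - Φ y)‖ ≤ ∑ y, f y x * ε := by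
        refine norm_sum_le_of_le _ fun y _ => ?_
        rw [norm_smul, Complex.norm_real, Real.norm_of_nonneg (f.nonneg y x)]
        by_cases hy : f y x = 0
        · simp [hy]
        · refine mul_le_mul_of_nonneg_left ?_ (f.nonneg y x)
          have : x ∈ U y := hf y (subset_closure hy)
          rw [← dist_eq_norm]
          exact (Metric.mem_ball.1 this).le
    _ = ε := by rw [← Finset.sum_mul, hsum, one_mul]

section Smooth

variable {G : Type*} [Group G] [TopologicalSpace G] [IsTopologicalGroup G] [CompactSpace G]
  [T2Space G] [MeasurableSpace G] [BorelSpace G]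
  {H H' : Type*} [NormedAddCommGroup H] [InnerProductSpace ℂ H] [CompleteSpace H]
  [NormedAddCommGroup H'] [InnerProductSpace ℂ H'] [CompleteSpace H']

namespace UnitaryRepr

theorem integrable_smul_op (u : UnitaryRepr G H) (ψ : C(G, ℂ)) (η : H) :
    Integrable (fun g => ψ g • u.op g η) (haarP G) :=
  integrable_of_continuous (ψ.continuous.smul (u.continuous_op η))

/-- The operator `∫ ψ(g) u_g dg`. -/
def smooth (u : UnitaryRepr G H) (ψ : C(G, ℂ)) : H →L[ℂ] H :=
  LinearMap.mkContinuous
    { toFun := fun η => ∫ g, ψ g • u.op g η ∂haarP G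
      map_add' := fun η η' => by
        simp only [map_add, smul_add]
        exact integral_add (u.integrable_smul_op ψ η) (u.integrable_smul_op ψ η')
      map_smul' := fun c η => by
        simp only [map_smul, smul_comm _ c]
        exact integral_smul c _ } ‖ψ‖ (fun η => by
    refine norm_integral_haarP_le fun g => ?_
    rw [norm_smul, LinearIsometryEquiv.norm_map]
    exact mul_le_mul_of_nonneg_right (ψ.norm_coe_le_norm g) (norm_nonneg _))

theorem smooth_apply (u : UnitaryRepr G H) (ψ : C(G, ℂ)) (η : H) :
    u.smooth ψ η = ∫ g, ψ g • u.op g η ∂haarP G := rfl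

theorem inner_smooth_right (u : UnitaryRepr G H) (ψ : C(G, ℂ)) (ξ η : H) :
    ⟪ξ, u.smooth ψ η⟫_ℂ = ∫ g, ψ g * ⟪ξ, u.op g η⟫_ℂ ∂haarP G := by
  rw [smooth_apply, ← integral_inner (u.integrable_smul_op ψ η)]
  simp only [inner_smul_right]

theorem inner_smooth_left (u : UnitaryRepr G H) (ψ : C(G, ℂ)) (ξ η : H) :
    ⟪u.smooth ψ ξ, η⟫_ℂ = ∫ g, (starRingEnd ℂ) (ψ g⁻¹) * ⟪ξ, u.op g η⟫_ℂ ∂haarP G := by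
  rw [← inner_conj_symm, inner_smooth_right, ← integral_conj, ← integral_inv_eq_self]
  refine integral_congr_ae (Filter.Eventually.of_forall fun g => ?_)
  simp only [map_mul, inner_conj_symm, inner_op_left, inv_inv]

theorem comp_smooth {u : UnitaryRepr G H} {u' : UnitaryRepr G H'} (T : H →L[ℂ] H')
    (hT : ∀ g η, T (u.op g η) = u'.op g (T η)) (ψ : C(G, ℂ)) (η : H) :
    T (u.smooth ψ η) = u'.smooth ψ (T η) := by
  rw [smooth_apply, smooth_apply, ← T.integral_comp_comm (u.integrable_smul_op ψ η)]
  simp only [map_smul, hT]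

theorem smooth_one_of_fixed (u : UnitaryRepr G H) {η : H} (h : ∀ g, u.op g η = η) :
    u.smooth 1 η = η := by
  rw [smooth_apply]
  simp [h]

/-- Smoothing operators approximate the identity; they can be taken self-adjoint. -/
theorem exists_smooth_sub_le (u : UnitaryRepr G H) (η : H) {ε : ℝ} (hε : 0 < ε) :
    ∃ ψ : C(G, ℂ), (∀ g, ψ g⁻¹ = (starRingEnd ℂ) (ψ g)) ∧ ‖u.smooth ψ η - η‖ ≤ ε := by
  let V : Set G := {g | ‖u.op g η - η‖ < ε}
  have hV : IsOpen V := isOpen_lt ((u.continuous_op η).sub continuous_const).norm continuous_const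
  have h1V : (1 : G) ∈ V := by simpa [V, u.op_one_apply] using hε
  have hVi : IsOpen (V ∩ V⁻¹) := hV.inter hV.inv
  obtain ⟨f, hf0, hf1, hf01⟩ := exists_continuous_zero_one_of_isClosed hVi.isClosed_compl
    (isClosed_singleton (x := (1 : G))) (by
      rw [Set.disjoint_singleton_right]
      simpa using h1V)
  let k : C(G, ℝ) := ⟨fun g => f g + f g⁻¹, by fun_prop⟩
  have hk0 : 0 ≤ k := fun g => add_nonneg (hf01 g).1 (hf01 g⁻¹).1
  have hk1 : k 1 ≠ 0 := by
    have : f 1 = 1 := hf1 rfl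
    change f 1 + f 1⁻¹ ≠ 0
    rw [inv_one, this]
    norm_num
  have hkV : ∀ g, g ∉ V → k g = 0 := fun g hg => by
    have h1 : f g = 0 := hf0 (fun h => hg h.1)
    have h2 : f g⁻¹ = 0 := hf0 (fun h => hg (by simpa using h.2))
    change f g + f g⁻¹ = 0
    rw [h1, h2, add_zero]
  have hI : 0 < ∫ g, k g ∂haarP G :=
    k.continuous.integral_pos_of_hasCompactSupport_nonneg_nonzero
      (HasCompactSupport.of_compactSpace _) hk0 hk1
  let c := (∫ g, k g ∂haarP G)⁻¹
  have hc : 0 < c := inv_pos.2 hI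
  refine ⟨⟨fun g => ((c * k g : ℝ) : ℂ), by fun_prop⟩, fun g => ?_, ?_⟩
  · change ((c * k g⁻¹ : ℝ) : ℂ) = (starRingEnd ℂ) ((c * k g : ℝ) : ℂ)
    rw [Complex.conj_ofReal]
    change ((c * (f g⁻¹ + f g⁻¹⁻¹) : ℝ) : ℂ) = ((c * (f g + f g⁻¹) : ℝ) : ℂ)
    rw [inv_inv, add_comm]
  · have hint : ∫ g, c * k g ∂haarP G = 1 := by
      rw [integral_const_mul]
      exact inv_mul_cancel₀ hI.ne'
    have hη : η = ∫ g, ((c * k g : ℝ) : ℂ) • η ∂haarP G := by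
      rw [integral_smul_const, integral_complex_ofReal, hint, Complex.ofReal_one, one_smul]
    have hcont : Continuous fun g => ((c * k g : ℝ) : ℂ) := by fun_prop
    rw [smooth_apply]
    nth_rewrite 2 [hη]
    change ‖∫ g, ((c * k g : ℝ) : ℂ) • u.op g η ∂haarP G - _‖ ≤ _
    rw [← integral_sub (f := fun g => ((c * k g : ℝ) : ℂ) • u.op g η)
      (g := fun g => ((c * k g : ℝ) : ℂ) • η)
      (integrable_of_continuous (hcont.smul (u.continuous_op η)))
      (integrable_of_continuous (hcont.smul continuous_const))]
    refine (norm_integral_le_integral_norm _).trans ?_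
    calc ∫ g, ‖((c * k g : ℝ) : ℂ) • u.op g η - ((c * k g : ℝ) : ℂ) • η‖ ∂haarP G
        ≤ ∫ g, (c * k g) * ε ∂haarP G := by
          refine integral_mono (integrable_of_continuous ?_) (integrable_of_continuous ?_) ?_
          · exact ((hcont.smul (u.continuous_op η)).sub (hcont.smul continuous_const)).norm
          · fun_prop
          · intro g
            have hck : 0 ≤ c * k g := mul_nonneg hc.le (hk0 g)
            simp only
            rw [← smul_sub, norm_smul, Complex.norm_real, Real.norm_of_nonneg hck]
            by_cases hg : g ∈ V
            · exact mul_le_mul_of_nonneg_left (le_of_lt hg) hck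
            · rw [hkV g hg]
              simp
      _ = ε := by rw [integral_mul_const, hint, one_mul]

end UnitaryRepr

end Smooth

/-! ### Translations on `L²(G, E)` -/

section Translations

variable {G : Type*} [Group G] [TopologicalSpace G] [IsTopologicalGroup G] [CompactSpace G]
  [T2Space G] [MeasurableSpace G] [BorelSpace G]
  {E : Type*} [NormedAddCommGroup E] [InnerProductSpace ℂ E]

theorem ctsL_ext_clm {Y : Type*} [NormedAddCommGroup Y] [NormedSpace ℂ Y]
    {S T : LTwo G E →L[ℂ] Y} (h : ∀ f, S (ctsL f) = T (ctsL f)) : S = T :=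
  LTwo.ext_clm fun η φ => by rw [ltmul_ctsL, h]

theorem inner_ctsL (f f' : C(G, E)) :
    ⟪ctsL f, ctsL f'⟫_ℂ = ∫ h, ⟪f h, f' h⟫_ℂ ∂haarP G := by
  rw [L2.inner_def]
  refine integral_congr_ae ?_
  filter_upwards [coeFn_ctsL f, coeFn_ctsL f'] with h h1 h2
  rw [h1, h2]

theorem norm_ctsL_le {f : C(G, E)} {C : ℝ} (hC : 0 ≤ C) (h : ∀ g, ‖f g‖ ≤ C) :
    ‖ctsL f‖ ≤ C := by
  refine ((ctsL : C(G, E) →L[ℂ] LTwo G E).le_opNorm f).trans ?_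
  refine (mul_le_mul (LinearMap.mkContinuous_norm_le _ zero_le_one _)
    ((ContinuousMap.norm_le _ hC).2 h) (norm_nonneg _) zero_le_one).trans_eq (one_mul _)

theorem leftTranslate_ctsL (g : G) (f : C(G, E)) :
    leftTranslate g (ctsL f) = ctsL (f.comp ⟨fun h => g⁻¹ * h, by fun_prop⟩) := rfl

theorem rightTranslate_ctsL (g : G) (f : C(G, E)) :
    rightTranslate g (ctsL f) = ctsL (f.comp ⟨fun h => h * g, by fun_prop⟩) := rfl

/-- `leftTranslate` as an isometry. -/
def leftIso (g : G) : LTwo G E →ₗᵢ[ℂ] LTwo G E :=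
  Lp.compMeasurePreservingₗᵢ ℂ _ (measurePreserving_mul_left (haarP G) g⁻¹)

/-- `rightTranslate` as an isometry. -/
def rightIso (g : G) : LTwo G E →ₗᵢ[ℂ] LTwo G E :=
  Lp.compMeasurePreservingₗᵢ ℂ _ (measurePreserving_mul_right (haarP G) g)

theorem leftIso_apply (g : G) (f : LTwo G E) : leftIso g f = leftTranslate g f := rfl

/-- `twistedRightTranslate` as an isometry. -/
def twistedIso (T : E ≃ₗᵢ[ℂ] E) (g : G) : LTwo G E →ₗᵢ[ℂ] LTwo G E where
  toLinearMap := ((T.toContinuousLinearEquiv : E →L[ℂ] E).compLpₗ 2 (haarP G)) ∘ₗ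
    (rightIso g).toLinearMap
  norm_map' f := by
    change ‖(T.toContinuousLinearEquiv : E →L[ℂ] E).compLp (rightIso g f)‖ = ‖f‖
    rw [← (rightIso g).norm_map f, Lp.norm_def, Lp.norm_def]
    congr 1
    refine eLpNorm_congr_norm_ae ?_
    filter_upwards [ContinuousLinearMap.coeFn_compLp
      (T.toContinuousLinearEquiv : E →L[ℂ] E) (rightIso g f)] with h hh
    rw [hh]
    exact T.norm_map _

theorem compLp_ctsL (T : E →L[ℂ] E) (f : C(G, E)) :
    T.compLp (ctsL f) = ctsL (⟨fun h => T (f h), by fun_prop⟩ : C(G, E)) := by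
  refine Lp.ext ?_
  filter_upwards [coeFn_ctsL f, coeFn_ctsL (⟨fun h => T (f h), by fun_prop⟩ : C(G, E)),
    ContinuousLinearMap.coeFn_compLp T (ctsL f)] with h h1 h2 h3
  rw [h2, h3, h1]
  rfl

theorem twistedRightTranslate_ctsL (T : E ≃ₗᵢ[ℂ] E) (g : G) (f : C(G, E)) :
    twistedRightTranslate T g (ctsL f) =
      ctsL (⟨fun h => T (f (h * g)), by fun_prop⟩ : C(G, E)) := by
  rw [twistedRightTranslate, rightTranslate_ctsL, compLp_ctsL]
  rfl

theorem leftTranslate_ltmul (g : G) (η : E) (f : LTwo G ℂ) :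
    leftTranslate g (ltmul η f) = ltmul η (leftTranslate g f) := by
  have : (leftIso g).toContinuousLinearMap ∘L (ltmulL (G := G) (E := E)).flip η =
      (ltmulL (G := G) (E := E)).flip η ∘L (leftIso g).toContinuousLinearMap := by
    refine ctsL_ext_clm fun φ => ?_
    change leftTranslate g (ltmul η (ctsL φ)) = ltmul η (leftTranslate g (ctsL φ))
    rw [leftTranslate_ctsL, ltmul_ctsL, ltmul_ctsL, leftTranslate_ctsL]
    rfl
  exact DFunLike.congr_fun this f

theorem twistedRightTranslate_ltmul (T : E ≃ₗᵢ[ℂ] E) (g : G) (η : E) (f : LTwo G ℂ) :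
    twistedRightTranslate T g (ltmul η f) = ltmul (T η) (rightTranslate g f) := by
  have : (twistedIso T g).toContinuousLinearMap ∘L (ltmulL (G := G) (E := E)).flip η =
      (ltmulL (G := G) (E := E)).flip (T η) ∘L (rightIso g).toContinuousLinearMap := by
    refine ctsL_ext_clm fun φ => ?_
    change twistedRightTranslate T g (ltmul η (ctsL φ)) = ltmul (T η) (rightTranslate g (ctsL φ))
    rw [rightTranslate_ctsL, ltmul_ctsL, ltmul_ctsL, twistedRightTranslate_ctsL]
    congr 1
    ext h
    exact map_smul T _ _
  exact DFunLike.congr_fun this f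

theorem continuous_leftTranslate (f : LTwo G E) : Continuous fun g => leftTranslate g f := by
  have hF : Continuous fun g : G => (⟨fun h => g⁻¹ * h, by fun_prop⟩ : C(G, G)) :=
    (ContinuousMap.curry ⟨fun p : G × G => p.1⁻¹ * p.2, by fun_prop⟩).continuous
  exact continuous_const.compMeasurePreservingLp hF
    (fun g => measurePreserving_mul_left (haarP G) g⁻¹) ENNReal.ofNat_ne_top

theorem continuous_rightTranslate (f : LTwo G E) : Continuous fun g => rightTranslate g f := by
  have hF : Continuous fun g : G => (⟨fun h => h * g, by fun_prop⟩ : C(G, G)) :=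
    (ContinuousMap.curry ⟨fun p : G × G => p.2 * p.1, by fun_prop⟩).continuous
  exact continuous_const.compMeasurePreservingLp hF
    (fun g => measurePreserving_mul_right (haarP G) g) ENNReal.ofNat_ne_top

variable (G E) in
/-- The left regular representation. -/
def leftRepr : UnitaryRepr G (LTwo G E) :=
  UnitaryRepr.ofIsometries leftIso
    (fun v => by
      have : (leftIso 1).toContinuousLinearMap = ContinuousLinearMap.id ℂ (LTwo G E) :=
        ctsL_ext_clm fun f => by
          change leftTranslate 1 (ctsL f) = ctsL f
          rw [leftTranslate_ctsL]
          congr 1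
          ext h
          simp
      exact DFunLike.congr_fun this v)
    (fun g k v => by
      have : (leftIso (g * k)).toContinuousLinearMap =
          (leftIso g).toContinuousLinearMap ∘L (leftIso k).toContinuousLinearMap :=
        ctsL_ext_clm (E := E) fun f => by
          change leftTranslate (g * k) (ctsL f) = leftTranslate g (leftTranslate k (ctsL f))
          simp only [leftTranslate_ctsL]
          congr 1
          ext h
          simp [mul_assoc]
      exact DFunLike.congr_fun this v)
    continuous_leftTranslate

theorem leftRepr_op (g : G) (f : LTwo G E) : (leftRepr G E).op g f = leftTranslate g f := rfl

/-- The representation `u ⊗ r` on `E ⊗ L²(G) = L²(G, E)`. -/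
def twistedRepr (u : UnitaryRepr G E) : UnitaryRepr G (LTwo G E) :=
  UnitaryRepr.ofIsometries (fun g => twistedIso (u.op g) g)
    (fun v => by
      have : (twistedIso (u.op 1) 1).toContinuousLinearMap = ContinuousLinearMap.id ℂ (LTwo G E) :=
        ctsL_ext_clm fun f => by
          change twistedRightTranslate (u.op 1) 1 (ctsL f) = ctsL f
          rw [twistedRightTranslate_ctsL]
          congr 1
          ext h
          simp
      exact DFunLike.congr_fun this v)
    (fun g k v => by
      have : (twistedIso (u.op (g * k)) (g * k)).toContinuousLinearMap =
          (twistedIso (u.op g) g).toContinuousLinearMap ∘L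
            (twistedIso (u.op k) k).toContinuousLinearMap :=
        ctsL_ext_clm (E := E) fun f => by
          change twistedRightTranslate (u.op (g * k)) (g * k) (ctsL f) =
            twistedRightTranslate (u.op g) g (twistedRightTranslate (u.op k) k (ctsL f))
          simp only [twistedRightTranslate_ctsL]
          congr 1
          ext h
          simp [mul_assoc]
      exact DFunLike.congr_fun this v)
    (fun v => by
      refine mem_of_ltmul_mem (continuityVectors fun g => twistedIso (u.op g) g)
        (isClosed_continuityVectors _) (fun η f => ?_) v
      change Continuous fun g => twistedRightTranslate (u.op g) g (ltmul η f)
      simp only [twistedRightTranslate_ltmul]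
      exact ((ltmulL (G := G) (E := E)).continuous.comp (continuous_rightTranslate f)).clm_apply
        (u.continuous_op η))

theorem twistedRepr_op (u : UnitaryRepr G E) (g : G) (f : LTwo G E) :
    (twistedRepr u).op g f = twistedRightTranslate (u.op g) g f := rfl

/-- The trivial representation. -/
def trivialRepr (G E : Type*) [Group G] [TopologicalSpace G] [NormedAddCommGroup E]
    [InnerProductSpace ℂ E] : UnitaryRepr G E where
  op := 1
  continuous_op _ := continuous_const

variable (G) in
/-- The right regular representation. -/
def rightRepr : UnitaryRepr G (LTwo G ℂ) := twistedRepr (trivialRepr G ℂ)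

theorem rightRepr_op (g : G) (f : LTwo G ℂ) : (rightRepr G).op g f = rightTranslate g f := by
  refine Lp.ext ?_
  exact ContinuousLinearMap.coeFn_compLp
    (((trivialRepr G ℂ).op g).toContinuousLinearEquiv : ℂ →L[ℂ] ℂ) (rightTranslate g f)

theorem leftTranslate_rightTranslate (g k : G) (f : LTwo G E) :
    leftTranslate g (rightTranslate k f) = rightTranslate k (leftTranslate g f) := by
  have : (leftIso g : LTwo G E →ₗᵢ[ℂ] _).toContinuousLinearMap ∘L
      (rightIso k).toContinuousLinearMap =
      (rightIso k).toContinuousLinearMap ∘L (leftIso g).toContinuousLinearMap := by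
    refine ctsL_ext_clm (E := E) fun f => ?_
    change leftTranslate g (rightTranslate k (ctsL f)) = rightTranslate k (leftTranslate g (ctsL f))
    simp only [leftTranslate_ctsL, rightTranslate_ctsL]
    congr 1
    ext h
    simp [mul_assoc]
  exact DFunLike.congr_fun this f

theorem ctsL_integral [CompleteSpace E] {F : G → C(G, E)} (hF : Continuous F) :
    ∫ g, ctsL (F g) ∂haarP G = ctsL (∫ g, F g ∂haarP G) :=
  ctsL.integral_comp_comm (integrable_of_continuous hF)

theorem integral_continuousMap_apply [CompleteSpace E] {F : G → C(G, E)} (hF : Continuous F)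
    (h : G) : (∫ g, F g ∂haarP G) h = ∫ g, F g h ∂haarP G :=
  ((ContinuousMap.evalCLM ℂ h : C(G, E) →L[ℂ] E).integral_comp_comm
    (integrable_of_continuous hF)).symm

theorem integral_norm_le_norm_ctsL (φ : C(G, ℂ)) : ∫ g, ‖φ g‖ ∂haarP G ≤ ‖ctsL φ‖ := by
  let n : C(G, ℂ) := ⟨fun g => (‖φ g‖ : ℂ), by fun_prop⟩
  have h1 : ((∫ g, ‖φ g‖ ∂haarP G : ℝ) : ℂ) = ⟪ctsL (1 : C(G, ℂ)), ctsL n⟫_ℂ := by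
    rw [inner_ctsL, ← integral_complex_ofReal]
    simp [n]
  have h2 : ‖ctsL n‖ = ‖ctsL φ‖ := by
    rw [Lp.norm_def, Lp.norm_def]
    congr 1
    refine eLpNorm_congr_norm_ae ?_
    filter_upwards [coeFn_ctsL φ, coeFn_ctsL n] with g h1 h2
    rw [h1, h2]
    simp [n]
  have h3 : ‖ctsL (1 : C(G, ℂ))‖ ≤ 1 := norm_ctsL_le zero_le_one (by simp)
  calc ∫ g, ‖φ g‖ ∂haarP G ≤ |∫ g, ‖φ g‖ ∂haarP G| := le_abs_self _
    _ = ‖⟪ctsL (1 : C(G, ℂ)), ctsL n⟫_ℂ‖ := by rw [← h1, Complex.norm_real, Real.norm_eq_abs]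
    _ ≤ ‖ctsL (1 : C(G, ℂ))‖ * ‖ctsL n‖ := norm_inner_le_norm _ _
    _ ≤ 1 * ‖ctsL n‖ := mul_le_mul_of_nonneg_right h3 (norm_nonneg _)
    _ = ‖ctsL φ‖ := by rw [one_mul, h2]

/-- `(g ↦ (h ↦ ψ (h * g⁻¹)))`, the kernel of the smoothing operator of the left regular
representation. -/
def convKernel (ψ : C(G, ℂ)) : C(G, C(G, ℂ)) :=
  ContinuousMap.curry ⟨fun p : G × G => ψ (p.2 * p.1⁻¹), by fun_prop⟩

theorem smooth_leftRepr_ctsL (ψ φ : C(G, ℂ)) :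
    (leftRepr G ℂ).smooth ψ (ctsL φ) = ctsL (∫ g, φ g • convKernel ψ g ∂haarP G) := by
  let F : C(G, C(G, ℂ)) :=
    ContinuousMap.curry ⟨fun p : G × G => ψ p.1 * φ (p.1⁻¹ * p.2), by fun_prop⟩
  have h1 : (leftRepr G ℂ).smooth ψ (ctsL φ) = ∫ g, ctsL (F g) ∂haarP G := by
    rw [UnitaryRepr.smooth_apply]
    refine integral_congr_ae (Filter.Eventually.of_forall fun g => ?_)
    simp only [leftRepr_op, leftTranslate_ctsL, ← map_smul]
    rfl
  have hK : Continuous fun g => φ g • convKernel ψ g :=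
    φ.continuous.smul (convKernel ψ).continuous
  rw [h1, ctsL_integral F.continuous]
  congr 1
  ext h
  rw [integral_continuousMap_apply F.continuous, integral_continuousMap_apply hK]
  rw [← integral_mul_left_eq_self _ h, ← integral_inv_eq_self]
  refine integral_congr_ae (Filter.Eventually.of_forall fun g => ?_)
  change ψ (h * g⁻¹) * φ ((h * g⁻¹)⁻¹ * h) = φ g * ψ (h * g⁻¹)
  rw [mul_comm]
  simp

/-- Convolution operators on `L²(G)` are norm limits of operators of finite rank. -/
theorem smooth_leftRepr_mem_finiteRankClosure (ψ : C(G, ℂ)) :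
    (leftRepr G ℂ).smooth ψ ∈ HTensor.finiteRankClosure (LTwo G ℂ) (LTwo G ℂ) := by
  refine Metric.mem_closure_iff.2 fun ε hε => ?_
  obtain ⟨s, ρ, hρ⟩ := exists_sum_smul_norm_sub_le (convKernel ψ) (half_pos hε)
  refine ⟨∑ y : s, InnerProductSpace.rankOne ℂ (ctsL (convKernel ψ y)) (ctsL (star (ρ y))),
    Submodule.sum_mem _ fun y _ => Submodule.subset_span ⟨_, _, rfl⟩, ?_⟩
  refine lt_of_le_of_lt ?_ (half_lt_self hε)
  rw [dist_eq_norm]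
  refine ContinuousLinearMap.opNorm_le_bound _ (half_pos hε).le fun f => ?_
  refine denseRange_ctsL.induction_on f (isClosed_le (by fun_prop) (by fun_prop)) fun φ => ?_
  have hc : Continuous fun g => φ g • (convKernel ψ g - ∑ y : s, ρ y g • convKernel ψ y) := by
    fun_prop
  have hc1 : Continuous fun g => φ g • convKernel ψ g := by fun_prop
  have hc2 : Continuous fun g => φ g • ∑ y : s, ρ y g • convKernel ψ y := by fun_prop
  have key : ((leftRepr G ℂ).smooth ψ - ∑ y : s, InnerProductSpace.rankOne ℂ (ctsL (convKernel ψ y))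
      (ctsL (star (ρ y)))) (ctsL φ) =
      ctsL (∫ g, φ g • (convKernel ψ g - ∑ y : s, ρ y g • convKernel ψ y) ∂haarP G) := by
    simp only [smul_sub]
    rw [integral_sub (integrable_of_continuous hc1) (integrable_of_continuous hc2), map_sub,
      sub_apply, smooth_leftRepr_ctsL]
    congr 1
    simp only [Finset.smul_sum, smul_smul]
    rw [integral_finsetSum _ (fun y _ => integrable_of_continuous (by fun_prop)), map_sum,
      sum_apply]
    refine Finset.sum_congr rfl fun y _ => ?_
    rw [integral_smul_const, map_smul, InnerProductSpace.rankOne_apply, inner_ctsL]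
    congr 1
    refine integral_congr_ae (Filter.Eventually.of_forall fun g => ?_)
    simp
  rw [key]
  have hb : ‖∫ g, φ g • (convKernel ψ g - ∑ y : s, ρ y g • convKernel ψ y) ∂haarP G‖
      ≤ ε / 2 * ‖ctsL φ‖ := by
    refine (norm_integral_le_integral_norm _).trans ?_
    calc ∫ g, ‖φ g • (convKernel ψ g - ∑ y : s, ρ y g • convKernel ψ y)‖ ∂haarP G
        ≤ ∫ g, ε / 2 * ‖φ g‖ ∂haarP G := by
          refine integral_mono (integrable_of_continuous hc.norm)
            (integrable_of_continuous (by fun_prop)) fun g => ?_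
          simp only
          rw [norm_smul, mul_comm]
          exact mul_le_mul_of_nonneg_right (hρ g) (norm_nonneg _)
      _ ≤ ε / 2 * ‖ctsL φ‖ := by
          rw [integral_const_mul]
          exact mul_le_mul_of_nonneg_left (integral_norm_le_norm_ctsL φ) (half_pos hε).le
  exact norm_ctsL_le (by positivity) fun h => (ContinuousMap.norm_coe_le_norm _ h).trans hb

end Translations

/-! ### Fixed vectors of `u ⊗ r` -/

section Fixed

variable {G : Type*} [Group G] [TopologicalSpace G] [IsTopologicalGroup G] [CompactSpace G]
  [T2Space G] [MeasurableSpace G] [BorelSpace G]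
  {E : Type*} [NormedAddCommGroup E] [InnerProductSpace ℂ E]

/-- The isometry `η ↦ (h ↦ u_{h⁻¹} η)`; its range is the fixed space of `u ⊗ r`. -/
def fixedEmb (u : UnitaryRepr G E) : E →ₗᵢ[ℂ] LTwo G E :=
  LinearMap.isometryOfInner
    { toFun := fun η => ctsL ⟨fun h => u.op h⁻¹ η, (u.continuous_op η).comp continuous_inv⟩
      map_add' := fun η η' => by
        rw [← map_add]
        congr 1
        ext h
        exact map_add (u.op h⁻¹) η η'
      map_smul' := fun c η => by
        rw [RingHom.id_apply, ← map_smul]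
        congr 1
        ext h
        exact map_smul (u.op h⁻¹) c η }
    (fun η η' => by
      refine (inner_ctsL _ _).trans ?_
      simp)

theorem fixedEmb_apply (u : UnitaryRepr G E) (η : E) :
    fixedEmb u η = ctsL ⟨fun h => u.op h⁻¹ η, (u.continuous_op η).comp continuous_inv⟩ := rfl

theorem leftTranslate_fixedEmb (u : UnitaryRepr G E) (g : G) (η : E) :
    leftTranslate g (fixedEmb u η) = fixedEmb u (u.op g η) := by
  rw [fixedEmb_apply, fixedEmb_apply, leftTranslate_ctsL]
  congr 1
  ext h
  change u.op (g⁻¹ * h)⁻¹ η = u.op h⁻¹ (u.op g η)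
  rw [← u.op_mul_apply, mul_inv_rev, inv_inv]

theorem twistedRightTranslate_fixedEmb (u : UnitaryRepr G E) (g : G) (η : E) :
    twistedRightTranslate (u.op g) g (fixedEmb u η) = fixedEmb u η := by
  rw [fixedEmb_apply, twistedRightTranslate_ctsL]
  congr 1
  ext h
  change u.op g (u.op (h * g)⁻¹ η) = u.op h⁻¹ η
  rw [← u.op_mul_apply, mul_inv_rev, mul_inv_cancel_left]

/-- The projection onto the fixed vectors of `u ⊗ r`, on a dense subspace: the average of `η ⊗ φ` is
the function `h ↦ u_{h⁻¹} η'` with `η' = ∫ φ(g) u_g η dg`. -/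
theorem smooth_one_twistedRepr [CompleteSpace E] (u : UnitaryRepr G E) (η : E) (φ : C(G, ℂ)) :
    (twistedRepr u).smooth 1 (ltmul η (ctsL φ)) = fixedEmb u (u.smooth φ η) := by
  let F : C(G, C(G, E)) := ContinuousMap.curry
    ⟨fun p : G × G => φ (p.2 * p.1) • u.op p.1 η, by
      have := u.continuous_op η
      fun_prop⟩
  have h1 : (twistedRepr u).smooth 1 (ltmul η (ctsL φ)) = ∫ g, ctsL (F g) ∂haarP G := by
    rw [UnitaryRepr.smooth_apply]
    refine integral_congr_ae (Filter.Eventually.of_forall fun g => ?_)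
    simp only [twistedRepr_op, ltmul_ctsL, twistedRightTranslate_ctsL, ContinuousMap.one_apply,
      one_smul]
    congr 1
    ext h
    exact map_smul (u.op g) _ _
  rw [h1, ctsL_integral F.continuous, fixedEmb_apply]
  congr 1
  ext h
  rw [integral_continuousMap_apply F.continuous]
  change ∫ g, φ (h * g) • u.op g η ∂haarP G = u.op h⁻¹ (∫ g, φ g • u.op g η ∂haarP G)
  have h2 : u.op h⁻¹ (∫ g, φ g • u.op g η ∂haarP G) = ∫ g, u.op h⁻¹ (φ g • u.op g η) ∂haarP G :=
    (((u.op h⁻¹).toContinuousLinearEquiv : E →L[ℂ] E).integral_comp_comm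
      (u.integrable_smul_op φ η)).symm
  rw [h2, ← integral_mul_left_eq_self (fun g => u.op h⁻¹ (φ g • u.op g η)) h]
  refine integral_congr_ae (Filter.Eventually.of_forall fun g => ?_)
  change φ (h * g) • u.op g η = u.op h⁻¹ (φ (h * g) • u.op (h * g) η)
  rw [map_smul, ← u.op_mul_apply, inv_mul_cancel_left]

/-- Every vector of `L²(G, E)` fixed by `u ⊗ r` is one of the functions `h ↦ u_{h⁻¹} η`. -/
theorem exists_fixedEmb_eq [CompleteSpace E] (u : UnitaryRepr G E) {v : LTwo G E}
    (hv : ∀ g, twistedRightTranslate (u.op g) g v = v) : ∃ η, fixedEmb u η = v := by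
  have h := mem_of_ltmul_ctsL_mem
    ((LinearMap.range (fixedEmb u).toLinearMap).comap
      ((twistedRepr u).smooth 1 : LTwo G E →ₗ[ℂ] LTwo G E))
    (((fixedEmb u).isometry.isUniformInducing.isComplete_range.isClosed).preimage
      ((twistedRepr u).smooth 1).continuous)
    (fun η φ => ⟨_, (smooth_one_twistedRepr u η φ).symm⟩) v
  obtain ⟨η, hη⟩ := h
  refine ⟨η, hη.trans ?_⟩
  exact (twistedRepr u).smooth_one_of_fixed hv

end Fixed

/-! ### The representation `j_α` -/

section JOp

variable {G A : Type*} [Group G] [TopologicalSpace G] [IsTopologicalGroup G] [CompactSpace G]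
  [T2Space G] [MeasurableSpace G] [BorelSpace G] [CStarAlgebra A] {α : CStarDynamics G A}
  {E E' : Type*} [NormedAddCommGroup E] [InnerProductSpace ℂ E] [CompleteSpace E]
  [NormedAddCommGroup E'] [InnerProductSpace ℂ E'] [CompleteSpace E']

theorem mulOp_ctsL (Φ : C(G, E →L[ℂ] E)) (f : C(G, E)) :
    mulOp Φ (ctsL f) = ctsL ⟨fun h => Φ h (f h), by fun_prop⟩ := by
  refine Lp.ext ?_
  have hm : MemLp Φ ⊤ (haarP G) := memLp_top_of_bound
      (Φ.continuous.stronglyMeasurable_of_hasCompactSupport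
        (HasCompactSupport.of_compactSpace Φ)).aestronglyMeasurable ‖Φ‖
      (Filter.Eventually.of_forall Φ.norm_coe_le_norm)
  filter_upwards [(ContinuousLinearMap.id ℂ (E →L[ℂ] E)).coeFn_holder (r := 2) (hm.toLp Φ) (ctsL f),
    hm.coeFn_toLp, coeFn_ctsL f, coeFn_ctsL (⟨fun h => Φ h (f h), by fun_prop⟩ : C(G, E))]
    with h h1 h2 h3 h4
  rw [h4]
  refine h1.trans ?_
  rw [h2, h3]
  rfl

theorem continuous_starAlgHom (π : A →⋆ₐ[ℂ] (E →L[ℂ] E)) : Continuous π :=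
  AddMonoidHomClass.continuous_of_bound π 1 fun a => by
    simpa only [one_mul] using NonUnitalStarAlgHom.norm_apply_le π a

namespace CStarDynamics

theorem continuous_act_inv (α : CStarDynamics G A) (x : A) : Continuous fun h => α.act h⁻¹ x :=
  α.continuous_act.comp (continuous_inv.prodMk continuous_const)

theorem act_mul_apply (α : CStarDynamics G A) (g h : G) (x : A) :
    α.act (g * h) x = α.act g (α.act h x) := by rw [map_mul]; rfl

namespace CovRep

theorem jOp_ctsL (ρ : α.CovRep E) (x : A) (f : C(G, E)) :
    ρ.jOp x (ctsL f) = ctsL ⟨fun h => ρ.π (α.act h⁻¹ x) (f h),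
      ((continuous_starAlgHom ρ.π).comp (α.continuous_act_inv x)).clm_apply f.continuous⟩ :=
  mulOp_ctsL _ f

theorem inner_ctsL_jOp_ctsL (ρ : α.CovRep E) (x : A) (f f' : C(G, E)) :
    ⟪ctsL f, ρ.jOp x (ctsL f')⟫_ℂ = ⟪ρ.jOp (star x) (ctsL f), ctsL f'⟫_ℂ := by
  rw [jOp_ctsL, jOp_ctsL, inner_ctsL, inner_ctsL]
  refine integral_congr_ae (Filter.Eventually.of_forall fun h => ?_)
  change ⟪f h, ρ.π (α.act h⁻¹ x) (f' h)⟫_ℂ = ⟪ρ.π (α.act h⁻¹ (star x)) (f h), f' h⟫_ℂ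
  rw [map_star, map_star, ContinuousLinearMap.star_eq_adjoint,
    ContinuousLinearMap.adjoint_inner_left]

/-- The *-representation `j_α` of `A` on `L²(G, E)`. -/
def jHom (ρ : α.CovRep E) : A →⋆ₐ[ℂ] (LTwo G E →L[ℂ] LTwo G E) where
  toFun := ρ.jOp
  map_one' := ctsL_ext_clm fun f => by
    change ρ.jOp 1 (ctsL f) = ctsL f
    rw [jOp_ctsL]
    congr 1
    ext h
    change ρ.π (α.act h⁻¹ 1) (f h) = f h
    rw [map_one, map_one]
    rfl
  map_mul' x y := ctsL_ext_clm fun f => by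
    change _ = ρ.jOp x (ρ.jOp y (ctsL f))
    rw [jOp_ctsL, jOp_ctsL, jOp_ctsL]
    congr 1
    ext h
    change ρ.π (α.act h⁻¹ (x * y)) (f h) = ρ.π (α.act h⁻¹ x) (ρ.π (α.act h⁻¹ y) (f h))
    rw [map_mul, map_mul]
    rfl
  map_zero' := ctsL_ext_clm fun f => by
    rw [jOp_ctsL, zero_apply, ← map_zero ctsL]
    congr 1
    ext h
    change ρ.π (α.act h⁻¹ 0) (f h) = 0
    rw [map_zero, map_zero]
    rfl
  map_add' x y := ctsL_ext_clm fun f => by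
    rw [add_apply, jOp_ctsL, jOp_ctsL, jOp_ctsL, ← map_add]
    congr 1
    ext h
    change ρ.π (α.act h⁻¹ (x + y)) (f h) = ρ.π (α.act h⁻¹ x) (f h) + ρ.π (α.act h⁻¹ y) (f h)
    rw [map_add, map_add]
    rfl
  commutes' c := ctsL_ext_clm fun f => by
    rw [jOp_ctsL, Algebra.algebraMap_eq_smul_one, Algebra.algebraMap_eq_smul_one, smul_apply,
      one_apply_eq_self, ← map_smul]
    congr 1
    ext h
    change ρ.π (α.act h⁻¹ (c • 1)) (f h) = c • f h
    rw [map_smul, map_smul, map_one, map_one]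
    rfl
  map_star' x := by
    rw [ContinuousLinearMap.star_eq_adjoint]
    refine ctsL_ext_clm fun f => ?_
    refine ext_inner_right ℂ fun v => ?_
    rw [ContinuousLinearMap.adjoint_inner_left]
    have : innerSL ℂ (ρ.jOp (star x) (ctsL f)) = innerSL ℂ (ctsL f) ∘L ρ.jOp x :=
      ctsL_ext_clm fun f' => (ρ.inner_ctsL_jOp_ctsL x f f').symm
    exact DFunLike.congr_fun this v

theorem leftTranslate_jOp (ρ : α.CovRep E) (g : G) (x : A) (v : LTwo G E) :
    leftTranslate g (ρ.jOp x v) = ρ.jOp (α.act g x) (leftTranslate g v) := by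
  have : (leftIso g).toContinuousLinearMap ∘L ρ.jOp x =
      ρ.jOp (α.act g x) ∘L (leftIso g).toContinuousLinearMap := by
    refine ctsL_ext_clm fun f => ?_
    change leftTranslate g (ρ.jOp x (ctsL f)) = ρ.jOp (α.act g x) (leftTranslate g (ctsL f))
    rw [leftTranslate_ctsL, jOp_ctsL, jOp_ctsL, leftTranslate_ctsL]
    congr 1
    ext h
    change ρ.π (α.act (g⁻¹ * h)⁻¹ x) (f (g⁻¹ * h)) = ρ.π (α.act h⁻¹ (α.act g x)) (f (g⁻¹ * h))
    rw [← α.act_mul_apply, mul_inv_rev, inv_inv]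
  exact DFunLike.congr_fun this v

theorem twistedRightTranslate_jOp (ρ : α.CovRep E) (g : G) (x : A) (v : LTwo G E) :
    twistedRightTranslate (ρ.u.op g) g (ρ.jOp x v) =
      ρ.jOp x (twistedRightTranslate (ρ.u.op g) g v) := by
  have : (twistedIso (ρ.u.op g) g).toContinuousLinearMap ∘L ρ.jOp x =
      ρ.jOp x ∘L (twistedIso (ρ.u.op g) g).toContinuousLinearMap := by
    refine ctsL_ext_clm fun f => ?_
    change twistedRightTranslate (ρ.u.op g) g (ρ.jOp x (ctsL f)) =
      ρ.jOp x (twistedRightTranslate (ρ.u.op g) g (ctsL f))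
    rw [twistedRightTranslate_ctsL, jOp_ctsL, jOp_ctsL, twistedRightTranslate_ctsL]
    congr 1
    ext h
    change ρ.u.op g (ρ.π (α.act (h * g)⁻¹ x) (f (h * g))) =
      ρ.π (α.act h⁻¹ x) (ρ.u.op g (f (h * g)))
    rw [← ρ.covariant, ← α.act_mul_apply, mul_inv_rev, mul_inv_cancel_left]
  exact DFunLike.congr_fun this v

theorem jOp_fixedEmb (ρ : α.CovRep E) (x : A) (η : E) :
    ρ.jOp x (fixedEmb ρ.u η) = fixedEmb ρ.u (ρ.π x η) := by
  rw [fixedEmb_apply, fixedEmb_apply, jOp_ctsL]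
  congr 1
  ext h
  exact ρ.covariant h⁻¹ x η

end CovRep

end CStarDynamics

/-- The column of an `A`-valued continuous function, an operator `E → E ⊗ L²(G)`. -/
def funCol (π : A →⋆ₐ[ℂ] (E →L[ℂ] E)) : C(G, A) →L[ℂ] E →L[ℂ] HTensor E (LTwo G ℂ) :=
  ContinuousLinearMap.compL ℂ E (LTwo G E) (HTensor E (LTwo G ℂ))
      ((tensorIso (G := G) (E := E)).symm.toContinuousLinearEquiv :
        LTwo G E →L[ℂ] HTensor E (LTwo G ℂ)) ∘L
    LinearMap.mkContinuous₂ (LinearMap.mk₂ ℂ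
      (fun F η => ctsL (⟨fun h => π (F h) η,
        ((continuous_starAlgHom π).comp F.continuous).clm_apply continuous_const⟩ : C(G, E)))
      (fun F F' η => by
        rw [← map_add]
        congr 1
        ext h
        simp)
      (fun c F η => by
        rw [← map_smul]
        congr 1
        ext h
        simp)
      (fun F η η' => by
        rw [← map_add]
        congr 1
        ext h
        simp)
      (fun c F η => by
        rw [← map_smul]
        congr 1
        ext h
        simp)) 1 (fun F η => by
      rw [one_mul, LinearMap.mk₂_apply]
      refine norm_ctsL_le (by positivity) fun g => ?_
      refine ((π (F g)).le_opNorm η).trans (mul_le_mul_of_nonneg_right ?_ (norm_nonneg _))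
      exact (NonUnitalStarAlgHom.norm_apply_le π (F g)).trans (F.norm_coe_le_norm g))

theorem funCol_apply (π : A →⋆ₐ[ℂ] (E →L[ℂ] E)) (F : C(G, A)) (η : E) :
    funCol π F η = tensorIso.symm (ctsL (⟨fun h => π (F h) η,
        ((continuous_starAlgHom π).comp F.continuous).clm_apply continuous_const⟩ : C(G, E))) :=
  rfl

theorem funCol_smul_const (π : A →⋆ₐ[ℂ] (E →L[ℂ] E)) (φ : C(G, ℂ)) (a : A) :
    funCol π ⟨fun h => φ h • a, by fun_prop⟩ = HTensor.ket (ctsL φ) ∘L π a := by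
  ext η
  rw [funCol_apply, LinearIsometryEquiv.symm_apply_eq, ContinuousLinearMap.comp_apply,
    HTensor.ket_apply, tensorIso_htmul, ltmul_ctsL]
  congr 1
  ext h
  simp

open HTensor in
theorem funCol_mem_colPair (π : A →⋆ₐ[ℂ] (E →L[ℂ] E)) (π' : A →⋆ₐ[ℂ] (E' →L[ℂ] E'))
    (F : C(G, A)) : (funCol π F, funCol π' F) ∈ colPair π π' (LTwo G ℂ) := by
  have hc : IsClosed {F : C(G, A) | (funCol π F, funCol π' F) ∈ colPair π π' (LTwo G ℂ)} :=
    isClosed_colPair.preimage ((funCol (G := G) π).continuous.prodMk (funCol (G := G) π').continuous)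
  refine hc.closure_subset (Metric.mem_closure_iff.2 fun ε hε => ?_)
  obtain ⟨s, r, hr⟩ := exists_sum_smul_norm_sub_le F (half_pos hε)
  refine ⟨∑ y : s, ⟨fun h => r y h • F y, by fun_prop⟩, ?_, ?_⟩
  · change ((funCol (G := G) π).prod (funCol (G := G) π')) (∑ y : s, _) ∈
      colPair π π' (LTwo G ℂ)
    rw [map_sum]
    refine Submodule.sum_mem _ fun y _ => ?_
    change (funCol π _, funCol π' _) ∈ colPair π π' (LTwo G ℂ)
    rw [funCol_smul_const, funCol_smul_const]
    exact ket_comp_mem_colPair _ _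
  · refine lt_of_le_of_lt ?_ (half_lt_self hε)
    rw [dist_eq_norm, ContinuousMap.norm_le _ (half_pos hε).le]
    intro g
    simpa [ContinuousMap.sum_apply] using hr g

/-- The operator `j_α(x)` on `E ⊗ L²(G)`. -/
def jT (ρ : α.CovRep E) (x : A) : HTensor E (LTwo G ℂ) →L[ℂ] HTensor E (LTwo G ℂ) :=
  ((tensorIso (G := G) (E := E)).symm.toContinuousLinearEquiv :
      LTwo G E →L[ℂ] HTensor E (LTwo G ℂ)) ∘L ρ.jOp x ∘L
    ((tensorIso (G := G) (E := E)).toContinuousLinearEquiv :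
      HTensor E (LTwo G ℂ) →L[ℂ] LTwo G E)

theorem tensorIso_jT (ρ : α.CovRep E) (x : A) (v : HTensor E (LTwo G ℂ)) :
    tensorIso (jT ρ x v) = ρ.jOp x (tensorIso v) :=
  (tensorIso (G := G) (E := E)).apply_symm_apply _

theorem jT_comp_ket_ctsL (ρ : α.CovRep E) (x : A) (φ : C(G, ℂ)) :
    jT ρ x ∘L HTensor.ket (ctsL φ) =
      funCol ρ.π ⟨fun h => φ h • α.act h⁻¹ x, by have := α.continuous_act_inv x; fun_prop⟩ := by
  ext η
  apply (tensorIso (G := G) (E := E)).injective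
  rw [ContinuousLinearMap.comp_apply, tensorIso_jT, HTensor.ket_apply, tensorIso_htmul, ltmul_ctsL,
    funCol_apply, LinearIsometryEquiv.apply_symm_apply, CStarDynamics.CovRep.jOp_ctsL]
  congr 1
  ext h
  simp

open HTensor in
/-- The operators `j_α(x)` in two covariant representations correspond to each other, since the
column of a continuous function `φ` is the algebra valued function `h ↦ φ(h) α_{h⁻¹}(x)`. -/
theorem isAmp_jT (ρ : α.CovRep E) (ρ' : α.CovRep E') (x : A) :
    IsAmp ρ.π ρ'.π (jT (G := G) ρ x) (jT ρ' x) := by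
  intro k
  refine denseRange_ctsL.induction_on (p := fun k => (jT (G := G) ρ x ∘L ket k, jT ρ' x ∘L ket k) ∈
    colPair ρ.π ρ'.π (LTwo G ℂ)) k ?_ fun φ => ?_
  · refine isClosed_colPair.preimage (Continuous.prodMk ?_ ?_)
    · exact (ContinuousLinearMap.compL ℂ E _ _ (jT (G := G) ρ x)).continuous.comp
        (ket (E := E) (F := LTwo G ℂ)).continuous
    · exact (ContinuousLinearMap.compL ℂ E' _ _ (jT (G := G) ρ' x)).continuous.comp
        (ket (E := E') (F := LTwo G ℂ)).continuous
  · rw [jT_comp_ket_ctsL, jT_comp_ket_ctsL]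
    exact funCol_mem_colPair ρ.π ρ'.π _

end JOp

/-! ### The Peter–Weyl decomposition of `L²(G)` -/

section PeterWeyl

variable {G : Type*} [Group G] [TopologicalSpace G] [IsTopologicalGroup G] [CompactSpace G]
  [T2Space G] [MeasurableSpace G] [BorelSpace G]

theorem HTensor.isCompactOperator_of_mem_finiteRankClosure {K K₂ : Type*}
    [NormedAddCommGroup K] [InnerProductSpace ℂ K] [NormedAddCommGroup K₂]
    [InnerProductSpace ℂ K₂] [CompleteSpace K₂] {F : K →L[ℂ] K₂}
    (hF : F ∈ HTensor.finiteRankClosure K K₂) : IsCompactOperator F := by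
  have hle : HTensor.finiteRankClosure K K₂ ≤ compactOperator (RingHom.id ℂ) K K₂ := by
    rw [← compactOperator_topologicalClosure]
    refine Submodule.topologicalClosure_mono (Submodule.span_le.2 ?_)
    rintro _ ⟨k, l, rfl⟩
    have h : IsCompactOperator (ContinuousLinearMap.toSpanSingleton ℂ k ∘ innerSL ℂ l) :=
      (isCompactOperator_of_locallyCompactSpace_dom (innerSL ℂ l)).clm_comp _
    exact h
  exact hle hF

/-- The kernel function of the convolution operator with `ψ`, see `smooth_leftRepr_eq`. -/
def convVec (ψ : C(G, ℂ)) : C(G, LTwo G ℂ) :=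
  (⟨ctsL, ctsL.continuous⟩ : C(C(G, ℂ), LTwo G ℂ)).comp
    (ContinuousMap.curry ⟨fun p : G × G => (starRingEnd ℂ) (ψ (p.1 * p.2⁻¹)), by fun_prop⟩)

/-- The convolution operator `L²(G) → C(G)`. -/
def convL (ψ : C(G, ℂ)) : LTwo G ℂ →L[ℂ] C(G, ℂ) :=
  LinearMap.mkContinuous
    { toFun := fun f => ⟨fun h => ⟪convVec ψ h, f⟫_ℂ, by fun_prop⟩
      map_add' := fun f f' => by
        ext h
        exact inner_add_right (𝕜 := ℂ) (convVec ψ h) f f'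
      map_smul' := fun c f => by
        ext h
        exact inner_smul_right (𝕜 := ℂ) (convVec ψ h) f c } ‖convVec ψ‖ (fun f => by
    refine (ContinuousMap.norm_le _ (by positivity)).2 fun h => ?_
    exact (norm_inner_le_norm _ _).trans
      (mul_le_mul_of_nonneg_right ((convVec ψ).norm_coe_le_norm h) (norm_nonneg _)))

theorem smooth_leftRepr_eq (ψ : C(G, ℂ)) (f : LTwo G ℂ) :
    (leftRepr G ℂ).smooth ψ f = ctsL (convL ψ f) := by
  have : (leftRepr G ℂ).smooth ψ = ctsL ∘L convL ψ := by
    refine ctsL_ext_clm fun φ => ?_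
    rw [smooth_leftRepr_ctsL, ContinuousLinearMap.comp_apply]
    congr 1
    ext h
    have hK : Continuous fun g => φ g • convKernel ψ g :=
      φ.continuous.smul (convKernel ψ).continuous
    rw [integral_continuousMap_apply hK]
    refine Eq.trans ?_ (inner_ctsL _ _).symm
    refine integral_congr_ae (Filter.Eventually.of_forall fun g => ?_)
    change φ g * ψ (h * g⁻¹) = φ g * (starRingEnd ℂ) ((starRingEnd ℂ) (ψ (h * g⁻¹)))
    rw [Complex.conj_conj]
  exact DFunLike.congr_fun this f

/-- A vector which is fixed by all left translations is a constant function. -/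
theorem mem_span_one_of_leftTranslate_eq {f : LTwo G ℂ} (h : ∀ g, leftTranslate g f = f) :
    f ∈ Submodule.span ℂ {ctsL (1 : C(G, ℂ))} := by
  have h1 := (leftRepr G ℂ).smooth_one_of_fixed h
  rw [smooth_leftRepr_eq] at h1
  rw [← h1]
  refine Submodule.mem_span_singleton.2 ⟨⟪ctsL (1 : C(G, ℂ)), f⟫_ℂ, ?_⟩
  rw [← map_smul]
  congr 1
  ext g
  change _ * 1 = ⟪convVec 1 g, f⟫_ℂ
  rw [mul_one]
  congr 1
  change ctsL _ = ctsL _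
  congr 1
  ext k
  simp

/-- The finite-dimensional spaces of continuous functions which are invariant under left and right
translations. -/
structure IsBlock (W : Submodule ℂ (LTwo G ℂ)) : Prop where
  finiteDimensional : FiniteDimensional ℂ W
  left : ∀ g, ∀ f ∈ W, leftTranslate g f ∈ W
  right : ∀ g, ∀ f ∈ W, rightTranslate g f ∈ W
  continuous : ∀ f ∈ W, ∃ φ : C(G, ℂ), ctsL φ = f

theorem isBlock_span_one : IsBlock (Submodule.span ℂ {ctsL (1 : C(G, ℂ))}) where
  finiteDimensional := inferInstance
  left g f hf := by
    obtain ⟨c, rfl⟩ := Submodule.mem_span_singleton.1 hf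
    have : leftTranslate g (c • ctsL (1 : C(G, ℂ))) = c • ctsL (1 : C(G, ℂ)) :=
      map_smul (leftIso g) c _
    rwa [this]
  right g f hf := by
    obtain ⟨c, rfl⟩ := Submodule.mem_span_singleton.1 hf
    have : rightTranslate g (c • ctsL (1 : C(G, ℂ))) = c • ctsL (1 : C(G, ℂ)) :=
      map_smul (rightIso g) c _
    rwa [this]
  continuous f hf := by
    obtain ⟨c, rfl⟩ := Submodule.mem_span_singleton.1 hf
    exact ⟨c • 1, map_smul _ _ _⟩

/-- If `M` is a finite-dimensional space of continuous functions and invariant under right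
translations, then its left translates span a space of the same kind. -/
theorem exists_isBlock_of_right (M : Submodule ℂ (LTwo G ℂ)) [FiniteDimensional ℂ M]
    (hr : ∀ g, ∀ f ∈ M, rightTranslate g f ∈ M) (hc : ∀ f ∈ M, ∃ φ : C(G, ℂ), ctsL φ = f) :
    IsBlock (Submodule.span ℂ {f | ∃ g, ∃ v ∈ M, f = leftTranslate g v}) := by
  let b := stdOrthonormalBasis ℂ M
  choose φ hφ using fun i => hc (b i) (b i).2
  let c : Fin (Module.finrank ℂ M) → Fin (Module.finrank ℂ M) → C(G, ℂ) := fun i j =>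
    ⟨fun k => ⟪(b j : LTwo G ℂ), rightTranslate k (b i : LTwo G ℂ)⟫_ℂ,
      continuous_const.inner (continuous_rightTranslate _)⟩
  -- `λ_{g⁻¹} b_i = ∑ j, b_j(g) c_ij`
  have key (g : G) (i) : leftTranslate g (b i : LTwo G ℂ) = ∑ j, φ j g⁻¹ • ctsL (c i j) := by
    have h1 (k : G) : rightTranslate k (b i : LTwo G ℂ) = ∑ j, c i j k • (b j : LTwo G ℂ) := by
      have h := b.sum_repr ⟨rightTranslate k (b i : LTwo G ℂ), hr k _ (b i).2⟩
      have h2 := congrArg Subtype.val h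
      refine h2.symm.trans ?_
      rw [Submodule.coe_sum]
      refine Finset.sum_congr rfl fun j _ => ?_
      rw [b.repr_apply_apply]
      rfl
    have h2 (k g : G) : φ i (g * k) = ∑ j, c i j k * φ j g := by
      have h3 : (φ i).comp ⟨fun h => h * k, by fun_prop⟩ = ∑ j, c i j k • φ j := by
        apply ctsL_injective
        rw [← rightTranslate_ctsL, hφ, h1, map_sum]
        refine Finset.sum_congr rfl fun j _ => ?_
        rw [map_smul, hφ]
      have h4 := DFunLike.congr_fun h3 g
      simpa [ContinuousMap.sum_apply] using h4
    rw [← hφ, leftTranslate_ctsL]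
    simp only [← map_smul, ← map_sum]
    congr 1
    ext k
    change φ i (g⁻¹ * k) = _
    rw [h2, ContinuousMap.sum_apply]
    exact Finset.sum_congr rfl fun j _ => mul_comm _ _
  have hle : Submodule.span ℂ {f | ∃ g, ∃ v ∈ M, f = leftTranslate g v} ≤
      Submodule.span ℂ (Set.range fun p : Fin (Module.finrank ℂ M) × Fin (Module.finrank ℂ M) =>
        ctsL (c p.1 p.2)) := by
    refine Submodule.span_le.2 ?_
    rintro _ ⟨g, v, hv, rfl⟩
    have hv' : v = ∑ i, b.repr ⟨v, hv⟩ i • (b i : LTwo G ℂ) := by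
      have h := congrArg Subtype.val (b.sum_repr ⟨v, hv⟩)
      rw [Submodule.coe_sum] at h
      exact h.symm
    have h2 : leftTranslate g v = ∑ i, b.repr ⟨v, hv⟩ i • leftTranslate g (b i : LTwo G ℂ) := by
      conv_lhs => rw [hv', ← leftIso_apply, map_sum]
      exact Finset.sum_congr rfl fun i _ => map_smul (leftIso g) _ _
    rw [h2]
    refine Submodule.sum_mem _ fun i _ => Submodule.smul_mem _ _ ?_
    rw [key]
    exact Submodule.sum_mem _ fun j _ => Submodule.smul_mem _ _ (Submodule.subset_span ⟨(i, j), rfl⟩)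
  refine ⟨?_, fun g f hf => ?_, fun g f hf => ?_, fun f hf => ?_⟩
  · have : FiniteDimensional ℂ (Submodule.span ℂ
        (Set.range fun p : Fin (Module.finrank ℂ M) × Fin (Module.finrank ℂ M) =>
          ctsL (c p.1 p.2))) := FiniteDimensional.span_of_finite ℂ (Set.finite_range _)
    exact Submodule.finiteDimensional_of_le hle
  · refine Submodule.span_induction (p := fun f _ => (leftIso g) f ∈ _) ?_ ?_ ?_ ?_ hf
    · rintro _ ⟨k, v, hv, rfl⟩
      exact Submodule.subset_span ⟨g * k, v, hv, ((leftRepr G ℂ).op_mul_apply g k v).symm⟩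
    · rw [map_zero]; exact Submodule.zero_mem _
    · intro x y _ _ hx hy
      rw [map_add]; exact Submodule.add_mem _ hx hy
    · intro a x _ hx
      rw [map_smul]; exact Submodule.smul_mem _ a hx
  · refine Submodule.span_induction (p := fun f _ => (rightIso g) f ∈ _) ?_ ?_ ?_ ?_ hf
    · rintro _ ⟨k, v, hv, rfl⟩
      exact Submodule.subset_span ⟨k, _, hr g v hv, (leftTranslate_rightTranslate k g v).symm⟩
    · rw [map_zero]; exact Submodule.zero_mem _
    · intro x y _ _ hx hy
      rw [map_add]; exact Submodule.add_mem _ hx hy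
    · intro a x _ hx
      rw [map_smul]; exact Submodule.smul_mem _ a hx
  · have hle2 : Submodule.span ℂ (Set.range
        fun p : Fin (Module.finrank ℂ M) × Fin (Module.finrank ℂ M) => ctsL (c p.1 p.2)) ≤
        LinearMap.range (ctsL : C(G, ℂ) →L[ℂ] LTwo G ℂ).toLinearMap := by
      refine Submodule.span_le.2 ?_
      rintro _ ⟨p, rfl⟩
      exact ⟨_, rfl⟩
    exact hle2 (hle hf)

/-- Projections onto invariant subspaces are intertwiners. -/
theorem UnitaryRepr.starProjection_op {H : Type*} [NormedAddCommGroup H] [InnerProductSpace ℂ H]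
    (u : UnitaryRepr G H) (N : Submodule ℂ H) [N.HasOrthogonalProjection]
    (hN : ∀ g, ∀ v ∈ N, u.op g v ∈ N) (g : G) (v : H) :
    N.starProjection (u.op g v) = u.op g (N.starProjection v) := by
  refine Submodule.eq_starProjection_of_mem_of_inner_eq_zero
    (hN g _ (Submodule.starProjection_apply_mem _ _)) fun w hw => ?_
  rw [← map_sub, u.inner_op_left]
  exact Submodule.starProjection_inner_eq_zero _ _ (hN g⁻¹ w hw)

/-- Every nonzero closed subspace of `L²(G)` which is invariant under left and right translations
contains a nonzero finite-dimensional one: left translates of an eigenspace of a convolution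
operator. -/
theorem exists_isBlock_le (N : Submodule ℂ (LTwo G ℂ)) [N.HasOrthogonalProjection]
    (hl : ∀ g, ∀ f ∈ N, leftTranslate g f ∈ N) (hr : ∀ g, ∀ f ∈ N, rightTranslate g f ∈ N)
    (hN : N ≠ ⊥) : ∃ W ≤ N, W ≠ ⊥ ∧ IsBlock W := by
  obtain ⟨v, hv, hv0⟩ := Submodule.exists_mem_ne_zero_of_ne_bot hN
  obtain ⟨ψ, hψ, hψv⟩ := (leftRepr G ℂ).exists_smooth_sub_le v (half_pos (norm_pos_iff.2 hv0))
  set S := (leftRepr G ℂ).smooth ψ with hS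
  have hPS (f) : N.starProjection (S f) = S (N.starProjection f) :=
    UnitaryRepr.comp_smooth N.starProjection (fun g f => (leftRepr G ℂ).starProjection_op N hl g f)
      ψ f
  let T : LTwo G ℂ →L[ℂ] LTwo G ℂ := S ∘L N.starProjection
  have hTc : IsCompactOperator T :=
    (HTensor.isCompactOperator_of_mem_finiteRankClosure
      (smooth_leftRepr_mem_finiteRankClosure ψ)).comp_clm _
  have hTs : (T : LTwo G ℂ →ₗ[ℂ] LTwo G ℂ).IsSymmetric := fun f f' => by
    change ⟪S (N.starProjection f), f'⟫_ℂ = ⟪f, S (N.starProjection f')⟫_ℂ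
    rw [← hPS f', ← Submodule.inner_starProjection_left_eq_right, hS, UnitaryRepr.inner_smooth_left,
      UnitaryRepr.inner_smooth_right]
    simp only [hψ, Complex.conj_conj]
  have hT0 : T ≠ 0 := fun h => by
    have h1 : S v = 0 := by
      have := DFunLike.congr_fun h v
      change S (N.starProjection v) = 0 at this
      rwa [Submodule.starProjection_eq_self_iff.2 hv] at this
    rw [h1, zero_sub, norm_neg] at hψv
    linarith [norm_pos_iff.2 hv0]
  obtain ⟨μ, hμ, hμ0⟩ : ∃ μ, Module.End.HasEigenvalue (T : Module.End ℂ (LTwo G ℂ)) μ ∧ μ ≠ 0 := by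
    by_contra! h
    exact hT0 ((ContinuousLinearMap.eq_zero_of_forall_hasEigenvalue_eq_zero hTc hTs).1 h)
  let M := Module.End.eigenspace (T : Module.End ℂ (LTwo G ℂ)) μ
  have hM : FiniteDimensional ℂ M := ContinuousLinearMap.finite_dimensional_eigenspace hTc μ hμ0
  have hmem {f : LTwo G ℂ} : f ∈ M ↔ S (N.starProjection f) = μ • f :=
    Module.End.mem_eigenspace_iff
  have heq {f : LTwo G ℂ} (hf : f ∈ M) : f = μ⁻¹ • S (N.starProjection f) := by
    rw [hmem.1 hf, inv_smul_smul₀ hμ0]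
  have hMN : M ≤ N := fun f hf => by
    rw [heq hf, ← hPS]
    exact N.smul_mem _ (Submodule.starProjection_apply_mem _ _)
  have hMr (g : G) (f) (hf : f ∈ M) : rightTranslate g f ∈ M := by
    have h1 : N.starProjection (rightTranslate g f) = rightTranslate g (N.starProjection f) := by
      rw [← rightRepr_op, ← rightRepr_op]
      exact (rightRepr G).starProjection_op N (fun g f hf => by
        rw [rightRepr_op]
        exact hr g f hf) g f
    have h2 (f') : rightTranslate g (S f') = S (rightTranslate g f') :=
      UnitaryRepr.comp_smooth (rightIso g).toContinuousLinearMap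
        (fun k f => (leftTranslate_rightTranslate k g f).symm) ψ f'
    rw [hmem, h1, ← h2, hmem.1 hf]
    exact map_smul (rightIso g) _ _
  have hMc (f) (hf : f ∈ M) : ∃ φ : C(G, ℂ), ctsL φ = f :=
    ⟨μ⁻¹ • convL ψ (N.starProjection f), by rw [map_smul, ← smooth_leftRepr_eq]; exact (heq hf).symm⟩
  refine ⟨_, Submodule.span_le.2 ?_, ?_, exists_isBlock_of_right M hMr hMc⟩
  · rintro _ ⟨g, f, hf, rfl⟩
    exact hl g f (hMN hf)
  · intro h
    refine hμ (eq_bot_iff.2 ?_)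
    rw [← h]
    exact fun f hf => Submodule.subset_span ⟨1, f, hf, ((leftRepr G ℂ).op_one_apply f).symm⟩

variable (G) in
/-- The Peter–Weyl theorem, in the form that `L²(G)` is the closed orthogonal sum of
finite-dimensional spaces of continuous functions which are invariant under left and right
translations; one of them can be chosen to be the space of constant functions. -/
theorem exists_blocks : ∃ 𝒲 : Set (Submodule ℂ (LTwo G ℂ)), (∀ W ∈ 𝒲, IsBlock W) ∧
    (𝒲.Pairwise fun V W => V ⟂ W) ∧ Submodule.span ℂ {ctsL (1 : C(G, ℂ))} ∈ 𝒲 ∧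
    (sSup 𝒲)ᗮ = ⊥ := by
  obtain ⟨𝒲, h1, hmax⟩ := zorn_subset_nonempty
    {𝒲 : Set (Submodule ℂ (LTwo G ℂ)) | (∀ W ∈ 𝒲, IsBlock W) ∧ 𝒲.Pairwise fun V W => V ⟂ W}
    (fun c hc hch hne => ⟨⋃₀ c, ⟨fun W ⟨s, hs, hW⟩ => (hc hs).1 W hW,
      (Set.pairwise_sUnion hch.directedOn).2 fun s hs => (hc hs).2⟩,
      fun s hs => Set.subset_sUnion_of_mem hs⟩)
    {Submodule.span ℂ {ctsL (1 : C(G, ℂ))}} ⟨by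
      rintro W rfl
      exact isBlock_span_one, Set.pairwise_singleton _ _⟩
  refine ⟨𝒲, hmax.prop.1, hmax.prop.2, h1 rfl, ?_⟩
  by_contra hN
  have hinv (U : LTwo G ℂ ≃ₗᵢ[ℂ] LTwo G ℂ) (hU : ∀ W ∈ 𝒲, ∀ f ∈ W, U.symm f ∈ W) :
      ∀ f ∈ (sSup 𝒲)ᗮ, U f ∈ (sSup 𝒲)ᗮ := by
    intro f hf
    have hle : sSup 𝒲 ≤ (ℂ ∙ U f)ᗮ := sSup_le fun W hW w hw => by
      rw [Submodule.mem_orthogonal_singleton_iff_inner_left]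
      rw [← U.symm.inner_map_map, U.symm_apply_apply]
      exact (Submodule.mem_orthogonal _ f).1 hf _ (le_sSup hW (hU W hW w hw))
    refine (Submodule.mem_orthogonal _ _).2 fun w hw => ?_
    exact Submodule.mem_orthogonal_singleton_iff_inner_left.1 (hle hw)
  obtain ⟨W, hWN, hW0, hW⟩ := exists_isBlock_le (sSup 𝒲)ᗮ
    (fun g => hinv ((leftRepr G ℂ).op g) fun W hW f hf => by
      have : ((leftRepr G ℂ).op g).symm f = leftTranslate g⁻¹ f := by
        rw [LinearIsometryEquiv.symm_apply_eq]
        exact ((leftRepr G ℂ).op_op_inv g f).symm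
      rw [this]
      exact (hmax.prop.1 W hW).left _ f hf)
    (fun g f hf => by
      have := hinv ((rightRepr G).op g) (fun W hW f hf => by
        have : ((rightRepr G).op g).symm f = rightTranslate g⁻¹ f := by
          rw [LinearIsometryEquiv.symm_apply_eq, ← rightRepr_op]
          exact ((rightRepr G).op_op_inv g f).symm
        rw [this]
        exact (hmax.prop.1 W hW).right _ f hf) f hf
      rwa [rightRepr_op] at this) hN
  have hins : insert W 𝒲 ∈ {𝒲 : Set (Submodule ℂ (LTwo G ℂ)) | (∀ W ∈ 𝒲, IsBlock W) ∧
      𝒲.Pairwise fun V W => V ⟂ W} := by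
    refine ⟨?_, ?_⟩
    · rintro V (rfl | hV)
      · exact hW
      · exact hmax.prop.1 V hV
    · have : Std.Symm fun V W : Submodule ℂ (LTwo G ℂ) => V ⟂ W := ⟨fun V W h => h.symm⟩
      refine Set.pairwise_insert_of_symm.2 ⟨hmax.prop.2, fun V hV _ => ?_⟩
      refine Submodule.IsOrtho.symm ?_
      refine (Submodule.isOrtho_orthogonal_right _).mono (le_sSup hV) hWN
  have hmem : W ∈ 𝒲 := hmax.le_of_ge hins (Set.subset_insert _ _) (Set.mem_insert _ _)
  refine hW0 (eq_bot_iff.2 fun f hf => ?_)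
  have h3 := (Submodule.mem_orthogonal _ f).1 (hWN hf) f (le_sSup hmem hf)
  exact inner_self_eq_zero.1 h3

end PeterWeyl

/-! ### Subrepresentations, Hilbert sums and matrix coefficients -/

namespace UnitaryRepr

section Restrict

variable {G H V : Type*} [Group G] [TopologicalSpace G] [NormedAddCommGroup H]
  [InnerProductSpace ℂ H] [NormedAddCommGroup V] [InnerProductSpace ℂ V]

/-- The restriction of a unitary representation to an invariant subspace. -/
def restrict (u : UnitaryRepr G H) (W : Submodule ℂ H) (hW : ∀ g, ∀ v ∈ W, u.op g v ∈ W) :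
    UnitaryRepr G W :=
  UnitaryRepr.ofIsometries
    (fun g =>
      { toFun := fun v => ⟨u.op g v, hW g v v.2⟩
        map_add' := fun v w => Subtype.ext (map_add (u.op g) (v : H) w)
        map_smul' := fun c v => Subtype.ext (map_smul (u.op g) c (v : H))
        norm_map' := fun v => (u.op g).norm_map (v : H) })
    (fun v => Subtype.ext (u.op_one_apply (v : H)))
    (fun g h v => Subtype.ext (u.op_mul_apply g h (v : H)))
    (fun v => (u.continuous_op (v : H)).subtype_mk _)

variable {d : ℕ} {W : Submodule ℂ H}

/-- The matrix coefficients of a representation on an invariant subspace with orthonormal basis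
`b`. -/
def coeff (u : UnitaryRepr G H) (b : OrthonormalBasis (Fin d) ℂ W) (i j : Fin d) : C(G, ℂ) :=
  ⟨fun g => ⟪(b i : H), u.op g (b j : H)⟫_ℂ, continuous_const.inner (u.continuous_op _)⟩

theorem coeff_apply (u : UnitaryRepr G H) (b : OrthonormalBasis (Fin d) ℂ W) (i j : Fin d) (g : G) :
    u.coeff b i j g = ⟪(b i : H), u.op g (b j : H)⟫_ℂ := rfl

theorem sum_inner_smul (b : OrthonormalBasis (Fin d) ℂ W) {v : H} (hv : v ∈ W) :
    ∑ i, ⟪(b i : H), v⟫_ℂ • (b i : H) = v := by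
  have h := congrArg Subtype.val (b.sum_repr ⟨v, hv⟩)
  rw [Submodule.coe_sum] at h
  refine Eq.trans (Finset.sum_congr rfl fun i _ => ?_) h
  rw [b.repr_apply_apply]
  rfl

theorem inner_basis (b : OrthonormalBasis (Fin d) ℂ W) (i j : Fin d) :
    ⟪(b i : H), (b j : H)⟫_ℂ = if i = j then 1 else 0 :=
  orthonormal_iff_ite.1 b.orthonormal i j

theorem op_basis (u : UnitaryRepr G H) (b : OrthonormalBasis (Fin d) ℂ W)
    (hW : ∀ g, ∀ v ∈ W, u.op g v ∈ W) (g : G) (j : Fin d) :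
    u.op g (b j : H) = ∑ i, u.coeff b i j g • (b i : H) :=
  (sum_inner_smul b (hW g _ (b j).2)).symm

theorem coeff_mul (u : UnitaryRepr G H) (b : OrthonormalBasis (Fin d) ℂ W)
    (hW : ∀ g, ∀ v ∈ W, u.op g v ∈ W) (i j : Fin d) (g h : G) :
    u.coeff b i j (g * h) = ∑ l, u.coeff b i l g * u.coeff b l j h := by
  rw [coeff_apply, u.op_mul_apply, u.op_basis b hW h, map_sum, inner_sum]
  refine Finset.sum_congr rfl fun l _ => ?_
  rw [map_smul, inner_smul_right, mul_comm, coeff_apply u b i l]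

theorem coeff_inv (u : UnitaryRepr G H) (b : OrthonormalBasis (Fin d) ℂ W) (i j : Fin d) (g : G) :
    u.coeff b i j g⁻¹ = (starRingEnd ℂ) (u.coeff b j i g) := by
  rw [coeff_apply, coeff_apply, ← u.inner_op_left, inner_conj_symm]

theorem coeff_one (u : UnitaryRepr G H) (b : OrthonormalBasis (Fin d) ℂ W) (i j : Fin d) :
    u.coeff b i j 1 = if i = j then 1 else 0 := by
  rw [coeff_apply, u.op_one_apply, inner_basis]

theorem sum_coeff_mul_conj (u : UnitaryRepr G H) (b : OrthonormalBasis (Fin d) ℂ W)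
    (hW : ∀ g, ∀ v ∈ W, u.op g v ∈ W) (i i' : Fin d) (g : G) :
    ∑ j, u.coeff b i j g * (starRingEnd ℂ) (u.coeff b i' j g) = if i = i' then 1 else 0 := by
  simp only [← u.coeff_inv b]
  rw [← u.coeff_mul b hW, mul_inv_cancel, u.coeff_one]

end Restrict

section LpSum

variable {G ι : Type*} [Group G] [TopologicalSpace G] [DecidableEq ι] {V : ι → Type*}
  [∀ q, NormedAddCommGroup (V q)] [∀ q, InnerProductSpace ℂ (V q)]
  (σ : ∀ q, UnitaryRepr G (V q))

/-- The operators of the Hilbert sum of unitary representations. -/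
def lpOp (g : G) : lp V 2 →ₗᵢ[ℂ] lp V 2 where
  toFun v := ⟨fun q => (σ q).op g (v q), by
    have h := lp.memℓp v
    rw [← memℓp_norm_iff] at h
    refine memℓp_norm_iff.1 ?_
    simpa only [LinearIsometryEquiv.norm_map] using h⟩
  map_add' v w := lp.ext (funext fun q => map_add ((σ q).op g) (v q) (w q))
  map_smul' c v := lp.ext (funext fun q => map_smul ((σ q).op g) c (v q))
  norm_map' v := by
    have h2 : 0 < (2 : ENNReal).toReal := by norm_num
    rw [lp.norm_eq_tsum_rpow h2, lp.norm_eq_tsum_rpow h2]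
    congr 1
    refine tsum_congr fun q => ?_
    change ‖(σ q).op g (v q)‖ ^ _ = _
    rw [LinearIsometryEquiv.norm_map]

theorem lpOp_apply (g : G) (v : lp V 2) (q : ι) : lpOp σ g v q = (σ q).op g (v q) := rfl

theorem lpOp_single (g : G) (q : ι) (v : V q) :
    lpOp σ g (lp.single 2 q v) = lp.single 2 q ((σ q).op g v) := by
  refine lp.ext (funext fun q' => ?_)
  rw [lpOp_apply]
  by_cases h : q' = q
  · subst h
    rw [lp.single_apply_self, lp.single_apply_self]
  · rw [lp.single_apply_ne _ _ _ h, lp.single_apply_ne _ _ _ h, map_zero]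

/-- The Hilbert sum of unitary representations. -/
def lpSum : UnitaryRepr G (lp V 2) :=
  UnitaryRepr.ofIsometries (lpOp σ)
    (fun v => lp.ext (funext fun q => (σ q).op_one_apply (v q)))
    (fun g h v => lp.ext (funext fun q => (σ q).op_mul_apply g h (v q)))
    (fun v => by
      have hs := lp.hasSum_single (p := 2) (by norm_num) v
      refine (isClosed_continuityVectors (lpOp σ)).mem_of_tendsto hs
        (Filter.Eventually.of_forall fun s => ?_)
      refine (continuityVectors (lpOp σ)).sum_mem fun q _ => ?_
      change Continuous fun g => lpOp σ g (lp.single 2 q (v q))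
      simp only [lpOp_single]
      exact (lp.isometry_single q).continuous.comp ((σ q).continuous_op (v q)))

theorem lpSum_op_single (g : G) (q : ι) (v : V q) :
    (lpSum σ).op g (lp.single 2 q v) = lp.single 2 q ((σ q).op g v) := lpOp_single σ g q v

theorem finiteDimensional_multiplicitySpace_lpSum {V₀ : Type*} [NormedAddCommGroup V₀]
    [InnerProductSpace ℂ V₀] (σ₀ : UnitaryRepr G V₀)
    (hfin : {q | (σ q).multiplicitySpace σ₀ ≠ ⊥}.Finite)
    (hfd : ∀ q, FiniteDimensional ℂ ((σ q).multiplicitySpace σ₀)) :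
    FiniteDimensional ℂ ((lpSum σ).multiplicitySpace σ₀) := by
  have := hfin.to_subtype
  let c : ∀ q, (lpSum σ).multiplicitySpace σ₀ →ₗ[ℂ] (σ q).multiplicitySpace σ₀ := fun q =>
    { toFun := fun T => ⟨lp.evalCLM ℂ V 2 q ∘L T.1, fun g v =>
        congrArg (fun w : lp V 2 => w q) (T.2 g v)⟩
      map_add' := fun T T' => rfl
      map_smul' := fun a T => rfl }
  let C : (lpSum σ).multiplicitySpace σ₀ →ₗ[ℂ]
      (∀ q : {q | (σ q).multiplicitySpace σ₀ ≠ ⊥}, (σ q).multiplicitySpace σ₀) :=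
    LinearMap.pi fun q => c q
  refine FiniteDimensional.of_injective C ?_
  rw [← LinearMap.ker_eq_bot, LinearMap.ker_eq_bot']
  intro T hT
  refine Subtype.ext (ContinuousLinearMap.ext fun v => lp.ext (funext fun q => ?_))
  by_cases hq : (σ q).multiplicitySpace σ₀ = ⊥
  · have h1 : (c q T).1 = 0 := (Submodule.eq_bot_iff _).1 hq _ (c q T).2
    exact DFunLike.congr_fun h1 v
  · have h1 := congrArg Subtype.val (congrFun hT ⟨q, hq⟩)
    exact DFunLike.congr_fun h1 v

end LpSum

end UnitaryRepr

section BlockCoeff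

variable {G : Type*} [Group G] [TopologicalSpace G] [IsTopologicalGroup G] [CompactSpace G]
  [T2Space G] [MeasurableSpace G] [BorelSpace G]

/-- The left regular representation on a block has finite multiplicity. -/
theorem IsBlock.finiteDimensional_hom {W : Submodule ℂ (LTwo G ℂ)} (hW : IsBlock W) {V : Type*}
    [NormedAddCommGroup V] [InnerProductSpace ℂ V] [FiniteDimensional ℂ V] (σ : UnitaryRepr G V) :
    FiniteDimensional ℂ (((leftRepr G ℂ).restrict W hW.left).multiplicitySpace σ) := by
  have := hW.finiteDimensional
  infer_instance

/-- Only finitely many blocks in an orthogonal family contain a given finite-dimensional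
representation: an intertwiner `T` into functions is determined by the functional `v ↦ (T v)(1)`. -/
theorem finite_blocks_of_repr {𝒲 : Set (Submodule ℂ (LTwo G ℂ))} (h𝒲 : ∀ W ∈ 𝒲, IsBlock W)
    (horth : 𝒲.Pairwise fun V W => V ⟂ W) {V : Type*}
    [NormedAddCommGroup V] [InnerProductSpace ℂ V] [FiniteDimensional ℂ V] (σ : UnitaryRepr G V) :
    {W : 𝒲 | ((leftRepr G ℂ).restrict W.1 (h𝒲 W.1 W.2).left).multiplicitySpace σ ≠ ⊥}.Finite := by
  let e : (V →L[ℂ] ℂ) → V → C(G, ℂ) := fun ℓ v => ⟨fun h => ℓ (σ.op h⁻¹ v),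
    ℓ.continuous.comp ((σ.continuous_op v).comp continuous_inv)⟩
  let Θ : (V →L[ℂ] ℂ) →ₗ[ℂ] (V →ₗ[ℂ] LTwo G ℂ) := LinearMap.mk₂ ℂ (fun ℓ v => ctsL (e ℓ v))
    (fun ℓ ℓ' v => map_add ctsL (e ℓ v) (e ℓ' v))
    (fun c ℓ v => map_smul ctsL c (e ℓ v))
    (fun ℓ v w => by
      rw [← map_add]
      congr 1
      ext h
      simp [e])
    (fun c ℓ v => by
      rw [← map_smul]
      congr 1
      ext h
      simp [e])
  let X : 𝒲 → Submodule ℂ (LinearMap.range Θ) := fun W =>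
    { carrier := {T | ∀ v, T.1 v ∈ W.1}
      add_mem' := fun hS hT v => W.1.add_mem (hS v) (hT v)
      zero_mem' := fun v => W.1.zero_mem
      smul_mem' := fun c T hT v => W.1.smul_mem c (hT v) }
  -- the blocks are orthogonal, so the spaces `X W` are independent in a finite-dimensional space
  have hX : iSupIndep X := by
    intro W
    rw [Submodule.disjoint_def]
    intro T hT hT'
    have hle : ⨆ W', ⨆ (_ : W' ≠ W), X W' ≤
        { carrier := {T | ∀ v, T.1 v ∈ W.1ᗮ}
          add_mem' := fun hS hT v => W.1ᗮ.add_mem (hS v) (hT v)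
          zero_mem' := fun v => W.1ᗮ.zero_mem
          smul_mem' := fun c T hT v => W.1ᗮ.smul_mem c (hT v) } := by
      refine iSup₂_le fun W' hW' T hT v => ?_
      exact (horth W'.2 W.2 fun h => hW' (Subtype.ext h)) (hT v)
    refine Subtype.ext (LinearMap.ext fun v => ?_)
    have h1 := (Submodule.mem_orthogonal _ _).1 (hle hT' v) _ (hT v)
    exact inner_self_eq_zero.1 h1
  refine (WellFoundedGT.finite_ne_bot_of_iSupIndep hX).subset fun W hW hXW => hW ?_
  refine eq_bot_iff.2 fun T hT => ?_
  choose φ hφ using fun v => (h𝒲 W.1 W.2).continuous (T v : LTwo G ℂ) (T v).2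
  -- the functional `v ↦ (T v)(1)`, which determines the intertwiner `T`
  let ℓ : V →ₗ[ℂ] ℂ :=
    { toFun := fun v => φ v 1
      map_add' := fun v w => by
        have : φ (v + w) = φ v + φ w := ctsL_injective (by
          rw [map_add, hφ, hφ, hφ, map_add]
          rfl)
        rw [this]
        rfl
      map_smul' := fun c v => by
        have : φ (c • v) = c • φ v := ctsL_injective (by
          rw [map_smul, hφ, hφ, map_smul]
          rfl)
        rw [this]
        rfl }
  have hℓ (v : V) : Θ (LinearMap.toContinuousLinearMap ℓ) v = (T v : LTwo G ℂ) := by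
    rw [← hφ v]
    change ctsL _ = ctsL _
    congr 1
    ext h
    change φ (σ.op h⁻¹ v) 1 = φ v h
    have h1 : φ (σ.op h⁻¹ v) = (φ v).comp ⟨fun k => h⁻¹⁻¹ * k, by fun_prop⟩ := ctsL_injective (by
      rw [← leftTranslate_ctsL, hφ, hφ, hT h⁻¹ v]
      rfl)
    rw [h1]
    simp
  have hmem : (⟨Θ (LinearMap.toContinuousLinearMap ℓ), ⟨_, rfl⟩⟩ : LinearMap.range Θ) ∈ X W :=
    fun v => by
      change Θ (LinearMap.toContinuousLinearMap ℓ) v ∈ W.1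
      rw [hℓ]
      exact (T v).2
  rw [hXW, Submodule.mem_bot] at hmem
  have h0 : Θ (LinearMap.toContinuousLinearMap ℓ) = 0 := congrArg Subtype.val hmem
  refine (Submodule.mem_bot ℂ).2 (ContinuousLinearMap.ext fun v => Subtype.ext ?_)
  rw [← hℓ v, h0]
  rfl

variable {W : Submodule ℂ (LTwo G ℂ)} {d : ℕ}

/-- The reproducing kernel of an invariant space is invariant. -/
theorem kernel_invariant (u : UnitaryRepr G (LTwo G ℂ)) (b : OrthonormalBasis (Fin d) ℂ W)
    (hW : ∀ g, ∀ v ∈ W, u.op g v ∈ W) (φ : Fin d → C(G, ℂ)) (hφ : ∀ j, ctsL (φ j) = b j) (g : G)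
    (τ : C(G, G)) (hτ : ∀ φ : C(G, ℂ), u.op g (ctsL φ) = ctsL (φ.comp τ)) (x y : G) :
    ∑ j, φ j (τ x) * (starRingEnd ℂ) (φ j (τ y)) = ∑ j, φ j x * (starRingEnd ℂ) (φ j y) := by
  have h1 (j : Fin d) (x : G) : φ j (τ x) = ∑ i, u.coeff b i j g * φ i x := by
    have : (φ j).comp τ = ∑ i, u.coeff b i j g • φ i := by
      apply ctsL_injective
      rw [← hτ, hφ, u.op_basis b hW, map_sum]
      exact Finset.sum_congr rfl fun i _ => by rw [map_smul, hφ]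
    simpa [ContinuousMap.sum_apply] using DFunLike.congr_fun this x
  calc ∑ j, φ j (τ x) * (starRingEnd ℂ) (φ j (τ y))
      = ∑ i, ∑ i', (∑ j, u.coeff b i j g * (starRingEnd ℂ) (u.coeff b i' j g)) *
          (φ i x * (starRingEnd ℂ) (φ i' y)) := by
        simp only [h1, map_sum, map_mul]
        simp only [Finset.sum_mul_sum]
        rw [Finset.sum_comm]
        refine Finset.sum_congr rfl fun i _ => ?_
        rw [Finset.sum_comm]
        refine Finset.sum_congr rfl fun i' _ => ?_
        rw [Finset.sum_mul]
        refine Finset.sum_congr rfl fun j _ => ?_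
        ring
    _ = ∑ j, φ j x * (starRingEnd ℂ) (φ j y) := by
        simp only [u.sum_coeff_mul_conj b hW, ite_mul, one_mul, zero_mul, Finset.sum_ite_eq,
          Finset.mem_univ, if_true]

/-- The conjugate matrix coefficients of the left regular representation on a block form a Parseval
frame: the trace of the translation by `k'⁻¹ * k` is the value of the reproducing kernel at
`(k, k')`. -/
theorem IsBlock.frame (hW : IsBlock W) (b : OrthonormalBasis (Fin d) ℂ W) {f : LTwo G ℂ}
    (hf : f ∈ W) :
    ∑ i, ∑ j, ⟪ctsL (star ((leftRepr G ℂ).coeff b i j)), f⟫_ℂ •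
      ctsL (star ((leftRepr G ℂ).coeff b i j)) = f := by
  set L := (leftRepr G ℂ).coeff b with hL
  choose φ hφ using fun j => hW.continuous (b j) (b j).2
  have hl (g x y : G) : ∑ j, φ j (g * x) * (starRingEnd ℂ) (φ j (g * y)) =
      ∑ j, φ j x * (starRingEnd ℂ) (φ j y) := by
    have := kernel_invariant (leftRepr G ℂ) b hW.left φ hφ g⁻¹ ⟨fun h => g⁻¹⁻¹ * h, by fun_prop⟩
      (fun φ => leftTranslate_ctsL _ φ) x y
    simpa using this
  have hr (g x y : G) : ∑ j, φ j (x * g) * (starRingEnd ℂ) (φ j (y * g)) =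
      ∑ j, φ j x * (starRingEnd ℂ) (φ j y) :=
    kernel_invariant (rightRepr G) b (fun g v hv => by rw [rightRepr_op]; exact hW.right g v hv)
      φ hφ g ⟨fun h => h * g, by fun_prop⟩
      (fun φ => by rw [rightRepr_op, rightTranslate_ctsL]) x y
  have hcoeff (k : G) (j : Fin d) : L j j k = ∫ h, (starRingEnd ℂ) (φ j h) * φ j (k⁻¹ * h) ∂haarP G := by
    rw [hL, UnitaryRepr.coeff_apply, leftRepr_op, ← hφ j, leftTranslate_ctsL, inner_ctsL]
    refine integral_congr_ae (Filter.Eventually.of_forall fun h => ?_)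
    simp [mul_comm]
  have htrace (k k' : G) : ∑ i, ∑ j, (starRingEnd ℂ) (L i j k) * L i j k' =
      ∑ j, φ j k * (starRingEnd ℂ) (φ j k') := by
    calc ∑ i, ∑ j, (starRingEnd ℂ) (L i j k) * L i j k' = ∑ j, L j j (k⁻¹ * k') := by
          rw [Finset.sum_comm]
          refine Finset.sum_congr rfl fun j _ => ?_
          rw [hL, (leftRepr G ℂ).coeff_mul b hW.left]
          exact Finset.sum_congr rfl fun i _ => by rw [UnitaryRepr.coeff_inv]
      _ = ∫ h, ∑ j, φ j (k'⁻¹ * k * h) * (starRingEnd ℂ) (φ j h) ∂haarP G := by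
          rw [integral_finsetSum _ fun j _ => integrable_of_continuous (by fun_prop)]
          refine Finset.sum_congr rfl fun j _ => ?_
          rw [hcoeff]
          refine integral_congr_ae (Filter.Eventually.of_forall fun h => ?_)
          simp [mul_comm]
      _ = ∫ h, ∑ j, φ j k * (starRingEnd ℂ) (φ j k') ∂haarP G := by
          refine integral_congr_ae (Filter.Eventually.of_forall fun h => ?_)
          have h1 := hr h (k'⁻¹ * k) 1
          have h2 := hl k' (k'⁻¹ * k) 1
          rw [one_mul] at h1
          rw [mul_inv_cancel_left, mul_one] at h2
          exact h1.trans h2.symm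
      _ = _ := by simp
  obtain ⟨ψ, hψ⟩ := hW.continuous f hf
  have hexp : ψ = ∑ j, ⟪ctsL (φ j), ctsL ψ⟫_ℂ • φ j := by
    apply ctsL_injective
    rw [map_sum, hψ]
    conv_lhs => rw [← UnitaryRepr.sum_inner_smul b hf]
    exact Finset.sum_congr rfl fun j _ => by rw [map_smul, hφ]
  rw [← hψ]
  simp only [← map_smul, ← map_sum]
  congr 1
  ext k
  have hsum (F : Fin d → Fin d → C(G, ℂ)) : (∑ i, ∑ j, F i j) k = ∑ i, ∑ j, F i j k := by
    rw [ContinuousMap.sum_apply]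
    exact Finset.sum_congr rfl fun i _ => ContinuousMap.sum_apply _ _ _
  rw [hsum]
  simp only [ContinuousMap.smul_apply, smul_eq_mul, inner_ctsL]
  have hi (i j : Fin d) : (∫ h, ⟪(star (L i j)) h, ψ h⟫_ℂ ∂haarP G) * star (L i j k) =
      ∫ h, ((starRingEnd ℂ) (L i j k) * L i j h) * ψ h ∂haarP G := by
    rw [← integral_mul_const]
    refine integral_congr_ae (Filter.Eventually.of_forall fun h => ?_)
    simp
    ring
  refine (Finset.sum_congr rfl fun i _ => Finset.sum_congr rfl fun j _ => hi i j).trans ?_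
  have hint (i j : Fin d) : Integrable (fun h => ((starRingEnd ℂ) (L i j k) * L i j h) * ψ h)
      (haarP G) := integrable_of_continuous (by fun_prop)
  calc ∑ i, ∑ j, ∫ h, ((starRingEnd ℂ) (L i j k) * L i j h) * ψ h ∂haarP G
      = ∫ h, (∑ i, ∑ j, (starRingEnd ℂ) (L i j k) * L i j h) * ψ h ∂haarP G := by
        simp only [Finset.sum_mul]
        rw [integral_finsetSum _ fun i _ => integrable_finsetSum _ fun j _ => hint i j]
        exact Finset.sum_congr rfl fun i _ => (integral_finsetSum _ fun j _ => hint i j).symm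
    _ = ∑ j, (∫ h, (starRingEnd ℂ) (φ j h) * ψ h ∂haarP G) * φ j k := by
        simp only [htrace, Finset.sum_mul]
        rw [integral_finsetSum _ fun j _ => integrable_of_continuous (by fun_prop)]
        refine Finset.sum_congr rfl fun j _ => ?_
        rw [← integral_mul_const]
        refine integral_congr_ae (Filter.Eventually.of_forall fun h => ?_)
        simp only
        ring
    _ = ψ k := by
        conv_rhs => rw [hexp]
        simp only [ContinuousMap.sum_apply, ContinuousMap.smul_apply, smul_eq_mul, inner_ctsL]
        refine Finset.sum_congr rfl fun j _ => ?_
        congr 1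
        refine integral_congr_ae (Filter.Eventually.of_forall fun h => ?_)
        simp [mul_comm]

end BlockCoeff

/-! ### Frames of equivariant rows in a free C*-dynamical system -/

section Invertible

variable {M : Type*} [CStarAlgebra M] [PartialOrder M] [StarOrderedRing M]

/-- Cauchy–Schwarz for a finite sum of products `x * t`. -/
theorem exists_star_mul_self_le {𝒯 : Set M} {z : M}
    (hz : z ∈ AddSubmonoid.closure {w | ∃ x, ∃ t ∈ 𝒯, w = x * t}) :
    ∃ l : List M, (∀ t ∈ l, t ∈ 𝒯) ∧ ∃ c : ℝ, 0 < c ∧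
      star z * z ≤ c • (l.map fun t => star t * t).sum := by
  induction hz using AddSubmonoid.closure_induction with
  | mem w hw =>
    obtain ⟨x, t, ht, rfl⟩ := hw
    refine ⟨[t], by simpa using ht, ‖star x * x‖ + 1, by positivity, ?_⟩
    -- the summand `1` keeps the constant positive if `x = 0`
    have h1 : star (x * t) * (x * t) = star t * (star x * x) * t := by
      rw [star_mul]; simp only [mul_assoc]
    have h2 : star t * (star x * x) * t ≤ ‖star x * x‖ • (star t * t) :=
      CStarAlgebra.star_left_conjugate_le_norm_smul (IsSelfAdjoint.star_mul_self x)
    rw [h1]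
    refine h2.trans ?_
    simp only [List.map_cons, List.map_nil, List.sum_cons, List.sum_nil, add_zero, add_smul,
      one_smul]
    exact le_add_of_nonneg_right (star_mul_self_nonneg t)
  | zero => exact ⟨[], by simp, 1, one_pos, by simp⟩
  | add a b _ _ ha hb =>
    obtain ⟨l, hl, c, hc, hlc⟩ := ha
    obtain ⟨l', hl', c', hc', hlc'⟩ := hb
    have hpos (l : List M) : 0 ≤ (l.map fun t => star t * t).sum :=
      List.sum_nonneg fun x hx => by
        obtain ⟨t, _, rfl⟩ := List.mem_map.1 hx
        exact star_mul_self_nonneg t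
    refine ⟨l ++ l', fun t ht => (List.mem_append.1 ht).elim (hl t) (hl' t),
      2 * (c + c'), by positivity, ?_⟩
    -- the parallelogram law dominates the mixed terms
    have h1 : star (a + b) * (a + b) + star (a - b) * (a - b) =
        (2 : ℝ) • (star a * a + star b * b) := by
      rw [two_smul, star_add, star_sub]
      noncomm_ring
    calc star (a + b) * (a + b) ≤ star (a + b) * (a + b) + star (a - b) * (a - b) :=
          le_add_of_nonneg_right (star_mul_self_nonneg _)
      _ = (2 : ℝ) • (star a * a + star b * b) := h1
      _ ≤ (2 : ℝ) • (c • (l.map fun t => star t * t).sum + c' • (l'.map fun t => star t * t).sum) :=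
          smul_le_smul_of_nonneg_left (add_le_add hlc hlc') zero_le_two
      _ ≤ (2 : ℝ) • ((c + c') • ((l.map fun t => star t * t).sum) +
            (c + c') • (l'.map fun t => star t * t).sum) := by
          refine smul_le_smul_of_nonneg_left (add_le_add ?_ ?_) zero_le_two
          · exact smul_le_smul_of_nonneg_right (le_add_of_nonneg_right hc'.le) (hpos l)
          · exact smul_le_smul_of_nonneg_right (le_add_of_nonneg_left hc.le) (hpos l')
      _ = _ := by
          rw [List.map_append, List.sum_append, mul_smul, ← smul_add]

/-- If the left ideal generated by `𝒯` is dense, some finite sum `∑ t* t` with `t ∈ 𝒯` is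
invertible. -/
theorem exists_isUnit_sum {𝒯 : Set M}
    (h : (1 : M) ∈ (AddSubmonoid.closure {w | ∃ x, ∃ t ∈ 𝒯, w = x * t}).topologicalClosure) :
    ∃ l : List M, (∀ t ∈ l, t ∈ 𝒯) ∧ IsUnit (l.map fun t => star t * t).sum := by
  -- the invertible elements are open, so the ideal contains one of them
  obtain ⟨z, hz, hzu⟩ := mem_closure_iff.1 h {z | IsUnit z} Units.isOpen isUnit_one
  obtain ⟨l, hl, c, hc, hle⟩ := exists_star_mul_self_le hzu
  refine ⟨l, hl, ?_⟩
  have hu : IsUnit (c • (l.map fun t => star t * t).sum) :=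
    CStarAlgebra.isUnit_of_le _ hle
      (IsUnit.isStrictlyPositive ((IsUnit.star hz).mul hz) (star_mul_self_nonneg z))
  exact (isUnit_smul_iff (Units.mk0 c hc.ne') _).1 hu

/-- Polar decomposition: an invertible sum `∑ t* t` is normalized by a positive `P`, in a way
compatible with every *-endomorphism acting on each `t` by right multiplication with a fixed
unitary. -/
theorem exists_normalizer {l : List M} (hu : IsUnit (l.map fun t => star t * t).sum) :
    ∃ P : M, star P = P ∧ P * (l.map fun t => star t * t).sum * P = 1 ∧
      ∀ (Ψ : M →⋆ₙₐ[ℂ] M) (V : M), star V * V = 1 → V * star V = 1 →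
        (∀ t ∈ l, Ψ t = t * V) → ∀ t ∈ l, Ψ (t * P) = t * P * V := by
  set S := (l.map fun t => star t * t).sum with hS
  have hS0 : 0 ≤ S := List.sum_nonneg fun x hx => by
    obtain ⟨t, _, rfl⟩ := List.mem_map.1 hx
    exact star_mul_self_nonneg t
  set Q := CFC.sqrt S with hQ
  have hQQ : Q * Q = S := CFC.sqrt_mul_sqrt_self S hS0
  have hQ0 : 0 ≤ Q := CFC.sqrt_nonneg S
  have hQu : IsUnit Q := (CFC.isUnit_sqrt_iff S hS0).2 hu
  obtain ⟨P, hQP, hPQ⟩ := isUnit_iff_exists.1 hQu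
  have hQsa : star Q = Q := (IsSelfAdjoint.of_nonneg hQ0).star_eq
  have hPsa : star P = P := by
    have h1 : star P * Q = 1 := by
      have := congrArg star hQP
      rwa [star_mul, star_one, hQsa] at this
    calc star P = star P * (Q * P) := by rw [hQP, mul_one]
      _ = P := by rw [← mul_assoc, h1, one_mul]
  refine ⟨P, hPsa, ?_, fun Ψ V hVl hVr hl => ?_⟩
  · calc P * S * P = (P * Q) * (Q * P) := by rw [← hQQ]; simp only [mul_assoc]
      _ = 1 := by rw [hPQ, hQP, mul_one]
  have hΨS : Ψ S = star V * S * V := by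
    have h1 : ∀ l : List M, (∀ t ∈ l, Ψ t = t * V) →
        Ψ (l.map fun t => star t * t).sum = star V * (l.map fun t => star t * t).sum * V := by
      intro l
      induction l with
      | nil => simp
      | cons t l ih =>
        intro hl
        rw [List.map_cons, List.sum_cons, map_add, ih fun t ht => hl t (List.mem_cons_of_mem _ ht),
          map_mul, map_star, hl t List.mem_cons_self, star_mul, mul_add, add_mul]
        simp only [mul_assoc]
    exact h1 l hl
  -- positive square roots are unique
  have hΨQ : Ψ Q = star V * Q * V := by
    have hpos1 : 0 ≤ Ψ Q := by
      obtain ⟨b, hb⟩ := CStarAlgebra.nonneg_iff_eq_star_mul_self.1 hQ0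
      rw [hb, map_mul, map_star]
      exact star_mul_self_nonneg _
    have hpos2 : 0 ≤ star V * Q * V := star_left_conjugate_nonneg hQ0 _
    rw [← CFC.mul_self_eq_mul_self_iff _ _ hpos1 hpos2, ← map_mul, hQQ, hΨS, ← hQQ]
    calc star V * (Q * Q) * V = star V * Q * 1 * Q * V := by
          simp only [mul_assoc, one_mul]
      _ = _ := by
          rw [← hVr]
          simp only [mul_assoc]
  intro t ht
  have h1 : Ψ (t * P) * Ψ Q = t * V := by
    rw [← map_mul, mul_assoc, hPQ, mul_one, hl t ht]
  have h2 : (star V * Q * V) * (star V * P * V) = 1 := by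
    calc (star V * Q * V) * (star V * P * V)
        = star V * (Q * ((V * star V) * P)) * V := by simp only [mul_assoc]
      _ = 1 := by rw [hVr, one_mul, hQP, mul_one, hVl]
  calc Ψ (t * P) = Ψ (t * P) * ((star V * Q * V) * (star V * P * V)) := by rw [h2, mul_one]
    _ = t * ((V * star V) * P) * V := by
        rw [← mul_assoc, ← hΨQ, h1]
        simp only [mul_assoc]
    _ = _ := by rw [hVr, one_mul]

end Invertible

section Frame

variable {G A : Type*} [Group G] [TopologicalSpace G] [IsTopologicalGroup G] [CompactSpace G]
  [T2Space G] [MeasurableSpace G] [BorelSpace G] [CStarAlgebra A] {α : CStarDynamics G A}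

/-- The operator `F ↦ ∫ c(h) F(h) dh` on `C(G, A)`. -/
def weightedIntegral (c : C(G, ℂ)) : C(G, A) →L[ℂ] A :=
  LinearMap.mkContinuous
    { toFun := fun F => ∫ h, c h • F h ∂haarP G
      map_add' := fun F F' => by
        simp only [ContinuousMap.add_apply, smul_add]
        exact integral_add (integrable_of_continuous (by fun_prop))
          (integrable_of_continuous (by fun_prop))
      map_smul' := fun a F => by
        simp only [ContinuousMap.smul_apply, smul_comm _ a]
        exact integral_smul a _ } ‖c‖ (fun F => by
    refine norm_integral_haarP_le fun h => ?_
    rw [norm_smul]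
    exact mul_le_mul (c.norm_coe_le_norm h) (F.norm_coe_le_norm h) (norm_nonneg _) (norm_nonneg _))

theorem weightedIntegral_apply (c : C(G, ℂ)) (F : C(G, A)) :
    weightedIntegral c F = ∫ h, c h • F h ∂haarP G := rfl

/-- The orbit map `h ↦ α_h(y)`. -/
def CStarDynamics.orbit (α : CStarDynamics G A) (y : A) : C(G, A) :=
  ⟨fun h => α.act h y, α.continuous_act.comp (continuous_id.prodMk continuous_const)⟩

theorem CStarDynamics.act_weightedIntegral (α : CStarDynamics G A) (c : C(G, ℂ)) (y : A) (k : G) :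
    α.act k (weightedIntegral c (α.orbit y)) = ∫ h, c (k⁻¹ * h) • α.act h y ∂haarP G := by
  let a : A →L[ℂ] A :=
    { toFun := α.act k
      map_add' := map_add _
      map_smul' := map_smul _
      cont := α.continuous_act.comp (continuous_const.prodMk continuous_id) }
  have h1 : α.act k (weightedIntegral c (α.orbit y)) = ∫ h, α.act k (c h • α.act h y) ∂haarP G :=
    (a.integral_comp_comm (integrable_of_continuous
      (c.continuous.smul (α.orbit y).continuous))).symm
  rw [h1, ← integral_mul_left_eq_self (fun h => α.act k (c h • α.act h y)) k⁻¹]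
  refine integral_congr_ae (Filter.Eventually.of_forall fun h => ?_)
  simp only
  rw [map_smul, ← α.act_mul_apply, mul_inv_cancel_left]

variable {d : ℕ}

/-- The equivariant rows of a representation `R` by unitary matrices, see `exists_frame`. -/
theorem exists_equivariant_row (α : CStarDynamics G A) (R : Fin d → Fin d → C(G, ℂ))
    (hmul : ∀ i j g h, R i j (g * h) = ∑ l, R i l g * R l j h) (y : A) (i j : Fin d) (k : G) :
    α.act k (weightedIntegral ((R i j).comp ⟨fun h => h⁻¹, continuous_inv⟩) (α.orbit y)) =
      ∑ l, R l j k • weightedIntegral ((R i l).comp ⟨fun h => h⁻¹, continuous_inv⟩) (α.orbit y) := by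
  have hint (l : Fin d) : Integrable (fun h => R l j k • R i l h⁻¹ • α.act h y) (haarP G) :=
    integrable_of_continuous (by
      have := (α.orbit y).continuous
      exact (((R i l).continuous.comp continuous_inv).smul this).const_smul _)
  rw [α.act_weightedIntegral]
  simp only [weightedIntegral_apply, ← integral_smul]
  refine Eq.trans ?_ (integral_finsetSum _ fun l _ => hint l)
  refine integral_congr_ae (Filter.Eventually.of_forall fun h => ?_)
  change R i j (k⁻¹ * h)⁻¹ • α.act h y = _
  rw [mul_inv_rev, inv_inv, hmul, Finset.sum_smul]
  exact Finset.sum_congr rfl fun l _ => by rw [mul_comm, ← smul_smul]; rfl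

/-- In a free C*-dynamical system every finite-dimensional unitary representation `R` of the group
admits a finite Parseval frame of equivariant rows. -/
theorem exists_frame_of_order [PartialOrder A] [StarOrderedRing A] (hα : α.IsFree)
    (R : Fin d → Fin d → C(G, ℂ))
    (hmul : ∀ i j g h, R i j (g * h) = ∑ l, R i l g * R l j h)
    (hone : ∀ i j, R i j 1 = if i = j then 1 else 0)
    (hinv : ∀ i j g, R i j g⁻¹ = (starRingEnd ℂ) (R j i g)) :
    ∃ (m : ℕ) (y : Fin m → Fin d → A),
      (∀ i j, ∑ r, star (y r i) * y r j = if i = j then 1 else 0) ∧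
      ∀ h r j, α.act h (y r j) = ∑ l, R l j h • y r l := by
  let Ψ (h : G) : CStarMatrix (Fin d) (Fin d) A →⋆ₙₐ[ℂ] CStarMatrix (Fin d) (Fin d) A :=
    CStarMatrix.mapₙₐ ((α.act h : A →⋆ₐ[ℂ] A) : A →⋆ₙₐ[ℂ] A)
  have hΨ (h : G) (t : CStarMatrix (Fin d) (Fin d) A) (i j) : Ψ h t i j = α.act h (t i j) := rfl
  let Rm (h : G) : CStarMatrix (Fin d) (Fin d) A := CStarMatrix.ofMatrix fun i j => R i j h • 1
  have hRm (h : G) (i j) : Rm h i j = R i j h • 1 := rfl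
  have hmulRm (t : CStarMatrix (Fin d) (Fin d) A) (h : G) (i j) :
      (t * Rm h) i j = ∑ l, R l j h • t i l := by
    rw [CStarMatrix.mul_apply]
    refine Finset.sum_congr rfl fun l _ => ?_
    rw [hRm, mul_smul_comm, mul_one]
  have hstar (h : G) : star (Rm h) = Rm h⁻¹ := by
    ext i j
    rw [CStarMatrix.star_apply, hRm, hRm, hinv, star_smul, star_one]
    rfl
  have hRmul (g h : G) : Rm g * Rm h = Rm (g * h) := by
    ext i j
    rw [hmulRm, hRm, hmul, Finset.sum_smul]
    exact Finset.sum_congr rfl fun l _ => by rw [hRm, smul_smul, mul_comm]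
  have hRone : Rm 1 = 1 := by
    ext i j
    rw [hRm, hone, CStarMatrix.one_apply]
    split_ifs <;> simp
  have hRl (h : G) : star (Rm h) * Rm h = 1 := by rw [hstar, hRmul, inv_mul_cancel, hRone]
  have hRr (h : G) : Rm h * star (Rm h) = 1 := by rw [hstar, hRmul, mul_inv_cancel, hRone]
  -- the matrices with equivariant rows, and the left ideal generated by them
  let 𝒯 : Set (CStarMatrix (Fin d) (Fin d) A) := {t | ∀ h, Ψ h t = t * Rm h}
  let 𝒵 := AddSubmonoid.closure {w : CStarMatrix (Fin d) (Fin d) A | ∃ x, ∃ t ∈ 𝒯, w = x * t}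
  let c (i j : Fin d) : C(G, ℂ) := (R i j).comp ⟨fun h => h⁻¹, continuous_inv⟩
  -- the matrix whose only nonzero row is the row `p` with entries `∫ F(h) R(h⁻¹)_{ij} dh`
  let Ξ (p i : Fin d) (F : C(G, A)) : CStarMatrix (Fin d) (Fin d) A :=
    CStarMatrix.ofMatrix fun p' j => if p' = p then weightedIntegral (c i j) F else 0
  have hΞc (p i : Fin d) : Continuous (Ξ p i) := by
    refine continuous_pi fun p' => continuous_pi fun j => ?_
    change Continuous fun F => if p' = p then weightedIntegral (c i j) F else 0
    split_ifs
    · exact (weightedIntegral (c i j)).continuous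
    · exact continuous_const
  have hΞ𝒯 (p i : Fin d) (y : A) : Ξ p i (α.orbit y) ∈ 𝒯 := by
    intro h
    ext p' j
    rw [hmulRm, hΨ]
    change α.act h (if p' = p then _ else 0) = ∑ l, R l j h • (if p' = p then _ else 0)
    split_ifs with hp
    · exact exists_equivariant_row α R hmul y i j h
    · simp
  have hΞ𝒵 (p i : Fin d) (F : C(G, A)) : Ξ p i F ∈ 𝒵.topologicalClosure := by
    refine hα.induction_on (p := fun F => Ξ p i F ∈ 𝒵.topologicalClosure) F
      (𝒵.isClosed_topologicalClosure.preimage (hΞc p i)) fun z => ?_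
    refine 𝒵.le_topologicalClosure ?_
    induction z using TensorProduct.induction_on with
    | zero =>
      have : Ξ p i (α.ellwood 0) = 0 := by
        ext p' j
        change (if p' = p then weightedIntegral (c i j) (α.ellwood 0) else 0) = 0
        simp
      rw [this]
      exact 𝒵.zero_mem
    | add z z' hz hz' =>
      have : Ξ p i (α.ellwood (z + z')) = Ξ p i (α.ellwood z) + Ξ p i (α.ellwood z') := by
        ext p' j
        change (if p' = p then weightedIntegral (c i j) (α.ellwood (z + z')) else 0) =
          (if p' = p then weightedIntegral (c i j) (α.ellwood z) else 0) +
          (if p' = p then weightedIntegral (c i j) (α.ellwood z') else 0)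
        split_ifs <;> simp
      rw [this]
      exact 𝒵.add_mem hz hz'
    | tmul x y =>
      refine AddSubmonoid.subset_closure
        ⟨CStarMatrix.ofMatrix fun p' q => if p' = p ∧ q = p then x else 0,
          Ξ p i (α.orbit y), hΞ𝒯 p i y, ?_⟩
      have hx (j : Fin d) : weightedIntegral (c i j) (α.ellwood (x ⊗ₜ y)) =
          x * weightedIntegral (c i j) (α.orbit y) := by
        rw [weightedIntegral_apply, weightedIntegral_apply]
        refine Eq.trans ?_ ((ContinuousLinearMap.mul ℂ A x).integral_comp_comm
          (integrable_of_continuous ((c i j).continuous.smul (α.orbit y).continuous)))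
        refine integral_congr_ae (Filter.Eventually.of_forall fun h => ?_)
        change c i j h • (x * α.act h y) = x * (c i j h • α.act h y)
        rw [mul_smul_comm]
      ext p' j
      rw [CStarMatrix.mul_apply, Finset.sum_eq_single p]
      · change (if p' = p then weightedIntegral (c i j) (α.ellwood (x ⊗ₜ y)) else 0) =
          (if p' = p ∧ p = p then x else 0) *
            (if p = p then weightedIntegral (c i j) (α.orbit y) else 0)
        by_cases hp : p' = p
        · simp [hp, hx]
        · simp [hp]
      · intro q _ hq
        change (if p' = p ∧ q = p then x else 0) * _ = 0
        simp [hq]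
      · simp
  have hone𝒵 : (1 : CStarMatrix (Fin d) (Fin d) A) ∈ 𝒵.topologicalClosure := by
    -- `1 = ∫ R(h) R(h⁻¹) dh`, row by row
    have h1 : (1 : CStarMatrix (Fin d) (Fin d) A) =
        ∑ p, ∑ i, Ξ p i ⟨fun h => R p i h • (1 : A), by fun_prop⟩ := by
      ext p' j
      have hsum (F : Fin d → Fin d → CStarMatrix (Fin d) (Fin d) A) :
          (∑ p, ∑ i, F p i) p' j = ∑ p, ∑ i, F p i p' j := by
        have (s : Finset (Fin d)) (F : Fin d → CStarMatrix (Fin d) (Fin d) A) :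
            (∑ p ∈ s, F p) p' j = ∑ p ∈ s, F p p' j := by
          induction s using Finset.induction_on with
          | empty => rfl
          | insert a s ha ih => rw [Finset.sum_insert ha, Finset.sum_insert ha, ← ih]; rfl
        rw [this]
        exact Finset.sum_congr rfl fun p _ => this _ _
      rw [hsum, Finset.sum_eq_single p']
      · have h2 (i : Fin d) : Ξ p' i ⟨fun h => R p' i h • (1 : A), by fun_prop⟩ p' j =
            (∫ h, R p' i h * R i j h⁻¹ ∂haarP G) • (1 : A) := by
          change (if p' = p' then weightedIntegral (c i j) _ else 0) = _
          rw [if_pos rfl, weightedIntegral_apply, ← integral_smul_const]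
          refine integral_congr_ae (Filter.Eventually.of_forall fun h => ?_)
          change R i j h⁻¹ • R p' i h • (1 : A) = _
          rw [smul_smul, mul_comm]
        have h3 : ∑ i, ∫ h, R p' i h * R i j h⁻¹ ∂haarP G = if p' = j then 1 else 0 := by
          rw [← integral_finsetSum _ fun i _ => integrable_of_continuous (by fun_prop)]
          simp only [← hmul, mul_inv_cancel, hone]
          simp
        simp only [h2]
        rw [← Finset.sum_smul, h3, CStarMatrix.one_apply]
        split_ifs <;> simp
      · intro p _ hp
        refine Finset.sum_eq_zero fun i _ => ?_
        change (if p' = p then weightedIntegral (c i j) _ else 0) = 0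
        rw [if_neg hp.symm]
      · simp
    rw [h1]
    exact sum_mem fun p _ => sum_mem fun i _ => hΞ𝒵 p i _
  obtain ⟨l, hl, hu⟩ := exists_isUnit_sum hone𝒵
  obtain ⟨P, hPsa, hPS, hP⟩ := exists_normalizer hu
  have hyeq (t) (ht : t ∈ l) (h : G) : Ψ h (t * P) = t * P * Rm h :=
    hP (Ψ h) (Rm h) (hRl h) (hRr h) (fun t ht => hl t ht h) t ht
  let e : Fin (l.length * d) ≃ Fin l.length × Fin d := finProdFinEquiv.symm
  let Y (q : Fin l.length × Fin d) (j : Fin d) : A := (l.get q.1 * P) q.2 j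
  refine ⟨l.length * d, fun r => Y (e r), fun i j => ?_, fun h r j => ?_⟩
  · have h1 : ∑ n, star (l.get n * P) * (l.get n * P) = 1 := by
      have h2 : ∑ n, star (l.get n) * l.get n = (l.map fun t => star t * t).sum := by
        rw [← List.sum_ofFn]
        congr 1
        exact List.ext_get (by simp) (by simp)
      calc ∑ n, star (l.get n * P) * (l.get n * P)
          = P * (∑ n, star (l.get n) * l.get n) * P := by
            rw [Finset.mul_sum, Finset.sum_mul]
            refine Finset.sum_congr rfl fun n _ => ?_
            rw [star_mul, hPsa]
            simp only [mul_assoc]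
        _ = 1 := by rw [h2, hPS]
    have h3 : (∑ n, star (l.get n * P) * (l.get n * P)) i j =
        (1 : CStarMatrix (Fin d) (Fin d) A) i j :=
      congrArg (fun Z : CStarMatrix (Fin d) (Fin d) A => Z i j) h1
    rw [CStarMatrix.one_apply] at h3
    rw [← h3]
    have hsum (s : Finset (Fin l.length)) (F : Fin l.length → CStarMatrix (Fin d) (Fin d) A) :
        (∑ p ∈ s, F p) i j = ∑ p ∈ s, F p i j := by
      induction s using Finset.induction_on with
      | empty => rfl
      | insert a s ha ih => rw [Finset.sum_insert ha, Finset.sum_insert ha, ← ih]; rfl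
    rw [hsum, e.sum_comp fun q => star (Y q i) * Y q j, Fintype.sum_prod_type]
    refine Finset.sum_congr rfl fun n _ => ?_
    rw [CStarMatrix.mul_apply]
    rfl
  · have h1 := hyeq _ (l.get_mem (e r).1) h
    have h2 : Ψ h (l.get (e r).1 * P) (e r).2 j = (l.get (e r).1 * P * Rm h) (e r).2 j :=
      congrArg (fun Z : CStarMatrix (Fin d) (Fin d) A => Z (e r).2 j) h1
    rwa [hmulRm, hΨ] at h2

/-- `exists_frame_of_order` for the spectral order of the algebra. -/
theorem exists_frame (hα : α.IsFree) (R : Fin d → Fin d → C(G, ℂ))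
    (hmul : ∀ i j g h, R i j (g * h) = ∑ l, R i l g * R l j h)
    (hone : ∀ i j, R i j 1 = if i = j then 1 else 0)
    (hinv : ∀ i j g, R i j g⁻¹ = (starRingEnd ℂ) (R j i g)) :
    ∃ (m : ℕ) (y : Fin m → Fin d → A),
      (∀ i j, ∑ r, star (y r i) * y r j = if i = j then 1 else 0) ∧
      ∀ h r j, α.act h (y r j) = ∑ l, R l j h • y r l :=
  letI := CStarAlgebra.spectralOrder A
  letI := CStarAlgebra.spectralOrderedRing A
  exists_frame_of_order hα R hmul hone hinv

end Frame

/-! ### Compact operators between Hilbert spaces -/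

/-- A compact operator into a Hilbert space is a norm limit of operators of finite rank: compress it
to the span of a finite net in the image of the unit ball. -/
theorem IsCompactOperator.mem_finiteRankClosure {K K₂ : Type*} [NormedAddCommGroup K]
    [InnerProductSpace ℂ K] [CompleteSpace K] [NormedAddCommGroup K₂] [InnerProductSpace ℂ K₂]
    [CompleteSpace K₂] {F : K →L[ℂ] K₂} (hF : IsCompactOperator F) :
    F ∈ HTensor.finiteRankClosure K K₂ := by
  refine Metric.mem_closure_iff.2 fun ε hε => ?_
  obtain ⟨t, ht, hsub⟩ := Metric.totallyBounded_iff.1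
    ((hF.isCompact_closure_image_closedBall (1 : ℝ)).totallyBounded.subset subset_closure) (ε / 2)
    (half_pos hε)
  let N : Submodule ℂ K₂ := Submodule.span ℂ t
  have : FiniteDimensional ℂ N := FiniteDimensional.span_of_finite ℂ ht
  let b := stdOrthonormalBasis ℂ N
  have hP : N.starProjection ∘L F = ∑ i, InnerProductSpace.rankOne ℂ (b i : K₂)
      (F.adjoint (b i : K₂)) := by
    ext x
    rw [sum_apply]
    change N.starProjection (F x) = _
    rw [Submodule.starProjection_apply, ← b.sum_repr (N.orthogonalProjectionOnto (F x)),
      Submodule.coe_sum]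
    refine Finset.sum_congr rfl fun i _ => ?_
    rw [b.repr_apply_apply, InnerProductSpace.rankOne_apply, ContinuousLinearMap.adjoint_inner_left,
      Submodule.inner_orthogonalProjectionOnto_eq_of_mem_left]
    rfl
  refine ⟨N.starProjection ∘L F, ?_, ?_⟩
  · rw [hP]
    exact sum_mem fun i _ => Submodule.subset_span ⟨_, _, rfl⟩
  · rw [dist_eq_norm]
    refine lt_of_le_of_lt (ContinuousLinearMap.opNorm_le_of_unit_norm (half_pos hε).le
      fun x hx => ?_) (half_lt_self hε)
    obtain ⟨y, hy, hyx⟩ := Set.mem_iUnion₂.1 (hsub ⟨x, by simp [hx], rfl⟩)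
    rw [Metric.mem_ball, dist_eq_norm] at hyx
    refine le_trans ?_ hyx.le
    change ‖F x - N.starProjection (F x)‖ ≤ _
    rw [Submodule.starProjection_minimal]
    exact ciInf_le ⟨0, by rintro _ ⟨z, rfl⟩; exact norm_nonneg _⟩
      (⟨y, Submodule.subset_span hy⟩ : N)

section Blocks

variable {G : Type*} [Group G] [TopologicalSpace G] [IsTopologicalGroup G] [CompactSpace G]
  [T2Space G] [MeasurableSpace G] [BorelSpace G]

/-! ### Isometries defined on an orthogonal family of subspaces -/

theorem dense_sSup {K : Type*} [NormedAddCommGroup K] [InnerProductSpace ℂ K] [CompleteSpace K]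
    {𝒲 : Set (Submodule ℂ K)} (h𝒲 : (sSup 𝒲)ᗮ = ⊥) : Dense ((sSup 𝒲 : Submodule ℂ K) : Set K) :=
  (Submodule.dense_iff_topologicalClosure_eq_top).2
    (Submodule.topologicalClosure_eq_top_iff.2 h𝒲)

theorem clm_ext_of_sSup {K Y : Type*} [NormedAddCommGroup K] [InnerProductSpace ℂ K]
    [CompleteSpace K] [NormedAddCommGroup Y] [NormedSpace ℂ Y]
    {𝒲 : Set (Submodule ℂ K)} (h𝒲 : (sSup 𝒲)ᗮ = ⊥) {S T : K →L[ℂ] Y}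
    (h : ∀ W ∈ 𝒲, ∀ f ∈ W, S f = T f) : S = T := by
  have hle : sSup 𝒲 ≤ LinearMap.eqLocus (S : K →ₗ[ℂ] Y) (T : K →ₗ[ℂ] Y) :=
    sSup_le fun W hW f hf => h W hW f hf
  exact ContinuousLinearMap.ext fun f => (dense_sSup h𝒲).induction
    (fun f hf => hle hf) (isClosed_eq S.continuous T.continuous) f

/-- Operators `c_W f : E → X` for `f` in an orthogonal family of subspaces `W` with
`(c_W f)† (c_W' f') = ⟪f, f'⟫` extend to the closed span of the subspaces. -/
theorem exists_clm_of_family {K E X : Type*} [NormedAddCommGroup K] [InnerProductSpace ℂ K]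
    [CompleteSpace K] [NormedAddCommGroup E] [InnerProductSpace ℂ E]
    [NormedAddCommGroup X] [InnerProductSpace ℂ X] [CompleteSpace X]
    {𝒲 : Set (Submodule ℂ K)} (h𝒲 : (sSup 𝒲)ᗮ = ⊥) (c : 𝒲 → K →ₗ[ℂ] E →L[ℂ] X)
    (hc : ∀ W W' : 𝒲, ∀ f ∈ W.1, ∀ f' ∈ W'.1, ∀ e e',
      ⟪c W f e, c W' f' e'⟫_ℂ = ⟪e, e'⟫_ℂ * ⟪f, f'⟫_ℂ) :
    ∃ C : K →L[ℂ] E →L[ℂ] X, (∀ W : 𝒲, ∀ f ∈ W.1, C f = c W f) ∧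
      ∀ e e' f f', ⟪C f e, C f' e'⟫_ℂ = ⟪e, e'⟫_ℂ * ⟪f, f'⟫_ℂ := by
  classical
  obtain ⟨c₀, hc₀⟩ : ∃ c₀ : DirectSum 𝒲 (fun W => W.1) →ₗ[ℂ] E →L[ℂ] X,
      ∀ (W : 𝒲) (f : W.1), c₀ (DirectSum.lof ℂ 𝒲 (fun W => W.1) W f) = c W f :=
    ⟨DirectSum.toModule ℂ 𝒲 _ fun W => c W ∘ₗ W.1.subtype, fun W f =>
      DirectSum.toModule_lof (φ := fun W : 𝒲 => c W ∘ₗ W.1.subtype) ℂ W f⟩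
  obtain ⟨j, hj⟩ : ∃ j : DirectSum 𝒲 (fun W => W.1) →ₗ[ℂ] K,
      ∀ (W : 𝒲) (f : W.1), j (DirectSum.lof ℂ 𝒲 (fun W => W.1) W f) = f :=
    ⟨DirectSum.toModule ℂ 𝒲 _ fun W => W.1.subtype, fun W f =>
      DirectSum.toModule_lof (φ := fun W : 𝒲 => W.1.subtype) ℂ W f⟩
  have key (x x') (e e' : E) : ⟪c₀ x e, c₀ x' e'⟫_ℂ = ⟪e, e'⟫_ℂ * ⟪j x, j x'⟫_ℂ := by
    induction x using DirectSum.induction_on with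
    | zero => simp
    | add x y hx hy => simp only [map_add, add_apply, inner_add_left, mul_add, hx, hy]
    | of W f =>
      induction x' using DirectSum.induction_on with
      | zero => simp
      | add x y hx hy => simp only [map_add, add_apply, inner_add_right, mul_add, hx, hy]
      | of W' f' =>
        rw [← DirectSum.lof_eq_of ℂ, ← DirectSum.lof_eq_of ℂ, hc₀, hc₀, hj, hj]
        exact hc W W' f f.2 f' f'.2 e e'
  have hdense : DenseRange j := by
    have hle : sSup 𝒲 ≤ LinearMap.range j :=
      sSup_le fun W hW f hf => ⟨_, hj ⟨W, hW⟩ ⟨f, hf⟩⟩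
    exact (dense_sSup h𝒲).mono hle
  have hnorm (x) : ‖c₀ x‖ ≤ 1 * ‖j x‖ := by
    refine ContinuousLinearMap.opNorm_le_bound _ (by positivity) fun e => ?_
    have h1 : ‖c₀ x e‖ ^ 2 = (‖j x‖ * ‖e‖) ^ 2 := by
      have h2 := key x x e e
      rw [inner_self_eq_norm_sq_to_K, inner_self_eq_norm_sq_to_K, inner_self_eq_norm_sq_to_K] at h2
      rw [mul_pow, mul_comm]
      exact Complex.ofReal_injective (by push_cast; exact h2)
    rw [one_mul]
    exact ((pow_left_inj₀ (norm_nonneg _) (by positivity) two_ne_zero).1 h1).le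
  have hext (x) : c₀.extendOfNorm j (j x) = c₀ x :=
    LinearMap.extendOfNorm_eq hdense ⟨1, hnorm⟩ x
  refine ⟨c₀.extendOfNorm j, fun W f hf => ?_, fun e e' f f' => ?_⟩
  · rw [← hc₀ W ⟨f, hf⟩, ← hext, hj]
  · refine hdense.induction_on₂ (p := fun f f' => ⟪c₀.extendOfNorm j f e,
      c₀.extendOfNorm j f' e'⟫_ℂ = ⟪e, e'⟫_ℂ * ⟪f, f'⟫_ℂ) ?_ (fun x x' => ?_) f f'
    · exact isClosed_eq (by fun_prop) (by fun_prop)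
    · rw [hext, hext, key]

/-! ### The columns of the isometry on one block -/

section BlockColumn

variable {A : Type*} [CStarAlgebra A] {W : Submodule ℂ (LTwo G ℂ)} {d m : ℕ}
  (b : OrthonormalBasis (Fin d) ℂ W) (y : Fin m → Fin d → A)

/-- The coefficient of the column of `f` at the copy `r` of the basis vector `i`. -/
def blockCoef (r : Fin m) (i : Fin d) : LTwo G ℂ →ₗ[ℂ] A :=
  ∑ j, ((innerSL ℂ (ctsL (star ((leftRepr G ℂ).coeff b i j))) : LTwo G ℂ →L[ℂ] ℂ) :
    LTwo G ℂ →ₗ[ℂ] ℂ).smulRight (y r j)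

theorem blockCoef_apply (r : Fin m) (i : Fin d) (f : LTwo G ℂ) :
    blockCoef b y r i f = ∑ j, ⟪ctsL (star ((leftRepr G ℂ).coeff b i j)), f⟫_ℂ • y r j := by
  rw [blockCoef, LinearMap.sum_apply]
  rfl

/-- The columns of a block are isometric: this combines the Parseval identity of the rows `y` with
that of the matrix coefficients. -/
theorem sum_star_blockCoef_mul (hW : IsBlock W)
    (hy : ∀ i j, ∑ r, star (y r i) * y r j = if i = j then 1 else 0) {f f' : LTwo G ℂ}
    (hf' : f' ∈ W) :
    ∑ r, ∑ i, star (blockCoef b y r i f) * blockCoef b y r i f' = ⟪f, f'⟫_ℂ • (1 : A) := by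
  set t := fun i j => ctsL (star ((leftRepr G ℂ).coeff b i j)) with ht
  calc ∑ r, ∑ i, star (blockCoef b y r i f) * blockCoef b y r i f'
      = ∑ i, ∑ j, ∑ j', (⟪f, t i j⟫_ℂ * ⟪t i j', f'⟫_ℂ) • ∑ r, star (y r j) * y r j' := by
        rw [Finset.sum_comm]
        refine Finset.sum_congr rfl fun i _ => ?_
        simp only [blockCoef_apply, star_sum, star_smul, Finset.sum_mul_sum, Finset.smul_sum]
        rw [Finset.sum_comm]
        refine Finset.sum_congr rfl fun j _ => ?_
        rw [Finset.sum_comm]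
        refine Finset.sum_congr rfl fun j' _ => Finset.sum_congr rfl fun r _ => ?_
        rw [smul_mul_smul_comm]
        congr 2
        exact inner_conj_symm _ _
    _ = ∑ i, ∑ j, (⟪f, t i j⟫_ℂ * ⟪t i j, f'⟫_ℂ) • (1 : A) := by
        simp [hy]
    _ = ⟪f, ∑ i, ∑ j, ⟪t i j, f'⟫_ℂ • t i j⟫_ℂ • (1 : A) := by
        simp only [inner_sum, inner_smul_right, Finset.sum_smul]
        simp only [mul_comm]
    _ = _ := by rw [ht, hW.frame b hf']

/-- Right translation acts on the second index of the coefficients, by the conjugate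
representation. -/
theorem inner_star_coeff_rightTranslate (hW : IsBlock W) (g : G) (i l : Fin d) (f : LTwo G ℂ) :
    ⟪ctsL (star ((leftRepr G ℂ).coeff b i l)), rightTranslate g f⟫_ℂ =
      ∑ j, star ((leftRepr G ℂ).coeff b l j g) *
        ⟪ctsL (star ((leftRepr G ℂ).coeff b i j)), f⟫_ℂ := by
  have h1 := (rightRepr G).inner_op_left g⁻¹ (ctsL (star ((leftRepr G ℂ).coeff b i l))) f
  rw [inv_inv, rightRepr_op, rightRepr_op, rightTranslate_ctsL] at h1
  have h2 : (star ((leftRepr G ℂ).coeff b i l)).comp ⟨fun h => h * g⁻¹, by fun_prop⟩ =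
      ∑ j, (leftRepr G ℂ).coeff b l j g • star ((leftRepr G ℂ).coeff b i j) := by
    ext h
    rw [ContinuousMap.sum_apply]
    change star ((leftRepr G ℂ).coeff b i l (h * g⁻¹)) = _
    rw [(leftRepr G ℂ).coeff_mul b hW.left, star_sum]
    refine Finset.sum_congr rfl fun j _ => ?_
    rw [UnitaryRepr.coeff_inv, star_mul', starRingEnd_apply, star_star, mul_comm]
    rfl
  rw [← h1, h2, map_sum, sum_inner]
  refine Finset.sum_congr rfl fun j _ => ?_
  rw [map_smul, inner_smul_left]
  rfl

/-- Left translation acts on the first index of the coefficients. -/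
theorem inner_star_coeff_leftTranslate (hW : IsBlock W) (g : G) (j l : Fin d) (f : LTwo G ℂ) :
    ⟪ctsL (star ((leftRepr G ℂ).coeff b l j)), leftTranslate g f⟫_ℂ =
      ∑ i, (leftRepr G ℂ).coeff b l i g * ⟪ctsL (star ((leftRepr G ℂ).coeff b i j)), f⟫_ℂ := by
  have h1 := (leftRepr G ℂ).inner_op_left g⁻¹ (ctsL (star ((leftRepr G ℂ).coeff b l j))) f
  rw [inv_inv, leftRepr_op, leftRepr_op, leftTranslate_ctsL] at h1
  have h2 : (star ((leftRepr G ℂ).coeff b l j)).comp ⟨fun h => g⁻¹⁻¹ * h, by fun_prop⟩ =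
      ∑ i, star ((leftRepr G ℂ).coeff b l i g) • star ((leftRepr G ℂ).coeff b i j) := by
    ext h
    rw [ContinuousMap.sum_apply]
    change star ((leftRepr G ℂ).coeff b l j (g⁻¹⁻¹ * h)) = _
    rw [inv_inv, (leftRepr G ℂ).coeff_mul b hW.left, star_sum]
    exact Finset.sum_congr rfl fun j _ => star_mul' _ _
  rw [← h1, h2, map_sum, sum_inner]
  refine Finset.sum_congr rfl fun i _ => ?_
  rw [map_smul, inner_smul_left, starRingEnd_apply, star_star]

theorem blockCoef_rightTranslate {α : CStarDynamics G A} (hW : IsBlock W)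
    (hy : ∀ h r j, α.act h (y r j) = ∑ l, star ((leftRepr G ℂ).coeff b l j h) • y r l)
    (g : G) (r : Fin m) (i : Fin d) (f : LTwo G ℂ) :
    blockCoef b y r i (rightTranslate g f) = α.act g (blockCoef b y r i f) := by
  simp only [blockCoef_apply, inner_star_coeff_rightTranslate b hW, map_sum, map_smul, hy,
    Finset.sum_smul, Finset.smul_sum, smul_smul]
  rw [Finset.sum_comm]
  simp only [mul_comm]

theorem blockCoef_leftTranslate (hW : IsBlock W) (g : G) (r : Fin m) (l : Fin d) (f : LTwo G ℂ) :
    blockCoef b y r l (leftTranslate g f) =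
      ∑ i, (leftRepr G ℂ).coeff b l i g • blockCoef b y r i f := by
  simp only [blockCoef_apply, inner_star_coeff_leftTranslate b hW, Finset.sum_smul,
    Finset.smul_sum, smul_smul]
  rw [Finset.sum_comm]

variable {E H : Type*} [NormedAddCommGroup E] [InnerProductSpace ℂ E] [CompleteSpace E]
  [NormedAddCommGroup H] [InnerProductSpace ℂ H]

/-- The column `∑ π(a_{ri}(f)) ⊗ w_{ri}` of `f`, with the coefficients `a_{ri}(f)` given by
`blockCoef`. -/
def blockCol (π : A →⋆ₐ[ℂ] (E →L[ℂ] E)) (w : Fin m → Fin d → H) :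
    LTwo G ℂ →ₗ[ℂ] E →L[ℂ] HTensor E H where
  toFun f := ∑ r, ∑ i, HTensor.ket (w r i) ∘L π (blockCoef b y r i f)
  map_add' f f' := by
    simp only [map_add, ContinuousLinearMap.comp_add, Finset.sum_add_distrib]
  map_smul' c f := by
    simp only [map_smul, ContinuousLinearMap.comp_smul, Finset.smul_sum, RingHom.id_apply]

variable (π : A →⋆ₐ[ℂ] (E →L[ℂ] E)) (w : Fin m → Fin d → H)

theorem blockCol_apply (f : LTwo G ℂ) (η : E) :
    blockCol b y π w f η = ∑ r, ∑ i, htmul (π (blockCoef b y r i f) η) (w r i) := by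
  change (∑ r, ∑ i, HTensor.ket (w r i) ∘L π (blockCoef b y r i f)) η = _
  simp only [sum_apply]
  rfl

theorem blockCol_mem_col (f : LTwo G ℂ) : blockCol b y π w f ∈ HTensor.col π H := by
  change (∑ r, ∑ i, HTensor.ket (w r i) ∘L π (blockCoef b y r i f)) ∈ _
  exact sum_mem fun _ _ => sum_mem fun _ _ => HTensor.ket_comp_mem_col _ _

/-- The columns of one block depend isometrically on `f`. -/
theorem inner_blockCol (hW : IsBlock W)
    (hy : ∀ i j, ∑ r, star (y r i) * y r j = if i = j then 1 else 0)
    (hw : ∀ r i r' i', ⟪w r i, w r' i'⟫_ℂ = if r = r' ∧ i = i' then 1 else 0)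
    (f : LTwo G ℂ) {f' : LTwo G ℂ} (hf' : f' ∈ W) (η η' : E) :
    ⟪blockCol b y π w f η, blockCol b y π w f' η'⟫_ℂ = ⟪η, η'⟫_ℂ * ⟪f, f'⟫_ℂ := by
  have h1 (r i r' i') : ⟪htmul (π (blockCoef b y r i f) η) (w r i),
      htmul (π (blockCoef b y r' i' f') η') (w r' i')⟫_ℂ =
      if r = r' then (if i = i' then
        ⟪η, π (star (blockCoef b y r i f) * blockCoef b y r i f') η'⟫_ℂ else 0) else 0 := by
    rw [HTensor.inner_htmul, hw]
    by_cases hr : r = r'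
    · by_cases hi : i = i'
      · subst hr hi
        simp only [and_self, if_true, mul_one]
        rw [map_mul, map_star, ContinuousLinearMap.star_eq_adjoint]
        exact (ContinuousLinearMap.adjoint_inner_right _ _ _).symm
      · simp [hi]
    · simp [hr]
  have h2 := sum_star_blockCoef_mul b y hW hy (f := f) hf'
  rw [blockCol_apply, blockCol_apply]
  simp only [sum_inner, inner_sum, h1]
  simp only [Finset.sum_ite_irrel, Finset.sum_const_zero,
    Finset.sum_ite_eq', Finset.mem_univ, if_true]
  simp only [← inner_sum, ← sum_apply, ← map_sum]
  rw [h2, map_smul, map_one, smul_apply, inner_smul_right, mul_comm]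
  rfl

theorem inner_blockCol_eq_zero {W' : Submodule ℂ (LTwo G ℂ)} {d' m' : ℕ}
    (b' : OrthonormalBasis (Fin d') ℂ W') (y' : Fin m' → Fin d' → A) (w' : Fin m' → Fin d' → H)
    (hw : ∀ r i r' i', ⟪w r i, w' r' i'⟫_ℂ = 0) (f f' : LTwo G ℂ) (η η' : E) :
    ⟪blockCol b y π w f η, blockCol b' y' π w' f' η'⟫_ℂ = 0 := by
  rw [blockCol_apply, blockCol_apply]
  simp only [sum_inner, inner_sum, HTensor.inner_htmul, hw, mul_zero, Finset.sum_const_zero]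

/-- Equivariance of the rows turns right translation into the action on the algebra. -/
theorem map_blockCol {α : CStarDynamics G A} (ρ : α.CovRep E) (hW : IsBlock W)
    (hy : ∀ h r j, α.act h (y r j) = ∑ l, star ((leftRepr G ℂ).coeff b l j h) • y r l)
    (g : G) (f : LTwo G ℂ) (η : E) :
    hmap (ρ.u.op g).toLinearIsometry LinearIsometry.id (blockCol b y ρ.π w f η) =
      blockCol b y ρ.π w (rightTranslate g f) (ρ.u.op g η) := by
  rw [blockCol_apply, blockCol_apply]
  simp only [map_sum, hmap_htmul, blockCoef_rightTranslate b y hW hy, ρ.covariant]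
  rfl

/-- If `G` acts on the vectors `w` as on the block, left translation becomes the action on `H`. -/
theorem map_op_blockCol (hW : IsBlock W) (μ : UnitaryRepr G H)
    (hw : ∀ g r i, μ.op g (w r i) = ∑ l, (leftRepr G ℂ).coeff b l i g • w r l)
    (g : G) (f : LTwo G ℂ) (η : E) :
    hmap LinearIsometry.id (μ.op g).toLinearIsometry (blockCol b y π w f η) =
      blockCol b y π w (leftTranslate g f) η := by
  rw [blockCol_apply, blockCol_apply]
  simp only [map_sum, hmap_htmul, blockCoef_leftTranslate b y hW, map_smul, sum_apply, smul_apply]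
  refine Finset.sum_congr rfl fun r _ => ?_
  have h1 (i : Fin d) : (htmul ((LinearIsometry.id : E →ₗᵢ[ℂ] E) (π (blockCoef b y r i f) η))
      ((μ.op g).toLinearIsometry (w r i)) : HTensor E H) =
      ∑ l, (leftRepr G ℂ).coeff b l i g • htmul (π (blockCoef b y r i f) η) (w r l) := by
    change htmul (π (blockCoef b y r i f) η) (μ.op g (w r i)) = _
    rw [hw, ← HTensor.ket_apply, map_sum, sum_apply]
    exact Finset.sum_congr rfl fun l _ => HTensor.htmul_smul _ _ _
  simp only [h1]
  rw [Finset.sum_comm]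
  refine Finset.sum_congr rfl fun l _ => ?_
  rw [← HTensor.ket_apply, map_sum]
  exact Finset.sum_congr rfl fun i _ => by rw [map_smul]; rfl

end BlockColumn

end Blocks

/-! ### The freeness isometry -/

section CompactsCondition

variable {G A : Type*} [Group G] [TopologicalSpace G] [IsTopologicalGroup G] [CompactSpace G]
  [T2Space G] [MeasurableSpace G] [BorelSpace G] [CStarAlgebra A] {α : CStarDynamics G A}
  {E H : Type*} [NormedAddCommGroup E] [InnerProductSpace ℂ E] [CompleteSpace E]
  [NormedAddCommGroup H] [InnerProductSpace ℂ H] [CompleteSpace H]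

/-- An isometry whose columns are columns over the algebra satisfies the compactness condition. -/
theorem comp_mem_compactsLH (ρ : α.CovRep E) (s : LTwo G E →L[ℂ] HTensor E H)
    (hs : ∀ f : LTwo G ℂ, s ∘L ltmulL f ∈ HTensor.col ρ.π H)
    {T : LTwo G E →L[ℂ] LTwo G E} (hT : T ∈ ρ.compactsL) : s ∘L T ∈ ρ.compactsLH H := by
  let J : HTensor E (LTwo G ℂ) →L[ℂ] LTwo G E :=
    ((tensorIso : HTensor E (LTwo G ℂ) ≃ₗᵢ[ℂ] LTwo G E).toContinuousLinearEquiv :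
      HTensor E (LTwo G ℂ) →L[ℂ] LTwo G E)
  let J' : LTwo G E →L[ℂ] HTensor E (LTwo G ℂ) :=
    ((tensorIso : HTensor E (LTwo G ℂ) ≃ₗᵢ[ℂ] LTwo G E).symm.toContinuousLinearEquiv :
      LTwo G E →L[ℂ] HTensor E (LTwo G ℂ))
  have hJ (η : E) (f : LTwo G ℂ) : J (htmul η f) = ltmul η f := tensorIso_htmul η f
  have hJ' (η : E) (f : LTwo G ℂ) : J' (ltmul η f) = htmul η f := by
    rw [← hJ]
    exact tensorIso.symm_apply_apply _
  have hclosed : IsClosed (ρ.compactsLH H : Set (LTwo G E →L[ℂ] HTensor E H)) :=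
    Submodule.isClosed_topologicalClosure _
  -- the operator `X ∘ (1 ⊗ ⟨g|)` for a column `X`
  have hcol (a : A) (g : LTwo G ℂ) {X : E →L[ℂ] HTensor E H} (hX : X ∈ HTensor.col ρ.π H) :
      X ∘L ρ.π a ∘L HTensor.bra g ∘L J' ∈ ρ.compactsLH H := by
    let Φ : (E →L[ℂ] HTensor E H) →L[ℂ] (LTwo G E →L[ℂ] HTensor E H) :=
      (ContinuousLinearMap.compL ℂ (LTwo G E) E (HTensor E H)).flip
        (ρ.π a ∘L HTensor.bra g ∘L J')
    have hle : HTensor.col ρ.π H ≤ (ρ.compactsLH H).comap (Φ : _ →ₗ[ℂ] _) := by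
      refine Submodule.topologicalClosure_minimal _ (Submodule.span_le.2 ?_)
        (hclosed.preimage Φ.continuous)
      rintro _ ⟨d, k, rfl⟩
      refine Submodule.le_topologicalClosure _ (Submodule.subset_span
        ⟨d * a, InnerProductSpace.rankOne ℂ k g, ?_, fun η f => ?_⟩)
      · exact HTensor.isCompactOperator_of_mem_finiteRankClosure
          (Submodule.le_topologicalClosure _ (Submodule.subset_span ⟨k, g, rfl⟩))
      · change htmul (ρ.π d (ρ.π a (HTensor.bra g (J' (ltmul η f))))) k = _
        rw [hJ', HTensor.bra_htmul, InnerProductSpace.rankOne_apply, map_smul, map_smul,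
          HTensor.smul_htmul, HTensor.htmul_smul, map_mul]
        rfl
    exact hle hX
  have hk (a : A) (k : LTwo G ℂ →L[ℂ] LTwo G ℂ)
      (hk : k ∈ HTensor.finiteRankClosure (LTwo G ℂ) (LTwo G ℂ)) :
      s ∘L J ∘L HTensor.map (ρ.π a) k ∘L J' ∈ ρ.compactsLH H := by
    let Φ : (LTwo G ℂ →L[ℂ] LTwo G ℂ) →L[ℂ] (LTwo G E →L[ℂ] HTensor E H) :=
      (ContinuousLinearMap.compL ℂ (LTwo G E) (HTensor E (LTwo G ℂ)) (HTensor E H) (s ∘L J)) ∘L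
      (ContinuousLinearMap.compL ℂ (LTwo G E) (HTensor E (LTwo G ℂ)) (HTensor E (LTwo G ℂ))).flip J'
        ∘L HTensor.mapRightL (ρ.π a)
    have hle : HTensor.finiteRankClosure (LTwo G ℂ) (LTwo G ℂ) ≤
        (ρ.compactsLH H).comap (Φ : _ →ₗ[ℂ] _) := by
      refine Submodule.topologicalClosure_minimal _ (Submodule.span_le.2 ?_)
        (hclosed.preimage Φ.continuous)
      rintro _ ⟨x, g, rfl⟩
      have h1 := hcol a g (hs x)
      have h2 : Φ (InnerProductSpace.rankOne ℂ x g) =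
          (s ∘L ltmulL x) ∘L ρ.π a ∘L HTensor.bra g ∘L J' := by
        refine LTwo.ext_clm fun η φ => ?_
        change s (J (HTensor.map (ρ.π a) _ (J' _))) = s (ltmul (ρ.π a (HTensor.bra g (J' _))) x)
        rw [hJ', HTensor.map_htmul, hJ, HTensor.bra_htmul, InnerProductSpace.rankOne_apply,
          map_smul, ← ltmulL_apply, ← ltmulL_apply, map_smul, map_smul]
        rfl
      change Φ _ ∈ ρ.compactsLH H
      rw [h2]
      exact h1
    exact hle hk
  let Ψ : (LTwo G E →L[ℂ] LTwo G E) →L[ℂ] (LTwo G E →L[ℂ] HTensor E H) :=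
    ContinuousLinearMap.compL ℂ _ _ _ s
  have hle : ρ.compactsL ≤ (ρ.compactsLH H).comap (Ψ : _ →ₗ[ℂ] _) := by
    refine Submodule.topologicalClosure_minimal _ (Submodule.span_le.2 ?_)
      (hclosed.preimage Ψ.continuous)
    rintro T ⟨a, k, hkc, hT⟩
    have h2 : T = J ∘L HTensor.map (ρ.π a) k ∘L J' := by
      refine LTwo.ext_clm fun η φ => ?_
      rw [hT]
      change _ = J (HTensor.map (ρ.π a) _ (J' _))
      rw [hJ', HTensor.map_htmul, hJ]
    change s ∘L T ∈ ρ.compactsLH H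
    rw [h2]
    exact hk a k hkc.mem_finiteRankClosure
  exact hle hT

end CompactsCondition

section FrameData

variable {G : Type uG} [Group G] [TopologicalSpace G] [IsTopologicalGroup G] [CompactSpace G]
  [T2Space G] [MeasurableSpace G] [BorelSpace G] {A : Type*} [CStarAlgebra A]

/-- An orthonormal basis of a block. -/
def IsBlock.basis {W : Submodule ℂ (LTwo G ℂ)} (hW : IsBlock W) :
    OrthonormalBasis (Fin (Module.finrank ℂ W)) ℂ W :=
  haveI := hW.finiteDimensional
  stdOrthonormalBasis ℂ W

/-- A decomposition of `L²(G)` into blocks, with a Parseval frame of equivariant rows in the algebra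
for each block; the frame of the trivial block is `1`. -/
structure BlockFrames (α : CStarDynamics G A) where
  /-- The blocks. -/
  blocks : Set (Submodule ℂ (LTwo G ℂ))
  isBlock : ∀ W : blocks, IsBlock W.1
  orthogonal : ∀ W W' : blocks, W ≠ W' → W.1 ⟂ W'.1
  orthogonal_sSup : (sSup blocks)ᗮ = ⊥
  one_mem : Submodule.span ℂ {ctsL (1 : C(G, ℂ))} ∈ blocks
  /-- The number of rows. -/
  rows : blocks → ℕ
  /-- The rows. -/
  row : ∀ W, Fin (rows W) → Fin (Module.finrank ℂ W.1) → A
  sum_star_mul : ∀ W i j, ∑ r, star (row W r i) * row W r j = if i = j then 1 else 0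
  act_row : ∀ W h r j,
    α.act h (row W r j) = ∑ l, star ((leftRepr G ℂ).coeff (isBlock W).basis l j h) • row W r l
  rows_one : rows ⟨_, one_mem⟩ = 1
  row_one : ∀ r j, row ⟨_, one_mem⟩ r j = 1

/-- The rows of a block are equivariant for the conjugate of the left regular representation on it. -/
theorem CStarDynamics.IsFree.nonempty_blockFrames {α : CStarDynamics G A} (hα : α.IsFree) :
    Nonempty (BlockFrames α) := by
  classical
  obtain ⟨𝒲, h1, h2, h3, h4⟩ := exists_blocks (G := G)
  have key (W : 𝒲) : ∃ (m : ℕ) (y : Fin m → Fin (Module.finrank ℂ W.1) → A),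
      (∀ i j, ∑ r, star (y r i) * y r j = if i = j then 1 else 0) ∧
      (∀ h r j, α.act h (y r j) =
        ∑ l, star ((leftRepr G ℂ).coeff (h1 W.1 W.2).basis l j h) • y r l) ∧
      (W.1 = Submodule.span ℂ {ctsL (1 : C(G, ℂ))} → m = 1 ∧ ∀ r j, y r j = 1) := by
    by_cases hW : W.1 = Submodule.span ℂ {ctsL (1 : C(G, ℂ))}
    -- on the constants the representation is trivial, and the single row `1` is a frame
    · have hd : Module.finrank ℂ W.1 = 1 := by
        rw [hW]
        refine finrank_span_singleton fun h => ?_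
        have := DFunLike.congr_fun (ctsL_injective (h.trans (map_zero ctsL).symm)) 1
        simp at this
      have huniq : ∀ i j : Fin (Module.finrank ℂ W.1), i = j := fun i j => by
        have := i.2; have := j.2; ext; omega
      have hL (i j) (h : G) : (leftRepr G ℂ).coeff (h1 W.1 W.2).basis i j h = 1 := by
        have h5 : (leftRepr G ℂ).op h ((h1 W.1 W.2).basis j : LTwo G ℂ) = (h1 W.1 W.2).basis j := by
          have hmem : ((h1 W.1 W.2).basis j : LTwo G ℂ) ∈ Submodule.span ℂ {ctsL (1 : C(G, ℂ))} :=
            hW ▸ ((h1 W.1 W.2).basis j).2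
          obtain ⟨c, hc⟩ := Submodule.mem_span_singleton.1 hmem
          rw [← hc, map_smul]
          rfl
        rw [UnitaryRepr.coeff_apply, h5, UnitaryRepr.inner_basis, if_pos (huniq i j)]
      refine ⟨1, fun _ _ => 1, fun i j => ?_, fun h r j => ?_, fun _ => ⟨rfl, fun _ _ => rfl⟩⟩
      · simp [huniq i j]
      · simp [hL, hd]
    · obtain ⟨m, y, hy, hy'⟩ := exists_frame hα
        (fun i j => star ((leftRepr G ℂ).coeff (h1 W.1 W.2).basis i j))
        (fun i j g h => by
          simp only [ContinuousMap.star_apply]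
          rw [(leftRepr G ℂ).coeff_mul _ (h1 W.1 W.2).left, star_sum]
          exact Finset.sum_congr rfl fun l _ => star_mul' _ _)
        (fun i j => by
          simp only [ContinuousMap.star_apply]
          rw [UnitaryRepr.coeff_one]
          split_ifs <;> simp)
        (fun i j g => by
          simp only [ContinuousMap.star_apply]
          rw [UnitaryRepr.coeff_inv]
          rfl)
      exact ⟨m, y, hy, hy', fun h => absurd h hW⟩
  choose m y hy hy' hone using key
  exact ⟨⟨𝒲, fun W => h1 W.1 W.2, fun W W' h => h2 W.2 W'.2 fun h' => h (Subtype.ext h'), h4, h3,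
    m, y, hy, hy', (hone _ rfl).1, (hone _ rfl).2⟩⟩

namespace BlockFrames

variable {α : CStarDynamics G A} (Y : BlockFrames α)

/-- One index for each row of each block. -/
abbrev Index : Type uG := Σ W : Y.blocks, Fin (Y.rows W)

/-- The Hilbert sum of as many copies of each block as its frame has rows. -/
abbrev Space : Type uG := lp (fun q : Y.Index => q.1.1) 2

/-- The left regular representation on the blocks. -/
def blockRepr (q : Y.Index) : UnitaryRepr G q.1.1 :=
  (leftRepr G ℂ).restrict q.1.1 (Y.isBlock q.1).left

open Classical in
/-- The representation of the group on `Y.Space`. -/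
def repr : UnitaryRepr G Y.Space := UnitaryRepr.lpSum Y.blockRepr

theorem hasFiniteMultiplicities : Y.repr.HasFiniteMultiplicities := by
  classical
  intro n σ _
  refine UnitaryRepr.finiteDimensional_multiplicitySpace_lpSum Y.blockRepr σ ?_
    fun q => (Y.isBlock q.1).finiteDimensional_hom σ
  have hfin := finite_blocks_of_repr (fun W hW => Y.isBlock ⟨W, hW⟩)
    (fun W hW W' hW' h => Y.orthogonal ⟨W, hW⟩ ⟨W', hW'⟩ fun h' => h (congrArg Subtype.val h')) σ
  exact hfin.preimage' (f := Sigma.fst) fun W _ => (Set.finite_range (Sigma.mk W)).subset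
    fun q hq => ⟨hq ▸ q.2, by cases hq; rfl⟩

open Classical in
/-- The basis vectors of the block `W` in the copy `r`. -/
def vec (W : Y.blocks) (r : Fin (Y.rows W)) (i : Fin (Module.finrank ℂ W.1)) : Y.Space :=
  lp.single 2 ⟨W, r⟩ ((Y.isBlock W).basis i)

theorem inner_vec (W : Y.blocks) (r i r' i') :
    ⟪Y.vec W r i, Y.vec W r' i'⟫_ℂ = if r = r' ∧ i = i' then 1 else 0 := by
  classical
  rw [vec, vec, lp.inner_single_left]
  by_cases hr : r = r'
  · subst hr
    rw [lp.single_apply_self]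
    simpa using orthonormal_iff_ite.1 (Y.isBlock W).basis.orthonormal i i'
  · rw [lp.single_apply_ne _ _ _ (by simpa using hr), inner_zero_right, if_neg (by simp [hr])]

theorem inner_vec_of_ne {W W' : Y.blocks} (h : W ≠ W') (r i r' i') :
    ⟪Y.vec W r i, Y.vec W' r' i'⟫_ℂ = 0 := by
  classical
  rw [vec, vec, lp.inner_single_left, lp.single_apply_ne _ _ _ (by simp [h]), inner_zero_right]

theorem repr_op_vec (g : G) (W : Y.blocks) (r i) :
    Y.repr.op g (Y.vec W r i) =
      ∑ l, (leftRepr G ℂ).coeff (Y.isBlock W).basis l i g • Y.vec W r l := by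
  classical
  rw [vec, repr, UnitaryRepr.lpSum_op_single]
  have h1 : (Y.blockRepr ⟨W, r⟩).op g ((Y.isBlock W).basis i) =
      ∑ l, (leftRepr G ℂ).coeff (Y.isBlock W).basis l i g • (Y.isBlock W).basis l := by
    refine Subtype.ext ?_
    rw [Submodule.coe_sum]
    exact (leftRepr G ℂ).op_basis (Y.isBlock W).basis (Y.isBlock W).left g i
  rw [h1]
  change lp.lsingle (𝕜 := ℂ) 2 (⟨W, r⟩ : Y.Index) _ = _
  rw [map_sum]
  exact Finset.sum_congr rfl fun l _ => map_smul _ _ _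

instance : CompleteSpace Y.Space :=
  haveI (q : Y.Index) : CompleteSpace q.1.1 :=
    haveI := (Y.isBlock q.1).finiteDimensional
    FiniteDimensional.complete ℂ _
  inferInstance

variable {E : Type*} [NormedAddCommGroup E] [InnerProductSpace ℂ E] [CompleteSpace E]

/-- Two operators agree if they agree on the elementary tensors with entries in the blocks. -/
theorem clm_ext {X : Type*} [NormedAddCommGroup X] [NormedSpace ℂ X] {S T : LTwo G E →L[ℂ] X}
    (h : ∀ W : Y.blocks, ∀ f ∈ W.1, ∀ η, S (ltmul η f) = T (ltmul η f)) : S = T := by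
  refine LTwo.ext_clm fun η φ => ?_
  have h1 : S ∘L (ltmulL (G := G) (E := E)).flip η = T ∘L (ltmulL (G := G) (E := E)).flip η :=
    clm_ext_of_sSup Y.orthogonal_sSup fun W hW f hf => h ⟨W, hW⟩ f hf η
  exact DFunLike.congr_fun h1 (ctsL φ)

/-- The trivial block contributes a single vector. -/
theorem exists_unique_vec :
    ∃ (r : Fin (Y.rows ⟨_, Y.one_mem⟩)) (i : Fin (Module.finrank ℂ
      (Submodule.span ℂ {ctsL (1 : C(G, ℂ))}))), (∀ r', r' = r) ∧ ∀ i', i' = i := by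
  have hd : Module.finrank ℂ (Submodule.span ℂ {ctsL (1 : C(G, ℂ))}) = 1 := by
    refine finrank_span_singleton fun h => ?_
    have := DFunLike.congr_fun (ctsL_injective (h.trans (map_zero ctsL).symm)) 1
    simp at this
  refine ⟨⟨0, by rw [Y.rows_one]; exact one_pos⟩, ⟨0, by rw [hd]; exact one_pos⟩, fun r => ?_,
    fun i => ?_⟩
  · have := r.2
    have := Y.rows_one
    ext
    simp only
    omega
  · have := i.2
    ext
    simp only
    omega

/-- The columns of the blocks combine to a normalized isometry which expresses freeness in the given
covariant representation. -/
theorem exists_freenessIsometry (ρ : α.CovRep E) :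
    ∃ s : LTwo G E →ₗᵢ[ℂ] HTensor E Y.Space, CStarDynamics.IsFreenessIsometry Y.repr ρ s ∧
      CStarDynamics.IsNormalizedIsometry Y.repr s := by
  obtain ⟨C, hC, hCi⟩ := exists_clm_of_family (E := E) (X := HTensor E Y.Space) Y.orthogonal_sSup
    (fun W => blockCol (Y.isBlock W).basis (Y.row W) ρ.π (Y.vec W)) (by
      intro W W' f hf f' hf' η η'
      by_cases h : W = W'
      · subst h
        exact inner_blockCol _ _ _ _ (Y.isBlock W) (Y.sum_star_mul W) (Y.inner_vec W) f hf' η η'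
      · rw [inner_blockCol_eq_zero _ _ _ _ _ _ _ (Y.inner_vec_of_ne h),
          (Y.orthogonal W W' h).inner_eq hf hf', mul_zero])
  obtain ⟨T, hT⟩ := HTensor.exists_isometry (C : LTwo G ℂ →ₗ[ℂ] E →L[ℂ] HTensor E Y.Space) hCi
  let s : LTwo G E →ₗᵢ[ℂ] HTensor E Y.Space := T.comp tensorIso.symm.toLinearIsometry
  have hs (η : E) (f : LTwo G ℂ) : s (ltmul η f) = C f η := by
    refine Eq.trans ?_ (hT η f)
    change T (tensorIso.symm (ltmul η f)) = _
    rw [← tensorIso_htmul, LinearIsometryEquiv.symm_apply_apply]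
  have hsW (W : Y.blocks) {f : LTwo G ℂ} (hf : f ∈ W.1) (η : E) : s (ltmul η f) =
      blockCol (Y.isBlock W).basis (Y.row W) ρ.π (Y.vec W) f η := by rw [hs, hC W f hf]
  have hCcol (f : LTwo G ℂ) : C f ∈ HTensor.col ρ.π Y.Space := by
    have hclosed : IsClosed ((HTensor.col ρ.π Y.Space).comap
        (C : LTwo G ℂ →ₗ[ℂ] E →L[ℂ] HTensor E Y.Space) : Set (LTwo G ℂ)) :=
      (Submodule.isClosed_topologicalClosure _).preimage C.continuous
    have hle : sSup Y.blocks ≤ (HTensor.col ρ.π Y.Space).comap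
        (C : LTwo G ℂ →ₗ[ℂ] E →L[ℂ] HTensor E Y.Space) := by
      refine sSup_le fun W hW f hf => ?_
      change C f ∈ HTensor.col ρ.π Y.Space
      rw [hC ⟨W, hW⟩ f hf]
      exact blockCol_mem_col _ _ _ _ f
    exact (dense_sSup Y.orthogonal_sSup).induction (fun f hf => hle hf) hclosed f
  refine ⟨s, ⟨fun T hT => ?_, fun g v => ?_, fun g v => ?_⟩, ?_⟩
  · refine comp_mem_compactsLH ρ _ (fun f => ?_) hT
    have h1 : s.toContinuousLinearMap ∘L ltmulL f = C f := ContinuousLinearMap.ext fun η => hs η f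
    rw [h1]
    exact hCcol f
  · have h1 : hmap (ρ.u.op g).toLinearIsometry LinearIsometry.id ∘L s.toContinuousLinearMap =
        s.toContinuousLinearMap ∘L (twistedIso (ρ.u.op g) g).toContinuousLinearMap := by
      refine Y.clm_ext fun W f hf η => ?_
      change hmap _ _ (s (ltmul η f)) = s (twistedRightTranslate (ρ.u.op g) g (ltmul η f))
      rw [twistedRightTranslate_ltmul, hsW W hf, hsW W ((Y.isBlock W).right g f hf),
        map_blockCol _ _ _ ρ (Y.isBlock W) (Y.act_row W)]
    exact DFunLike.congr_fun h1 v
  · have h1 : hmap LinearIsometry.id (Y.repr.op g).toLinearIsometry ∘L s.toContinuousLinearMap =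
        s.toContinuousLinearMap ∘L (leftIso g).toContinuousLinearMap := by
      refine Y.clm_ext fun W f hf η => ?_
      change hmap _ _ (s (ltmul η f)) = s (leftTranslate g (ltmul η f))
      rw [leftTranslate_ltmul, hsW W hf, hsW W ((Y.isBlock W).left g f hf),
        map_op_blockCol _ _ _ _ (Y.isBlock W) Y.repr fun g r i => Y.repr_op_vec g W r i]
    exact DFunLike.congr_fun h1 v
  · classical
    let W₀ : Y.blocks := ⟨_, Y.one_mem⟩
    obtain ⟨r, i, hr, hi⟩ := Y.exists_unique_vec
    have hnormone : ⟪ctsL (1 : C(G, ℂ)), ctsL (1 : C(G, ℂ))⟫_ℂ = 1 := by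
      rw [inner_ctsL]
      simp
    have hfixW (f : LTwo G ℂ) (hf : f ∈ W₀.1) (g : G) : leftTranslate g f = f := by
      obtain ⟨c, rfl⟩ := Submodule.mem_span_singleton.1 hf
      exact map_smul (leftIso g) c (ctsL (1 : C(G, ℂ)))
    have hspan (v : W₀.1) : ∃ c : ℂ, c • (Y.isBlock W₀).basis i = v := by
      refine ⟨⟪(Y.isBlock W₀).basis i, v⟫_ℂ, ?_⟩
      have h1 := (Y.isBlock W₀).basis.sum_repr v
      rw [Finset.sum_eq_single i (fun i' _ h => absurd (hi i') h) (by simp)] at h1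
      rw [← OrthonormalBasis.repr_apply_apply]
      exact h1
    refine ⟨Y.vec W₀ r i, ?_, le_antisymm (fun v hv => ?_) ?_, fun η => ?_⟩
    · have h1 := Y.inner_vec W₀ r i r i
      rw [if_pos ⟨rfl, rfl⟩, inner_self_eq_norm_sq_to_K] at h1
      have h2 : ‖Y.vec W₀ r i‖ ^ 2 = 1 := Complex.ofReal_injective (by push_cast; exact h1)
      exact (pow_eq_one_iff_of_nonneg (norm_nonneg _) two_ne_zero).1 h2
    · have hv1 (q : Y.Index) : (v q : LTwo G ℂ) ∈ Submodule.span ℂ {ctsL (1 : C(G, ℂ))} :=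
        mem_span_one_of_leftTranslate_eq fun g =>
          congrArg Subtype.val (congrArg (fun w : Y.Space => w q) (hv g))
      obtain ⟨c, hc⟩ := hspan (v ⟨W₀, r⟩)
      refine Submodule.mem_span_singleton.2 ⟨c, lp.ext (funext fun q => ?_)⟩
      by_cases hq : q = ⟨W₀, r⟩
      · subst hq
        rw [← hc]
        change c • (lp.single 2 (⟨W₀, r⟩ : Y.Index) ((Y.isBlock W₀).basis i) : Y.Space) ⟨W₀, r⟩ = _
        rw [lp.single_apply_self]
      · have hW : q.1 ≠ W₀ := by
          intro h
          obtain ⟨W, r'⟩ := q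
          simp only at h
          subst h
          exact hq (by rw [hr r'])
        have h0 : v q = 0 := Subtype.ext
          (inner_self_eq_zero.1 ((Y.orthogonal q.1 W₀ hW).inner_eq (v q).2 (hv1 q)))
        rw [h0]
        change c • (lp.single 2 (⟨W₀, r⟩ : Y.Index) ((Y.isBlock W₀).basis i) : Y.Space) q = _
        rw [lp.single_apply_ne _ _ _ hq, smul_zero]
    · rw [Submodule.span_singleton_le_iff_mem]
      intro g
      rw [Y.repr_op_vec, Finset.sum_eq_single i (fun i' _ h => absurd (hi i') h) (by simp),
        UnitaryRepr.coeff_apply, leftRepr_op, hfixW _ ((Y.isBlock W₀).basis i).2,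
        UnitaryRepr.inner_basis, if_pos rfl, one_smul]
    · have hconst : Lp.const 2 (haarP G) (1 : ℂ) = ctsL (1 : C(G, ℂ)) := rfl
      have hmem : ctsL (1 : C(G, ℂ)) ∈ W₀.1 := Submodule.mem_span_singleton_self _
      have hstar : star ((leftRepr G ℂ).coeff (Y.isBlock W₀).basis i i) = 1 := by
        ext g
        rw [ContinuousMap.star_apply, UnitaryRepr.coeff_apply, leftRepr_op,
          hfixW _ ((Y.isBlock W₀).basis i).2, UnitaryRepr.inner_basis, if_pos rfl]
        simp
      rw [hconst, hsW W₀ hmem, blockCol_apply,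
        Finset.sum_eq_single r (fun r' _ h => absurd (hr r') h) (by simp),
        Finset.sum_eq_single i (fun i' _ h => absurd (hi i') h) (by simp), blockCoef_apply,
        Finset.sum_eq_single i (fun i' _ h => absurd (hi i') h) (by simp), hstar, hnormone,
        Y.row_one, one_smul, map_one]
      rfl

end BlockFrames

end FrameData

/-! ### Amplified representations -/

namespace HTensor

section Amplify

variable {G E K : Type*} [Group G] [TopologicalSpace G]
  [NormedAddCommGroup E] [InnerProductSpace ℂ E] [NormedAddCommGroup K] [InnerProductSpace ℂ K]

/-- The tensor product of two isometries as an isometry. -/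
def hmapIso {E' K' : Type*} [NormedAddCommGroup E'] [InnerProductSpace ℂ E']
    [NormedAddCommGroup K'] [InnerProductSpace ℂ K'] (S : E →ₗᵢ[ℂ] E') (T : K →ₗᵢ[ℂ] K') :
    HTensor E K →ₗᵢ[ℂ] HTensor E' K' :=
  ⟨(hmap S T : HTensor E K →ₗ[ℂ] HTensor E' K'), fun v => by
    refine UniformSpace.Completion.induction_on v
      (isClosed_eq (hmap S T).continuous.norm continuous_norm) fun a => ?_
    have h : hmap S T (a : HTensor E K) = (TensorProduct.mapIsometry S T a : HTensor E' K') :=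
      ContinuousLinearMap.extend_eq _ UniformSpace.Completion.denseRange_coe
        (UniformSpace.Completion.isUniformInducing_coe _) a
    change ‖hmap S T (a : HTensor E K)‖ = _
    rw [h, UniformSpace.Completion.norm_coe, UniformSpace.Completion.norm_coe,
      LinearIsometry.norm_map]⟩

variable (E) in
/-- The representation `1 ⊗ μ`. -/
def amplify (μ : UnitaryRepr G K) : UnitaryRepr G (HTensor E K) :=
  UnitaryRepr.ofIsometries (fun g => hmapIso LinearIsometry.id (μ.op g).toLinearIsometry)
    (fun v => by
      have h : hmap (LinearIsometry.id : E →ₗᵢ[ℂ] E) (μ.op 1).toLinearIsometry =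
          ContinuousLinearMap.id ℂ _ := ext_clm fun e f => by
        rw [hmap_htmul]
        change htmul e (μ.op 1 f) = htmul e f
        rw [μ.op_one_apply]
      exact DFunLike.congr_fun h v)
    (fun g h v => by
      have h : hmap (LinearIsometry.id : E →ₗᵢ[ℂ] E) (μ.op (g * h)).toLinearIsometry =
          hmap LinearIsometry.id (μ.op g).toLinearIsometry ∘L
            hmap LinearIsometry.id (μ.op h).toLinearIsometry := ext_clm fun e f => by
        rw [ContinuousLinearMap.comp_apply, hmap_htmul, hmap_htmul, hmap_htmul]
        change htmul e (μ.op (g * h) f) = htmul e (μ.op g (μ.op h f))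
        rw [μ.op_mul_apply]
      exact DFunLike.congr_fun h v)
    (fun v => by
      refine dense_span_htmul.induction (P := fun v => v ∈ continuityVectors fun g =>
        hmapIso (LinearIsometry.id : E →ₗᵢ[ℂ] E) (μ.op g).toLinearIsometry)
        (fun v hv => Submodule.span_le.2 ?_ hv) (isClosed_continuityVectors _) v
      rintro _ ⟨e, f, rfl⟩
      change Continuous fun g => hmap LinearIsometry.id (μ.op g).toLinearIsometry (htmul e f)
      simp only [hmap_htmul]
      change Continuous fun g => (ket (μ.op g f) e : HTensor E K)
      exact (ket.continuous.comp (μ.continuous_op f)).clm_apply continuous_const)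

theorem amplify_op (μ : UnitaryRepr G K) (g : G) (v : HTensor E K) :
    (amplify E μ).op g v = hmap LinearIsometry.id (μ.op g).toLinearIsometry v := rfl

theorem amplify_op_htmul (μ : UnitaryRepr G K) (g : G) (e : E) (f : K) :
    (amplify E μ).op g (htmul e f) = htmul e (μ.op g f) := by
  rw [amplify_op, hmap_htmul]
  rfl

end Amplify

section Smooth

variable {G E E' K : Type*} [Group G] [TopologicalSpace G] [IsTopologicalGroup G] [CompactSpace G]
  [T2Space G] [MeasurableSpace G] [BorelSpace G]
  [NormedAddCommGroup E] [InnerProductSpace ℂ E] [CompleteSpace E]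
  [NormedAddCommGroup E'] [InnerProductSpace ℂ E'] [CompleteSpace E']
  [NormedAddCommGroup K] [InnerProductSpace ℂ K] [CompleteSpace K]

theorem smooth_amplify (μ : UnitaryRepr G K) (ψ : C(G, ℂ)) :
    (amplify E μ).smooth ψ = map (ContinuousLinearMap.id ℂ E) (μ.smooth ψ) :=
  ext_clm fun e f => by
    rw [map_htmul]
    exact (UnitaryRepr.comp_smooth (u := μ) (u' := amplify E μ) (ket.flip e)
      (fun g η => (amplify_op_htmul μ g e η).symm) ψ f).symm

variable {D : Type*} [CStarAlgebra D] {π : D →⋆ₐ[ℂ] (E →L[ℂ] E)} {π' : D →⋆ₐ[ℂ] (E' →L[ℂ] E')}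

theorem adjoint_amplify_op (μ : UnitaryRepr G K) {S : HTensor E (LTwo G ℂ) →L[ℂ] HTensor E K}
    (hS : ∀ g v, S ((amplify E (leftRepr G ℂ)).op g v) = (amplify E μ).op g (S v)) (g : G)
    (w : HTensor E K) :
    S.adjoint ((amplify E μ).op g w) = (amplify E (leftRepr G ℂ)).op g (S.adjoint w) := by
  refine ext_inner_left ℂ fun v => ?_
  rw [ContinuousLinearMap.adjoint_inner_right, ← inv_inv g, ← UnitaryRepr.inner_op_left,
    ← UnitaryRepr.inner_op_left, ContinuousLinearMap.adjoint_inner_right, hS]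

/-- Averaging in the column index of `S*` amounts to multiplication by the compact operator `λ(ψ)`. -/
theorem adjoint_comp_ket_smooth (μ : UnitaryRepr G K)
    {S : HTensor E (LTwo G ℂ) →L[ℂ] HTensor E K}
    (hS : ∀ g v, S ((amplify E (leftRepr G ℂ)).op g v) = (amplify E μ).op g (S v))
    (ψ : C(G, ℂ)) (ζ : K) : S.adjoint ∘L ket (μ.smooth ψ ζ) =
      map (ContinuousLinearMap.id ℂ E) ((leftRepr G ℂ).smooth ψ) ∘L S.adjoint ∘L ket ζ := by
  rw [← smooth_amplify]
  ext e
  change S.adjoint (htmul e (μ.smooth ψ ζ)) = (amplify E _).smooth ψ (S.adjoint (htmul e ζ))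
  rw [← UnitaryRepr.comp_smooth (u := amplify E μ) S.adjoint (adjoint_amplify_op μ hS),
    smooth_amplify, map_htmul]
  rfl

/-- The adjoint of an intertwiner from the regular representation has columns over `D`: by averaging
over the group one may multiply with compact operators. -/
theorem IsAmp.adjoint (hπ : Function.Injective π) (μ : UnitaryRepr G K)
    {T : HTensor E (LTwo G ℂ) →L[ℂ] HTensor E K} {T' : HTensor E' (LTwo G ℂ) →L[ℂ] HTensor E' K}
    (h : IsAmp π π' T T')
    (hT : ∀ g v, T ((amplify E (leftRepr G ℂ)).op g v) = (amplify E μ).op g (T v))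
    (hT' : ∀ g v, T' ((amplify E' (leftRepr G ℂ)).op g v) = (amplify E' μ).op g (T' v)) :
    IsAmp π π' T.adjoint T'.adjoint := by
  intro ζ
  refine isClosed_colPair.closure_subset_iff.2 (subset_refl _) (Metric.mem_closure_iff.2 ?_)
  intro ε hε
  obtain ⟨δ, hδ, hδε⟩ := Metric.continuous_iff.1
    (Continuous.prodMk (f := fun ζ => T.adjoint ∘L ket ζ) (g := fun ζ => T'.adjoint ∘L ket ζ)
      (by fun_prop) (by fun_prop)) ζ ε hε
  obtain ⟨ψ, hψ⟩ := μ.exists_smooth_sub_le ζ (half_pos hδ)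
  refine ⟨_, ?_, (dist_comm _ _).trans_lt (hδε (μ.smooth ψ ζ) ?_)⟩
  · change (T.adjoint ∘L ket (μ.smooth ψ ζ), T'.adjoint ∘L ket (μ.smooth ψ ζ)) ∈ colPair π π' _
    rw [adjoint_comp_ket_smooth μ hT, adjoint_comp_ket_smooth μ hT']
    exact h.map_comp_adjoint hπ (smooth_leftRepr_mem_finiteRankClosure ψ) ζ
  · rw [dist_eq_norm]
    exact hψ.2.trans_lt (half_lt_self hδ)

end Smooth

section Entries

variable {D E K : Type*} [CStarAlgebra D] [NormedAddCommGroup E] [InnerProductSpace ℂ E]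
  [CompleteSpace E] [NormedAddCommGroup K] [InnerProductSpace ℂ K] [CompleteSpace K]

/-- A column is approximated by its truncations to finite-dimensional subspaces; hence it is a
column over every subalgebra which contains its entries. -/
theorem mem_col_of_bra_comp {D₂ : Type*} [CStarAlgebra D₂] {π : D →⋆ₐ[ℂ] (E →L[ℂ] E)}
    {π₂ : D₂ →⋆ₐ[ℂ] (E →L[ℂ] E)} {X : E →L[ℂ] HTensor E K} (hX : X ∈ col π K)
    (h : ∀ k, ∃ b, bra k ∘L X = π₂ b) : X ∈ col π₂ K := by
  have hspan {Y : E →L[ℂ] HTensor E K}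
      (hY : Y ∈ Submodule.span ℂ {c | ∃ d k, c = ket k ∘L π d}) :
      ∃ N : Submodule ℂ K, FiniteDimensional ℂ N ∧ ∀ k ∈ Nᗮ, bra k ∘L Y = 0 := by
    induction hY using Submodule.span_induction with
    | zero => exact ⟨⊥, inferInstance, fun k _ => ContinuousLinearMap.comp_zero _⟩
    | mem a ha =>
      obtain ⟨d, k, rfl⟩ := ha
      refine ⟨Submodule.span ℂ {k}, inferInstance, fun l hl => ?_⟩
      rw [← ContinuousLinearMap.comp_assoc, bra_comp_ket,
        inner_eq_zero_symm.1 (Submodule.mem_orthogonal_singleton_iff_inner_right.1 hl), zero_smul,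
        ContinuousLinearMap.zero_comp]
    | add a b _ _ ha hb =>
      obtain ⟨N, hN, hNa⟩ := ha
      obtain ⟨N', hN', hNb⟩ := hb
      refine ⟨N ⊔ N', inferInstance, fun k hk => ?_⟩
      rw [ContinuousLinearMap.comp_add, hNa k (Submodule.orthogonal_le le_sup_left hk),
        hNb k (Submodule.orthogonal_le le_sup_right hk), add_zero]
    | smul c a _ ha =>
      obtain ⟨N, hN, hNa⟩ := ha
      exact ⟨N, hN, fun k hk => by rw [ContinuousLinearMap.comp_smul, hNa k hk, smul_zero]⟩
  refine (Submodule.isClosed_topologicalClosure _).closure_subset_iff.2 (subset_refl _)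
    (Metric.mem_closure_iff.2 fun ε hε => ?_)
  obtain ⟨Y, hY, hXY⟩ := Metric.mem_closure_iff.1 hX (ε / 2) (half_pos hε)
  obtain ⟨N, hN, hNY⟩ := hspan hY
  let Q := map (ContinuousLinearMap.id ℂ E) N.starProjection
  have hbraQ (k : K) : (bra k ∘L Q : HTensor E K →L[ℂ] E) = bra (N.starProjection k) :=
    ext_clm fun e f => by
      change bra k (map _ _ (htmul e f)) = _
      rw [map_htmul, bra_htmul, bra_htmul, ← N.inner_starProjection_left_eq_right]
      rfl
  have hQY : Q ∘L Y = Y := by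
    ext e
    refine bra_ext fun k => ?_
    have h1 : bra (k - N.starProjection k) ∘L Y = 0 :=
      hNY _ (Submodule.sub_starProjection_mem_orthogonal k)
    have h2 : bra k (Y e) - bra (N.starProjection k) (Y e) = 0 := by
      have h3 : bra (k - N.starProjection k) (Y e) = 0 := DFunLike.congr_fun h1 e
      rw [← h3]
      refine ext_inner_left ℂ fun e' => ?_
      rw [inner_sub_right, inner_bra, inner_bra, inner_bra, ← inner_sub_left]
      congr 1
      rw [← ket_apply, ← ket_apply, ← ket_apply, map_sub]
      rfl
    rw [← hbraQ] at h2
    exact (sub_eq_zero.1 h2).symm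
  have hQnorm : ‖Q‖ ≤ 1 := (norm_map_le _ _).trans
    (mul_le_one₀ ContinuousLinearMap.norm_id_le (norm_nonneg _) N.starProjection_norm_le)
  refine ⟨Q ∘L X, ?_, ?_⟩
  · let b := stdOrthonormalBasis ℂ N
    have hsum : Q ∘L X = ∑ i, ket (b i : K) ∘L (bra (b i : K) ∘L X) := by
      have h1 : Q = ∑ i, ket (b i : K) ∘L bra (b i : K) := ext_clm fun e f => by
        rw [sum_apply]
        change map _ _ (htmul e f) = _
        rw [map_htmul, Submodule.starProjection_apply,
          ← b.sum_repr (N.orthogonalProjectionOnto f), Submodule.coe_sum, ← ket_apply, map_sum,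
          sum_apply]
        refine Finset.sum_congr rfl fun i _ => ?_
        rw [b.repr_apply_apply]
        change ket ((inner ℂ (b i) (N.orthogonalProjectionOnto f)) • (b i : K)) e =
          ket (b i : K) (bra (b i : K) (htmul e f))
        rw [bra_htmul, map_smul, map_smul, ← N.inner_orthogonalProjectionOnto_eq_of_mem_left]
        rfl
      rw [h1]
      ext e
      simp [sum_apply]
    rw [hsum]
    refine sum_mem fun i _ => ?_
    obtain ⟨d, hd⟩ := h (b i)
    rw [hd]
    exact ket_comp_mem_col _ _
  · rw [dist_eq_norm] at hXY ⊢
    have h1 : X - Q ∘L X = (X - Y) - Q ∘L (X - Y) := by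
      rw [ContinuousLinearMap.comp_sub, hQY]
      abel
    have h2 : ‖Q ∘L (X - Y)‖ ≤ ‖X - Y‖ := (ContinuousLinearMap.opNorm_comp_le _ _).trans
      (mul_le_of_le_one_left (norm_nonneg _) hQnorm)
    calc ‖X - Q ∘L X‖ ≤ ‖X - Y‖ + ‖Q ∘L (X - Y)‖ := by rw [h1]; exact norm_sub_le _ _
      _ < ε := by linarith

end Entries

end HTensor

/-! ### Freeness isometries in different covariant representations -/

section Transport

open HTensor

variable {G A : Type*} [Group G] [TopologicalSpace G] [IsTopologicalGroup G] [CompactSpace G]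
  [T2Space G] [MeasurableSpace G] [BorelSpace G] [CStarAlgebra A] {α : CStarDynamics G A}
  {E E' H : Type*} [NormedAddCommGroup E] [InnerProductSpace ℂ E] [CompleteSpace E]
  [NormedAddCommGroup E'] [InnerProductSpace ℂ E'] [CompleteSpace E']
  [NormedAddCommGroup H] [InnerProductSpace ℂ H] [CompleteSpace H]

/-- The identification `L²(G, E) = E ⊗ L²(G)` as an operator. -/
def tensorInv : LTwo G E →L[ℂ] HTensor E (LTwo G ℂ) :=
  ((tensorIso : HTensor E (LTwo G ℂ) ≃ₗᵢ[ℂ] LTwo G E).symm.toContinuousLinearEquiv :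
    LTwo G E →L[ℂ] HTensor E (LTwo G ℂ))

/-- An isometry on `L²(G, E)` as an operator on `E ⊗ L²(G)`. -/
def tensorOp (s : LTwo G E →ₗᵢ[ℂ] HTensor E H) : HTensor E (LTwo G ℂ) →L[ℂ] HTensor E H :=
  s.toContinuousLinearMap ∘L
    ((tensorIso : HTensor E (LTwo G ℂ) ≃ₗᵢ[ℂ] LTwo G E).toContinuousLinearEquiv :
      HTensor E (LTwo G ℂ) →L[ℂ] LTwo G E)

theorem tensorOp_apply (s : LTwo G E →ₗᵢ[ℂ] HTensor E H) (v : HTensor E (LTwo G ℂ)) :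
    tensorOp s v = s (tensorIso v) := rfl

theorem tensorOp_comp_ket (s : LTwo G E →ₗᵢ[ℂ] HTensor E H) (f : LTwo G ℂ) :
    tensorOp s ∘L ket f = s.toContinuousLinearMap ∘L ltmulL f :=
  ContinuousLinearMap.ext fun η => congrArg s (tensorIso_htmul η f)

theorem adjoint_tensorOp (s : LTwo G E →ₗᵢ[ℂ] HTensor E H) :
    (tensorOp s).adjoint = tensorInv ∘L s.toContinuousLinearMap.adjoint := by
  symm
  rw [ContinuousLinearMap.eq_adjoint_iff]
  intro x y
  change ⟪tensorIso.symm (s.toContinuousLinearMap.adjoint x), y⟫_ℂ = ⟪x, s (tensorIso y)⟫_ℂ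
  rw [← (tensorIso : HTensor E (LTwo G ℂ) ≃ₗᵢ[ℂ] LTwo G E).inner_map_map,
    LinearIsometryEquiv.apply_symm_apply, ContinuousLinearMap.adjoint_inner_left]
  rfl

theorem adjoint_comp_self (s : LTwo G E →ₗᵢ[ℂ] HTensor E H) (v : LTwo G E) :
    s.toContinuousLinearMap.adjoint (s v) = v := by
  refine ext_inner_left ℂ fun w => ?_
  rw [ContinuousLinearMap.adjoint_inner_right]
  exact s.inner_map_map w v

theorem adjoint_tensorOp_comp_self (s : LTwo G E →ₗᵢ[ℂ] HTensor E H) :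
    (tensorOp s).adjoint ∘L tensorOp s = ContinuousLinearMap.id ℂ _ := by
  ext v
  rw [adjoint_tensorOp]
  change tensorIso.symm (s.toContinuousLinearMap.adjoint (s (tensorIso v))) = v
  rw [adjoint_comp_self, LinearIsometryEquiv.symm_apply_apply]

/-- The compactness condition says that the columns of the isometry are columns over the algebra. -/
theorem tensorOp_comp_ket_mem_col (ρ : α.CovRep E) (s : LTwo G E →ₗᵢ[ℂ] HTensor E H)
    (hs : ∀ T ∈ ρ.compactsL, s.toContinuousLinearMap ∘L T ∈ ρ.compactsLH H) (f : LTwo G ℂ) :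
    tensorOp s ∘L ket f ∈ col ρ.π H := by
  rw [tensorOp_comp_ket]
  have hX {X : LTwo G E →L[ℂ] HTensor E H} (hX : X ∈ ρ.compactsLH H) :
      X ∘L ltmulL f ∈ col ρ.π H := by
    let Φ : (LTwo G E →L[ℂ] HTensor E H) →L[ℂ] (E →L[ℂ] HTensor E H) :=
      (ContinuousLinearMap.compL ℂ E (LTwo G E) (HTensor E H)).flip (ltmulL f)
    have hle : ρ.compactsLH H ≤ (col ρ.π H).comap (Φ : _ →ₗ[ℂ] _) := by
      refine Submodule.topologicalClosure_minimal _ (Submodule.span_le.2 ?_)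
        ((Submodule.isClosed_topologicalClosure _).preimage Φ.continuous)
      rintro T ⟨a, k, -, hT⟩
      have h1 : T ∘L ltmulL f = ket (k f) ∘L ρ.π a := ContinuousLinearMap.ext fun η => hT η f
      change T ∘L ltmulL f ∈ col ρ.π H
      rw [h1]
      exact ket_comp_mem_col _ _
    exact hle hX
  let T : LTwo G E →L[ℂ] LTwo G E :=
    ((tensorIso : HTensor E (LTwo G ℂ) ≃ₗᵢ[ℂ] LTwo G E).toContinuousLinearEquiv :
      HTensor E (LTwo G ℂ) →L[ℂ] LTwo G E) ∘L
    map (ContinuousLinearMap.id ℂ E) (InnerProductSpace.rankOne ℂ f f) ∘L tensorInv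
  have hT (η : E) (f' : LTwo G ℂ) : T (ltmul η f') = ltmul η (⟪f, f'⟫_ℂ • f) := by
    change tensorIso (map _ _ (tensorIso.symm (ltmul η f'))) = _
    rw [← tensorIso_htmul, LinearIsometryEquiv.symm_apply_apply, map_htmul, tensorIso_htmul]
    rfl
  have hTmem : T ∈ ρ.compactsL := by
    refine Submodule.le_topologicalClosure _ (Submodule.subset_span
      ⟨1, InnerProductSpace.rankOne ℂ f f, ?_, fun η f' => ?_⟩)
    · exact isCompactOperator_of_mem_finiteRankClosure
        (Submodule.le_topologicalClosure _ (Submodule.subset_span ⟨f, f, rfl⟩))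
    · rw [hT, map_one]
      rfl
  have h1 := hX (hs T hTmem)
  by_cases hf : f = 0
  · rw [hf, map_zero, ContinuousLinearMap.comp_zero]
    exact Submodule.zero_mem _
  · have h2 : (s.toContinuousLinearMap ∘L T) ∘L ltmulL f =
        ⟪f, f⟫_ℂ • (s.toContinuousLinearMap ∘L ltmulL f) := by
      ext η
      change s (T (ltmul η f)) = ⟪f, f⟫_ℂ • s (ltmul η f)
      rw [hT, ← ltmulL_apply, ← ltmulL_apply, map_smul, smul_apply, map_smul]
    rw [h2] at h1
    exact ((col ρ.π H).smul_mem_iff (inner_self_ne_zero.2 hf)).1 h1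

theorem tensorOp_amplify_op (μ : UnitaryRepr G H) (s : LTwo G E →ₗᵢ[ℂ] HTensor E H)
    (hs : ∀ g f, hmap LinearIsometry.id (μ.op g).toLinearIsometry (s f) = s (leftTranslate g f))
    (g : G) (v : HTensor E (LTwo G ℂ)) :
    tensorOp s ((amplify E (leftRepr G ℂ)).op g v) = (amplify E μ).op g (tensorOp s v) := by
  rw [tensorOp_apply, tensorOp_apply, amplify_op _ _ (s _), hs]
  congr 1
  have h : ((tensorIso : HTensor E (LTwo G ℂ) ≃ₗᵢ[ℂ] LTwo G E).toContinuousLinearEquiv :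
      HTensor E (LTwo G ℂ) →L[ℂ] LTwo G E) ∘L
        hmap LinearIsometry.id ((leftRepr G ℂ).op g).toLinearIsometry =
      (leftIso g).toContinuousLinearMap ∘L
        ((tensorIso : HTensor E (LTwo G ℂ) ≃ₗᵢ[ℂ] LTwo G E).toContinuousLinearEquiv :
          HTensor E (LTwo G ℂ) →L[ℂ] LTwo G E) := by
    refine ext_clm fun e f => ?_
    change tensorIso (hmap _ _ (htmul e f)) = leftTranslate g (tensorIso (htmul e f))
    rw [hmap_htmul, tensorIso_htmul, tensorIso_htmul, leftTranslate_ltmul]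
    rfl
  exact DFunLike.congr_fun h v

/-- Conjugation of columns with the unitaries of a representation: `X ↦ (u_g ⊗ 1) X u_g*`. -/
def conjCol (u : UnitaryRepr G E) (g : G) : (E →L[ℂ] HTensor E H) →L[ℂ] (E →L[ℂ] HTensor E H) :=
  (ContinuousLinearMap.compL ℂ E (HTensor E H) (HTensor E H)
    (hmap (u.op g).toLinearIsometry LinearIsometry.id)) ∘L
  (ContinuousLinearMap.compL ℂ E E (HTensor E H)).flip
    ((u.op g⁻¹).toContinuousLinearEquiv : E →L[ℂ] E)

theorem conjCol_apply (u : UnitaryRepr G E) (g : G) (X : E →L[ℂ] HTensor E H) (η : E) :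
    conjCol u g X η = hmap (u.op g).toLinearIsometry LinearIsometry.id (X (u.op g⁻¹ η)) := rfl

/-- Conjugation by `u_g` is the action of the group on the coefficients of a column. -/
theorem conjCol_ket_comp (ρ : α.CovRep E) (g : G) (k : H) (a : A) :
    conjCol ρ.u g (ket k ∘L ρ.π a) = ket k ∘L ρ.π (α.act g a) := by
  ext η
  rw [conjCol_apply]
  change hmap _ _ (htmul (ρ.π a (ρ.u.op g⁻¹ η)) k) = htmul (ρ.π (α.act g a) η) k
  rw [hmap_htmul]
  change htmul (ρ.u.op g (ρ.π a (ρ.u.op g⁻¹ η))) k = _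
  rw [← ρ.covariant, UnitaryRepr.op_op_inv]

theorem conjCol_tensorOp (u : UnitaryRepr G E) (s : LTwo G E →ₗᵢ[ℂ] HTensor E H) {g : G}
    (hs : ∀ v, hmap (u.op g).toLinearIsometry LinearIsometry.id (s v) =
      s (twistedRightTranslate (u.op g) g v)) (f : LTwo G ℂ) :
    conjCol u g (tensorOp s ∘L ket f) = tensorOp s ∘L ket (rightTranslate g f) := by
  ext η
  rw [conjCol_apply, tensorOp_comp_ket, tensorOp_comp_ket]
  change hmap _ _ (s (ltmul _ f)) = s (ltmul η (rightTranslate g f))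
  rw [hs, twistedRightTranslate_ltmul, UnitaryRepr.op_op_inv]

/-- A freeness isometry for a faithful covariant representation has a counterpart in every
covariant representation. -/
theorem CStarDynamics.IsFreenessIsometry.exists_transport {μ : UnitaryRepr G H} {ρ : α.CovRep E}
    {s : LTwo G E →ₗᵢ[ℂ] HTensor E H} (hs : CStarDynamics.IsFreenessIsometry μ ρ s)
    (hρ : ρ.IsFaithful) (ρ' : α.CovRep E') :
    ∃ s' : LTwo G E' →ₗᵢ[ℂ] HTensor E' H, IsAmp ρ.π ρ'.π (tensorOp s) (tensorOp s') ∧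
      (∀ g f, hmap (ρ'.u.op g).toLinearIsometry LinearIsometry.id (s' f) =
        s' (twistedRightTranslate (ρ'.u.op g) g f)) ∧
      ∀ g f, hmap LinearIsometry.id (μ.op g).toLinearIsometry (s' f) = s' (leftTranslate g f) := by
  obtain ⟨T', hT'⟩ := exists_isAmp (π' := ρ'.π) hρ (tensorOp s)
    (0 : HTensor E (LTwo G ℂ) →L[ℂ] HTensor E H) (tensorOp_comp_ket_mem_col ρ s hs.compacts)
    (fun k => by rw [ContinuousLinearMap.zero_comp]; exact Submodule.zero_mem _) 1 (by
      rw [adjoint_tensorOp_comp_self, ContinuousLinearMap.comp_zero, add_zero, Complex.ofReal_one,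
        one_smul])
  have hiso : T'.adjoint ∘L T' = ContinuousLinearMap.id ℂ _ :=
    hT'.adjoint_comp_self_eq_id hρ (adjoint_tensorOp_comp_self s)
  let J : HTensor E' (LTwo G ℂ) →ₗᵢ[ℂ] HTensor E' H :=
    (T' : HTensor E' (LTwo G ℂ) →ₗ[ℂ] HTensor E' H).isometryOfInner fun x y => by
      change ⟪T' x, T' y⟫_ℂ = _
      rw [← ContinuousLinearMap.adjoint_inner_right]
      exact congrArg _ (DFunLike.congr_fun hiso y)
  let s' : LTwo G E' →ₗᵢ[ℂ] HTensor E' H := J.comp tensorIso.symm.toLinearIsometry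
  have hs' : tensorOp s' = T' := by
    ext v
    change T' (tensorIso.symm (tensorIso v)) = _
    rw [LinearIsometryEquiv.symm_apply_apply]
  have hs'l (η : E') (f : LTwo G ℂ) : s' (ltmul η f) = T' (htmul η f) := by
    rw [← hs', tensorOp_apply, tensorIso_htmul]
  refine ⟨s', by rwa [hs'], fun g v => ?_, fun g v => ?_⟩
  · have h1 : hmap (ρ'.u.op g).toLinearIsometry LinearIsometry.id ∘L s'.toContinuousLinearMap =
        s'.toContinuousLinearMap ∘L (twistedIso (ρ'.u.op g) g).toContinuousLinearMap := by
      refine LTwo.ext_clm fun η φ => ?_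
      -- both sides are the counterpart of the same column over the algebra
      have h2 := map_mem_colPair (conjCol ρ.u g) (conjCol ρ'.u g) (fun d k => by
        rw [conjCol_ket_comp, conjCol_ket_comp]
        exact ket_comp_mem_colPair _ _) (hT' (ctsL φ))
      simp only at h2
      rw [conjCol_tensorOp ρ.u s (hs.equivariant g)] at h2
      have h3 := DFunLike.congr_fun (snd_eq_of_fst_eq hρ h2 (hT' (rightTranslate g (ctsL φ))))
        (ρ'.u.op g η)
      rw [conjCol_apply, UnitaryRepr.op_inv_op] at h3
      change hmap _ _ (s' (ltmul η (ctsL φ))) =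
        s' (twistedRightTranslate (ρ'.u.op g) g (ltmul η (ctsL φ)))
      rw [twistedRightTranslate_ltmul, hs'l, hs'l]
      exact h3
    exact DFunLike.congr_fun h1 v
  · have h1 : hmap LinearIsometry.id (μ.op g).toLinearIsometry ∘L s'.toContinuousLinearMap =
        s'.toContinuousLinearMap ∘L (leftIso g).toContinuousLinearMap := by
      refine LTwo.ext_clm fun η φ => ?_
      have hamp : IsAmp ρ.π ρ'.π (hmap LinearIsometry.id (μ.op g).toLinearIsometry)
          (hmap LinearIsometry.id (μ.op g).toLinearIsometry) := by
        rw [hmap_eq_map, hmap_eq_map]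
        exact IsAmp.map _
      have h2 := hamp.comp_mem (hT' (ctsL φ))
      have h3 : hmap LinearIsometry.id (μ.op g).toLinearIsometry ∘L
          tensorOp s ∘L ket (ctsL φ) = tensorOp s ∘L ket (leftTranslate g (ctsL φ)) := by
        ext η
        rw [tensorOp_comp_ket, tensorOp_comp_ket]
        exact (hs.commuting g (ltmul η (ctsL φ))).trans (by rw [leftTranslate_ltmul]; rfl)
      simp only at h2
      rw [h3] at h2
      have h4 := DFunLike.congr_fun (snd_eq_of_fst_eq hρ h2 (hT' (leftTranslate g (ctsL φ)))) η
      change hmap _ _ (s' (ltmul η (ctsL φ))) = s' (leftTranslate g (ltmul η (ctsL φ)))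
      rw [leftTranslate_ltmul, hs'l, hs'l]
      exact h4
    exact DFunLike.congr_fun h1 v

variable {μ : UnitaryRepr G H} {ρ : α.CovRep E} {s : LTwo G E →ₗᵢ[ℂ] HTensor E H}

theorem piS_eq (ρ : α.CovRep E) (s : LTwo G E →ₗᵢ[ℂ] HTensor E H) (x : A) :
    ρ.piS s x = tensorOp s ∘L jT ρ x ∘L (tensorOp s).adjoint := by
  ext v
  rw [adjoint_tensorOp]
  change s (ρ.jOp x (s.toContinuousLinearMap.adjoint v)) =
    s (tensorIso (jT ρ x (tensorIso.symm (s.toContinuousLinearMap.adjoint v))))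
  rw [tensorIso_jT, LinearIsometryEquiv.apply_symm_apply]

/-- The operators `s j_α(x) s*` for corresponding isometries correspond to each other. -/
theorem isAmp_piS (hρ : ρ.IsFaithful) {ρ' : α.CovRep E'} {s' : LTwo G E' →ₗᵢ[ℂ] HTensor E' H}
    (h : IsAmp ρ.π ρ'.π (tensorOp s) (tensorOp s'))
    (hs : ∀ g f, hmap LinearIsometry.id (μ.op g).toLinearIsometry (s f) = s (leftTranslate g f))
    (hs' : ∀ g f, hmap LinearIsometry.id (μ.op g).toLinearIsometry (s' f) = s' (leftTranslate g f))
    (x : A) : IsAmp ρ.π ρ'.π (ρ.piS s x) (ρ'.piS s' x) := by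
  rw [piS_eq, piS_eq]
  exact h.comp ((isAmp_jT ρ ρ' x).comp
    (h.adjoint hρ μ (tensorOp_amplify_op μ s hs) (tensorOp_amplify_op μ s' hs')))

/-! The operators `s j_α(x) s*` form a *-representation on the range of `s s*`. -/

theorem piS_apply (x : A) (v : HTensor E H) :
    ρ.piS s x v = s (ρ.jOp x (s.toContinuousLinearMap.adjoint v)) := rfl

theorem piS_mul (x y : A) : ρ.piS s (x * y) = ρ.piS s x ∘L ρ.piS s y := by
  ext v
  rw [ContinuousLinearMap.comp_apply, piS_apply, piS_apply, piS_apply, adjoint_comp_self]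
  exact congrArg s (DFunLike.congr_fun (map_mul (ρ.jHom (G := G)) x y) _)

theorem piS_add (x y : A) : ρ.piS s (x + y) = ρ.piS s x + ρ.piS s y := by
  ext v
  rw [add_apply, piS_apply, piS_apply, piS_apply, ← map_add]
  exact congrArg s (DFunLike.congr_fun (map_add (ρ.jHom (G := G)) x y) _)

theorem piS_smul (c : ℂ) (x : A) : ρ.piS s (c • x) = c • ρ.piS s x := by
  ext v
  rw [smul_apply, piS_apply, piS_apply, ← map_smul]
  exact congrArg s (DFunLike.congr_fun (map_smul (ρ.jHom (G := G)) c x) _)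

theorem piS_one : ρ.piS s (1 : A) = CStarDynamics.rangeProj s := by
  ext v
  rw [piS_apply]
  exact congrArg s (DFunLike.congr_fun (map_one (ρ.jHom (G := G))) _)

theorem piS_star (x : A) : ρ.piS s (star x) = (ρ.piS s x).adjoint := by
  rw [ContinuousLinearMap.eq_adjoint_iff]
  intro v w
  have h1 : ρ.jOp (G := G) (star x) = (ρ.jOp x).adjoint := map_star (ρ.jHom (G := G)) x
  rw [piS_apply, h1]
  change ⟪s.toContinuousLinearMap _, w⟫_ℂ = ⟪v, s.toContinuousLinearMap _⟫_ℂ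
  rw [← ContinuousLinearMap.adjoint_inner_right, ContinuousLinearMap.adjoint_inner_left]
  exact ContinuousLinearMap.adjoint_inner_left _ _ _

/-- The operators `s j_α(x) s*` are covariant for `1 ⊗ μ`. -/
theorem piS_act (hs : ∀ g f, hmap LinearIsometry.id (μ.op g).toLinearIsometry (s f) =
    s (leftTranslate g f)) (g : G) (x : A) (v : HTensor E H) :
    ρ.piS s (α.act g x) ((amplify E μ).op g v) = (amplify E μ).op g (ρ.piS s x v) := by
  have h1 : s.toContinuousLinearMap.adjoint ((amplify E μ).op g v) =
      leftTranslate g (s.toContinuousLinearMap.adjoint v) := by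
    refine ext_inner_left ℂ fun w => ?_
    change _ = ⟪w, (leftRepr G E).op g _⟫_ℂ
    rw [ContinuousLinearMap.adjoint_inner_right, ← inv_inv g, ← UnitaryRepr.inner_op_left,
      ← UnitaryRepr.inner_op_left, ContinuousLinearMap.adjoint_inner_right]
    exact congrArg (fun z => ⟪z, v⟫_ℂ) (hs g⁻¹ w)
  rw [piS_apply, piS_apply, h1, ← ρ.leftTranslate_jOp, amplify_op, hs]

/-- The operators `s j_α(x) s*` commute with `u ⊗ 1`, so their entries are fixed by the group. -/
theorem piS_equivariant (hs : ∀ g f, hmap (ρ.u.op g).toLinearIsometry LinearIsometry.id (s f) =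
    s (twistedRightTranslate (ρ.u.op g) g f)) (g : G) (x : A) (v : HTensor E H) :
    ρ.piS s x (hmap (ρ.u.op g).toLinearIsometry LinearIsometry.id v) =
      hmap (ρ.u.op g).toLinearIsometry LinearIsometry.id (ρ.piS s x v) := by
  have h1 : s.toContinuousLinearMap.adjoint
      (hmap (ρ.u.op g).toLinearIsometry LinearIsometry.id v) =
      twistedRightTranslate (ρ.u.op g) g (s.toContinuousLinearMap.adjoint v) := by
    refine ext_inner_left ℂ fun w => ?_
    change _ = ⟪w, (twistedRepr ρ.u).op g _⟫_ℂ
    obtain ⟨w', rfl⟩ := ((twistedRepr ρ.u).op g).surjective w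
    rw [LinearIsometryEquiv.inner_map_map, ContinuousLinearMap.adjoint_inner_right,
      ContinuousLinearMap.adjoint_inner_right]
    change ⟪s (twistedRightTranslate (ρ.u.op g) g w'), _⟫_ℂ = ⟪s w', v⟫_ℂ
    rw [← hs]
    exact (hmapIso _ _).inner_map_map _ _
  rw [piS_apply, piS_apply, h1, ← ρ.twistedRightTranslate_jOp, hs]

end Transport

/-! ### Amplification over the fixed point algebra -/

section FixedAlgebra

open HTensor

variable {G A : Type*} [Group G] [TopologicalSpace G] [CStarAlgebra A] (α : CStarDynamics G A)

theorem CStarDynamics.continuous_act_apply (g : G) : Continuous (α.act g) :=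
  α.continuous_act.comp (continuous_const.prodMk continuous_id)

theorem CStarDynamics.isClosed_fixedAlgebra : IsClosed (α.fixedAlgebra : Set A) := by
  have h : (α.fixedAlgebra : Set A) = ⋂ g, {x | α.act g x = x} := by
    ext x
    simp only [Set.mem_iInter]
    rfl
  rw [h]
  exact isClosed_iInter fun g => isClosed_eq (α.continuous_act_apply g) continuous_id

namespace CStarDynamics

/-- The fixed point algebra as a C*-algebra. -/
scoped instance : CStarAlgebra α.fixedAlgebra :=
  haveI := α.isClosed_fixedAlgebra
  StarSubalgebra.cstarAlgebra α.fixedAlgebra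

end CStarDynamics

open scoped CStarDynamics

variable {α}

variable {E E' H : Type*} [NormedAddCommGroup E] [InnerProductSpace ℂ E] [CompleteSpace E]
  [NormedAddCommGroup E'] [InnerProductSpace ℂ E'] [CompleteSpace E']
  [NormedAddCommGroup H] [InnerProductSpace ℂ H] [CompleteSpace H]

/-- The restriction of a covariant representation to the fixed point algebra. -/
def CStarDynamics.CovRep.fixedRep (ρ : α.CovRep E) : α.fixedAlgebra →⋆ₐ[ℂ] (E →L[ℂ] E) :=
  ρ.π.comp α.fixedAlgebra.subtype

theorem fixedRep_apply (ρ : α.CovRep E) (b : α.fixedAlgebra) : ρ.fixedRep b = ρ.π (b : A) := rfl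

theorem fixedRep_injective {ρ : α.CovRep E} (hρ : ρ.IsFaithful) :
    Function.Injective ρ.fixedRep := fun _ _ h => Subtype.ext (hρ h)

/-- The slices `1 ⊗ ⟨k|` intertwine `u ⊗ 1` with `u`. -/
theorem bra_hmap (u : E ≃ₗᵢ[ℂ] E) (k : H) (v : HTensor E H) :
    bra k (hmap u.toLinearIsometry LinearIsometry.id v) = u (bra k v) := by
  have h : bra k ∘L hmap u.toLinearIsometry LinearIsometry.id =
      (u.toContinuousLinearEquiv : E →L[ℂ] E) ∘L bra k := ext_clm fun e f => by
    change bra k (hmap _ _ (htmul e f)) = u (bra k (htmul e f))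
    rw [hmap_htmul, bra_htmul, bra_htmul, map_smul]
    rfl
  exact DFunLike.congr_fun h v

/-- An operator commuting with `u ⊗ 1` whose columns are columns over the algebra has columns over
the fixed point algebra. -/
theorem comp_ket_mem_col_fixedRep {ρ : α.CovRep E} (hρ : ρ.IsFaithful)
    {T : HTensor E H →L[ℂ] HTensor E H} (hT : IsAmp ρ.π ρ.π T T)
    (hu : ∀ g v, T (hmap (ρ.u.op g).toLinearIsometry LinearIsometry.id v) =
      hmap (ρ.u.op g).toLinearIsometry LinearIsometry.id (T v)) (k : H) :
    T ∘L ket k ∈ col ρ.fixedRep H := by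
  refine mem_col_of_bra_comp (mem_col_of_mem_colPair (hT k)) fun l => ?_
  obtain ⟨a, ha, -⟩ := hT.exists_entry_eq hρ l k
  refine ⟨⟨a, fun g => hρ ?_⟩, ha⟩
  ext η
  rw [← ρ.u.op_op_inv g η, ρ.covariant, ← ha]
  change ρ.u.op g (bra l (T (htmul (ρ.u.op g⁻¹ η) k))) =
    bra l (T (htmul (ρ.u.op g (ρ.u.op g⁻¹ η)) k))
  rw [← bra_hmap, ← hu, hmap_htmul]
  rfl

variable [IsTopologicalGroup G] [CompactSpace G] [T2Space G] [MeasurableSpace G] [BorelSpace G]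
  {HB : Type*} [NormedAddCommGroup HB] [InnerProductSpace ℂ HB] [CompleteSpace HB]
  {μ : UnitaryRepr G H} {ρ : α.CovRep E} {s : LTwo G E →ₗᵢ[ℂ] HTensor E H}

/-- A selfadjoint square root of `‖x‖² - x* x`. -/
theorem exists_sqrt_norm_sq_sub {A : Type*} [CStarAlgebra A] (x : A) :
    ∃ y : A, star y = y ∧ y * y = ((‖x‖ ^ 2 : ℝ) : ℂ) • 1 - star x * x := by
  let _ := CStarAlgebra.spectralOrder A
  let _ := CStarAlgebra.spectralOrderedRing A
  have h : 0 ≤ algebraMap ℝ A (‖x‖ ^ 2) - star x * x :=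
    sub_nonneg.2 CStarAlgebra.star_mul_le_algebraMap_norm_sq
  refine ⟨CFC.sqrt (algebraMap ℝ A (‖x‖ ^ 2) - star x * x),
    (IsSelfAdjoint.of_nonneg (CFC.sqrt_nonneg _)).star_eq, ?_⟩
  rw [CFC.sqrt_mul_sqrt_self _ h, Algebra.algebraMap_eq_smul_one]
  rfl

theorem diag_mem_colPair {D K : Type*} [CStarAlgebra D] [NormedAddCommGroup K]
    [InnerProductSpace ℂ K] {π : D →⋆ₐ[ℂ] (E →L[ℂ] E)} {X : E →L[ℂ] HTensor E K}
    (hX : X ∈ col π K) : (X, X) ∈ colPair π π K := by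
  let Δ : (E →L[ℂ] HTensor E K) →L[ℂ] (E →L[ℂ] HTensor E K) × (E →L[ℂ] HTensor E K) :=
    (ContinuousLinearMap.id ℂ _).prod (ContinuousLinearMap.id ℂ _)
  have hle : col π K ≤ (colPair π π K).comap (Δ : _ →ₗ[ℂ] _) := by
    refine Submodule.topologicalClosure_minimal _ (Submodule.span_le.2 ?_)
      (isClosed_colPair.preimage Δ.continuous)
    rintro _ ⟨d, k, rfl⟩
    exact ket_comp_mem_colPair d k
  exact hle hX

/-- The operators `s j_α(x) s*` can be amplified along every representation of the fixed point
algebra: a bounded family of columns results because `j_α(x)* j_α(x) + j_α(y)² = ‖x‖²` for the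
square root `y` of `‖x‖² - x* x`. -/
theorem exists_isAmp_piS (hρ : ρ.IsFaithful) (hs : CStarDynamics.IsFreenessIsometry μ ρ s)
    (πB : α.fixedAlgebra →⋆ₐ[ℂ] (HB →L[ℂ] HB)) (x : A) :
    ∃ Θ : HTensor HB H →L[ℂ] HTensor HB H, IsAmp ρ.fixedRep πB (ρ.piS s x) Θ := by
  have hcol (x : A) (k : H) : ρ.piS s x ∘L ket k ∈ col ρ.fixedRep H := by
    have h : IsAmp ρ.π ρ.π (tensorOp s) (tensorOp s) := fun f =>
      diag_mem_colPair (tensorOp_comp_ket_mem_col ρ s hs.compacts f)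
    exact comp_ket_mem_col_fixedRep hρ (isAmp_piS hρ h hs.commuting hs.commuting x)
      (fun g v => piS_equivariant hs.equivariant g x v) k
  obtain ⟨y, hy, hyy⟩ := exists_sqrt_norm_sq_sub x
  let c : ℂ := ((‖x‖ : ℝ) : ℂ)
  -- `s j_α(y) s*` is completed by `‖x‖` off the range of `s`
  let R : HTensor E H →L[ℂ] HTensor E H :=
    ρ.piS s y + c • (ContinuousLinearMap.id ℂ _ - ρ.piS s 1)
  have hR (v) : R v = ρ.piS s y v + c • (v - ρ.piS s 1 v) := rfl
  have hmul (a b : A) (v) : ρ.piS s a (ρ.piS s b v) = ρ.piS s (a * b) v := by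
    rw [piS_mul]
    rfl
  have hRadj : R.adjoint = R := by
    have h1 : (ContinuousLinearMap.id ℂ (HTensor E H)).adjoint = ContinuousLinearMap.id ℂ _ :=
      ContinuousLinearMap.adjoint_id
    have hc : (starRingEnd ℂ) c = c := Complex.conj_ofReal _
    have h2 : R.adjoint = (ρ.piS s y).adjoint + (starRingEnd ℂ) c •
        ((ContinuousLinearMap.id ℂ (HTensor E H)).adjoint - (ρ.piS s 1).adjoint) := by
      rw [← map_sub, ← map_smulₛₗ, ← map_add]
    rw [h2, hc, h1, ← piS_star, ← piS_star, hy, star_one]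
  refine exists_isAmp (fixedRep_injective hρ) (ρ.piS s x) R (hcol x) (fun k => ?_) (‖x‖ ^ 2) ?_
  · have h1 : R ∘L ket k = ρ.piS s y ∘L ket k + c • (ket k - ρ.piS s 1 ∘L ket k) := rfl
    rw [h1]
    exact add_mem (hcol y k) (Submodule.smul_mem _ _ (sub_mem (ket_mem_col k) (hcol 1 k)))
  · ext v
    have h1 : ρ.piS s (y * y) v = (c * c) • ρ.piS s 1 v - ρ.piS s (star x * x) v := by
      have h2 : y * y = (c * c) • 1 + (-1 : ℂ) • (star x * x) := by
        rw [hyy, neg_one_smul, ← sub_eq_add_neg]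
        congr 2
        change _ = ((‖x‖ : ℝ) : ℂ) * ((‖x‖ : ℝ) : ℂ)
        push_cast
        ring
      rw [h2, piS_add, piS_smul, piS_smul, add_apply, smul_apply, smul_apply, neg_one_smul,
        ← sub_eq_add_neg]
    rw [hRadj, ← piS_star]
    change ρ.piS s (star x) (ρ.piS s x v) + R (R v) = ((‖x‖ ^ 2 : ℝ) : ℂ) • v
    rw [hR, hR]
    simp only [map_add, map_smul, map_sub, hmul, one_mul, mul_one, h1]
    have h3 : ((‖x‖ ^ 2 : ℝ) : ℂ) = c * c := by
      change _ = ((‖x‖ : ℝ) : ℂ) * ((‖x‖ : ℝ) : ℂ)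
      push_cast
      ring
    rw [h3, sub_self, smul_zero, sub_self, smul_zero]
    module

end FixedAlgebra

section Compression

variable {G A : Type*} [Group G] [TopologicalSpace G] [CStarAlgebra A] {α : CStarDynamics G A}
  {K : Type*} [NormedAddCommGroup K] [InnerProductSpace ℂ K] [CompleteSpace K]

/-- A covariant, possibly degenerate, *-representation restricts to a covariant representation on
the range of the image of `1`. -/
theorem exists_covRep (Θ : A →⋆ₙₐ[ℂ] (K →L[ℂ] K)) (v : UnitaryRepr G K)
    (hv : ∀ g x ζ, Θ (α.act g x) (v.op g ζ) = v.op g (Θ x ζ)) :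
    ∃ τ : α.CovRep (projRange (Θ 1)), (∀ x (ζ : projRange (Θ 1)), (τ.π x ζ : K) = Θ x ζ) ∧
      ∀ g (ζ : projRange (Θ 1)), (τ.u.op g ζ : K) = v.op g ζ := by
  have hmul (x y : A) (ζ : K) : Θ (x * y) ζ = Θ x (Θ y ζ) := by
    rw [map_mul]
    rfl
  have hmem (x : A) (ζ : K) : Θ x ζ ∈ projRange (Θ 1) := by
    rw [mem_projRange, ← hmul, one_mul]
  have hfix (ζ : projRange (Θ 1)) : Θ 1 (ζ : K) = ζ := mem_projRange.1 ζ.2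
  have hinv (g : G) (ζ : K) (hζ : ζ ∈ projRange (Θ 1)) : v.op g ζ ∈ projRange (Θ 1) := by
    rw [mem_projRange] at hζ ⊢
    have h := hv g 1 ζ
    rwa [map_one, hζ] at h
  let c (x : A) : projRange (Θ 1) →L[ℂ] projRange (Θ 1) :=
    (Θ x ∘L (projRange (Θ 1)).subtypeL).codRestrict _ fun ζ => hmem x ζ
  have hc (x : A) (ζ) : (c x ζ : K) = Θ x ζ := rfl
  let π : A →⋆ₐ[ℂ] (projRange (Θ 1) →L[ℂ] projRange (Θ 1)) :=
    { toFun := c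
      map_one' := ContinuousLinearMap.ext fun ζ => Subtype.ext (hfix ζ)
      map_mul' := fun x y => ContinuousLinearMap.ext fun ζ => Subtype.ext (hmul x y ζ)
      map_zero' := ContinuousLinearMap.ext fun ζ => Subtype.ext (by
        rw [hc, map_zero]
        rfl)
      map_add' := fun x y => ContinuousLinearMap.ext fun ζ => Subtype.ext (by
        rw [hc, map_add]
        rfl)
      commutes' := fun a => ContinuousLinearMap.ext fun ζ => Subtype.ext (by
        rw [hc, Algebra.algebraMap_eq_smul_one, map_smul, smul_apply, hfix]
        rfl)
      map_star' := fun x => by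
        refine (ContinuousLinearMap.eq_adjoint_iff _ _).2 fun ζ ξ => ?_
        change ⟪(c (star x) ζ : K), (ξ : K)⟫_ℂ = ⟪(ζ : K), (c x ξ : K)⟫_ℂ
        rw [hc, hc, map_star]
        exact ContinuousLinearMap.adjoint_inner_left _ _ _ }
  exact ⟨⟨π, v.restrict _ hinv, fun g x ζ => Subtype.ext (hv g x ζ)⟩, fun _ _ => rfl,
    fun _ _ => rfl⟩

end Compression

/-! ### The model covariant representation -/

section Model

open HTensor
open scoped CStarDynamics

variable {G A : Type*} [Group G] [TopologicalSpace G] [IsTopologicalGroup G] [CompactSpace G]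
  [T2Space G] [MeasurableSpace G] [BorelSpace G] [CStarAlgebra A] {α : CStarDynamics G A}
  {E H HB HA : Type*} [NormedAddCommGroup E] [InnerProductSpace ℂ E] [CompleteSpace E]
  [NormedAddCommGroup H] [InnerProductSpace ℂ H] [CompleteSpace H]
  [NormedAddCommGroup HB] [InnerProductSpace ℂ HB] [CompleteSpace HB]
  [NormedAddCommGroup HA] [InnerProductSpace ℂ HA] [CompleteSpace HA]
  {μ : UnitaryRepr G H} {ρ : α.CovRep E} {s : LTwo G E →ₗᵢ[ℂ] HTensor E H}
  {πB : α.fixedAlgebra →⋆ₐ[ℂ] (HB →L[ℂ] HB)}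

/-- The matrix entries of a column over the fixed point algebra lie in that algebra. -/
theorem isAmplification_of_isAmp (hρ : ρ.IsFaithful) {T : HTensor E H →L[ℂ] HTensor E H}
    {T' : HTensor HB H →L[ℂ] HTensor HB H} (h : IsAmp ρ.fixedRep πB T T') :
    CStarDynamics.IsAmplification ρ πB T T' := by
  intro ξ ζ
  obtain ⟨b, h1, h2⟩ := h.exists_entry_eq (fixedRep_injective hρ) ξ ζ
  refine ⟨b, fun η' η => ?_, fun η' η => ?_⟩
  · rw [← fixedRep_apply, ← h1, ← inner_bra]
    rfl
  · rw [← h2, ← inner_bra]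
    rfl

/-- The amplifications of the operators `s j_α(x) s*` form a *-representation which is covariant
for `1 ⊗ μ`. -/
theorem exists_amplified_rep (hρ : ρ.IsFaithful) (hs : CStarDynamics.IsFreenessIsometry μ ρ s)
    (πB : α.fixedAlgebra →⋆ₐ[ℂ] (HB →L[ℂ] HB)) :
    ∃ Θ : A →⋆ₙₐ[ℂ] (HTensor HB H →L[ℂ] HTensor HB H),
      (∀ x, IsAmp ρ.fixedRep πB (ρ.piS s x) (Θ x)) ∧
      ∀ g x ζ, Θ (α.act g x) ((amplify HB μ).op g ζ) = (amplify HB μ).op g (Θ x ζ) := by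
  have hinj := fixedRep_injective hρ
  choose Θ hΘ using fun x => exists_isAmp_piS hρ hs πB x
  have hadd (x y : A) : Θ (x + y) = Θ x + Θ y :=
    (hΘ (x + y)).unique hinj (by rw [piS_add]; exact (hΘ x).add (hΘ y))
  have hsmul (c : ℂ) (x : A) : Θ (c • x) = c • Θ x :=
    (hΘ (c • x)).unique hinj (by rw [piS_smul]; exact (hΘ x).smul c)
  let Θ' : A →⋆ₙₐ[ℂ] (HTensor HB H →L[ℂ] HTensor HB H) :=
    { toFun := Θ
      map_smul' := hsmul
      map_zero' := by
        have h := hsmul 0 0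
        rwa [zero_smul, zero_smul] at h
      map_add' := hadd
      map_mul' := fun x y => (hΘ (x * y)).unique hinj (by rw [piS_mul]; exact (hΘ x).comp (hΘ y))
      map_star' := fun x => (hΘ x).adjoint_eq hinj (by rw [← piS_star]; exact hΘ (star x)) }
  refine ⟨Θ', hΘ, fun g x ζ => ?_⟩
  have hμ : IsAmp ρ.fixedRep πB (hmap LinearIsometry.id (μ.op g).toLinearIsometry)
      (hmap LinearIsometry.id (μ.op g).toLinearIsometry) := by
    rw [hmap_eq_map, hmap_eq_map]
    exact IsAmp.map _
  have h1 : ρ.piS s (α.act g x) ∘L hmap LinearIsometry.id (μ.op g).toLinearIsometry =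
      hmap LinearIsometry.id (μ.op g).toLinearIsometry ∘L ρ.piS s x :=
    ContinuousLinearMap.ext fun v => piS_act hs.commuting g x v
  have h2 := (hΘ (α.act g x)).comp hμ
  rw [h1] at h2
  exact DFunLike.congr_fun (h2.unique hinj (hμ.comp (hΘ x))) ζ

/-- The amplification of `s j_α(x) s*` becomes `s' j_α(x) s'*` in every covariant representation
whose trivial isotypic component is the given representation of the fixed point algebra. -/
theorem hmap_amplified (hρ : ρ.IsFaithful) {Θ : A →⋆ₙₐ[ℂ] (HTensor HB H →L[ℂ] HTensor HB H)}
    (hΘ : ∀ x, IsAmp ρ.fixedRep πB (ρ.piS s x) (Θ x)) {ρ' : α.CovRep HA}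
    {s' : LTwo G HA →ₗᵢ[ℂ] HTensor HA H}
    (hs' : ∀ x, IsAmp ρ.π ρ'.π (ρ.piS s x) (ρ'.piS s' x)) (ι : HB →ₗᵢ[ℂ] HA)
    (hι : ∀ (b : α.fixedAlgebra) ξ, ι (πB b ξ) = ρ'.π (b : A) (ι ξ)) (x : A) (ζ : HTensor HB H) :
    hmap ι LinearIsometry.id (Θ x ζ) = ρ'.piS s' x (hmap ι LinearIsometry.id ζ) := by
  have hbra (k : H) (ζ : HTensor HB H) :
      bra k (hmap ι LinearIsometry.id ζ) = ι (bra k ζ) := by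
    have h : bra k ∘L hmap ι LinearIsometry.id = ι.toContinuousLinearMap ∘L bra k :=
      ext_clm fun e f => by
        change bra k (hmap _ _ (htmul e f)) = ι (bra k (htmul e f))
        rw [hmap_htmul, bra_htmul, bra_htmul, map_smul]
        rfl
    exact DFunLike.congr_fun h ζ
  have h : hmap ι LinearIsometry.id ∘L Θ x = ρ'.piS s' x ∘L hmap ι LinearIsometry.id := by
    refine ext_clm fun ξ l => bra_ext fun k => ?_
    obtain ⟨b, hb1, hb2⟩ := (hΘ x).exists_entry_eq (fixedRep_injective hρ) k l
    obtain ⟨a, ha1, ha2⟩ := (hs' x).exists_entry_eq hρ k l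
    have hab : (b : A) = a := hρ (hb1.symm.trans ha1)
    have h1 : bra k (Θ x (htmul ξ l)) = πB b ξ := DFunLike.congr_fun hb2 ξ
    have h2 : bra k (ρ'.piS s' x (htmul (ι ξ) l)) = ρ'.π a (ι ξ) := DFunLike.congr_fun ha2 (ι ξ)
    change bra k (hmap _ _ (Θ x (htmul ξ l))) = bra k (ρ'.piS s' x (hmap _ _ (htmul ξ l)))
    rw [hbra, h1, hι, hab, hmap_htmul]
    exact h2.symm
  exact DFunLike.congr_fun h ζ

/-- The vectors fixed by `u ⊗ 1` form the tensor product of the trivial isotypic component with the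
second factor. -/
theorem exists_hmap_eq {u : UnitaryRepr G HA} (ι : HB →ₗᵢ[ℂ] HA)
    (hι : ∀ η, (∀ g, u.op g η = η) → ∃ ξ, ι ξ = η) {v : HTensor HA H}
    (hv : ∀ g, hmap (u.op g).toLinearIsometry LinearIsometry.id v = v) :
    ∃ ζ, hmap ι LinearIsometry.id ζ = v := by
  refine ⟨map ι.toContinuousLinearMap.adjoint (ContinuousLinearMap.id ℂ H) v, ?_⟩
  have h1 : (hmap ι LinearIsometry.id : HTensor HB H →L[ℂ] HTensor HA H) ∘L
      map ι.toContinuousLinearMap.adjoint (ContinuousLinearMap.id ℂ H) =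
      map (ι.toContinuousLinearMap ∘L ι.toContinuousLinearMap.adjoint)
        (ContinuousLinearMap.id ℂ H) := ext_clm fun e f => by
    change hmap _ _ (map _ _ (htmul e f)) = _
    rw [map_htmul, hmap_htmul, map_htmul]
    rfl
  refine (DFunLike.congr_fun h1 v).trans (bra_ext fun k => ?_)
  have h2 : bra k ∘L map (ι.toContinuousLinearMap ∘L ι.toContinuousLinearMap.adjoint)
      (ContinuousLinearMap.id ℂ H) =
      (ι.toContinuousLinearMap ∘L ι.toContinuousLinearMap.adjoint) ∘L bra k :=
    ext_clm fun e f => by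
      change bra k (map _ _ (htmul e f)) = (_ ∘L _) (bra k (htmul e f))
      rw [map_htmul, bra_htmul, bra_htmul, map_smul]
      rfl
  obtain ⟨ξ, hξ⟩ := hι (bra k v) fun g => by rw [← bra_hmap, hv]
  refine (DFunLike.congr_fun h2 v).trans ?_
  change ι (ι.toContinuousLinearMap.adjoint (bra k v)) = bra k v
  rw [← hξ]
  congr 1
  refine ext_inner_left ℂ fun w => ?_
  rw [ContinuousLinearMap.adjoint_inner_right]
  exact ι.inner_map_map w ξ

/-- The model representation, acting on the range of `p = (π_B ⊗ id)(s s*)`, and its uniqueness among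
the covariant representations with trivial isotypic component `π_B`. -/
theorem CStarDynamics.IsFreenessIsometry.exists_model (hρ : ρ.IsFaithful)
    (hs : CStarDynamics.IsFreenessIsometry μ ρ s)
    (πB : α.fixedAlgebra →⋆ₐ[ℂ] (HB →L[ℂ] HB)) :
    ∃ (p : HTensor HB H →L[ℂ] HTensor HB H) (τ : α.CovRep (projRange p)),
      CStarDynamics.IsModel μ ρ s πB p τ ∧
      ∀ (HA : Type u₁) [NormedAddCommGroup HA] [InnerProductSpace ℂ HA] [CompleteSpace HA]
        (ρ' : α.CovRep HA), ρ'.TrivialComponentIso πB → ρ'.UnitarilyEquivalent τ := by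
  obtain ⟨Θ, hΘ, hcov⟩ := exists_amplified_rep hρ hs πB
  obtain ⟨τ, hτπ, hτu⟩ := exists_covRep Θ (amplify HB μ) hcov
  have hp : IsStarProjection (Θ 1) :=
    ⟨by rw [IsIdempotentElem, ← map_mul, one_mul], by rw [IsSelfAdjoint, ← map_star, star_one]⟩
  refine ⟨Θ 1, τ, ⟨hp, ?_, fun x => ⟨Θ x, isAmplification_of_isAmp hρ (hΘ x), hτπ x⟩, hτu⟩, ?_⟩
  · rw [← piS_one (ρ := ρ)]
    exact isAmplification_of_isAmp hρ (hΘ 1)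
  intro HA _ _ _ ρ' ⟨U, hU⟩
  obtain ⟨s', hamp, heq, hcomm⟩ := hs.exists_transport hρ ρ'
  let ι : HB →ₗᵢ[ℂ] HA := ρ'.u.trivialComponent.subtypeₗᵢ.comp U.toLinearIsometry
  have hι (ξ : HB) (g : G) : ρ'.u.op g (ι ξ) = ι ξ := (U ξ).2 g
  let h : HTensor HB H →ₗᵢ[ℂ] HTensor HA H := hmapIso ι LinearIsometry.id
  have hhΘ (x : A) (ζ) : h (Θ x ζ) = ρ'.piS s' x (h ζ) :=
    hmap_amplified hρ hΘ (isAmp_piS hρ hamp hs.commuting hcomm) ι hU x ζ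
  have hhμ (g : G) (ζ) : h ((amplify HB μ).op g ζ) = (amplify HA μ).op g (h ζ) := by
    have h1 : hmap ι LinearIsometry.id ∘L hmap LinearIsometry.id (μ.op g).toLinearIsometry =
        hmap LinearIsometry.id (μ.op g).toLinearIsometry ∘L hmap ι LinearIsometry.id :=
      ext_clm fun e f => by
        rw [ContinuousLinearMap.comp_apply, ContinuousLinearMap.comp_apply, hmap_htmul, hmap_htmul,
          hmap_htmul, hmap_htmul]
        rfl
    exact DFunLike.congr_fun h1 ζ
  have hhu (g : G) (ζ) : hmap (ρ'.u.op g).toLinearIsometry LinearIsometry.id (h ζ) = h ζ := by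
    have h1 : hmap (ρ'.u.op g).toLinearIsometry LinearIsometry.id ∘L hmap ι LinearIsometry.id =
        hmap ι (LinearIsometry.id : H →ₗᵢ[ℂ] H) := ext_clm fun e f => by
      rw [ContinuousLinearMap.comp_apply, hmap_htmul, hmap_htmul]
      exact congrArg (fun z => htmul z f) (hι e g)
    exact DFunLike.congr_fun h1 ζ
  have hpi (x : A) (v : LTwo G HA) : ρ'.piS s' x (s' v) = s' (ρ'.jOp x v) := by
    rw [piS_apply, adjoint_comp_self]
  have hone (v : LTwo G HA) : ρ'.piS s' 1 (s' v) = s' v := by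
    rw [piS_one]
    exact congrArg s' (adjoint_comp_self s' v)
  -- `h` identifies the range of `Θ 1` with the vectors of the range of `s'` fixed by `u ⊗ 1`
  have hex (η : HA) : ∃ ζ : projRange (Θ 1), h ζ = s' (fixedEmb ρ'.u η) := by
    obtain ⟨ζ, hζ⟩ := exists_hmap_eq (u := ρ'.u) ι
      (fun η hη => ⟨U.symm ⟨η, hη⟩, congrArg Subtype.val (U.apply_symm_apply ⟨η, hη⟩)⟩)
      (v := s' (fixedEmb ρ'.u η)) fun g => by rw [heq, twistedRightTranslate_fixedEmb]
    have hζ' : h ζ = s' (fixedEmb ρ'.u η) := hζ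
    refine ⟨⟨ζ, mem_projRange.2 (h.injective ?_)⟩, hζ⟩
    rw [hhΘ, hζ', hone]
  choose φ hφ using hex
  let Φ : HA →ₗᵢ[ℂ] projRange (Θ 1) :=
    { toFun := φ
      map_add' := fun η η' => Subtype.ext (h.injective (by
        rw [hφ, Submodule.coe_add, map_add, map_add, map_add, hφ, hφ]))
      map_smul' := fun c η => Subtype.ext (h.injective (by
        rw [hφ, RingHom.id_apply, Submodule.coe_smul, map_smul, map_smul, map_smul, hφ]))
      norm_map' := fun η => by
        change ‖((φ η : projRange (Θ 1)) : HTensor HB H)‖ = ‖η‖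
        rw [← h.norm_map, hφ, s'.norm_map, LinearIsometry.norm_map] }
  have hΦ (η : HA) : h (Φ η) = s' (fixedEmb ρ'.u η) := hφ η
  have hsurj : Function.Surjective Φ := by
    intro ζ
    have h1 : s' (s'.toContinuousLinearMap.adjoint (h ζ)) = h ζ := by
      have h2 := hhΘ 1 (ζ : HTensor HB H)
      rw [mem_projRange.1 ζ.2, piS_one] at h2
      exact h2.symm
    obtain ⟨η, hη⟩ := exists_fixedEmb_eq ρ'.u (v := s'.toContinuousLinearMap.adjoint (h ζ))
      fun g => s'.injective (by rw [← heq, h1, hhu])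
    exact ⟨η, Subtype.ext (h.injective (by rw [hΦ, hη, h1]))⟩
  refine ⟨LinearIsometryEquiv.ofSurjective Φ hsurj, fun x η => ?_, fun g η => ?_⟩
  · refine Subtype.ext (h.injective ?_)
    rw [hτπ]
    change h (Φ (ρ'.π x η)) = h (Θ x (Φ η))
    rw [hhΘ, hΦ, hΦ, hpi, ρ'.jOp_fixedEmb]
  · refine Subtype.ext (h.injective ?_)
    rw [hτu]
    change h (Φ (ρ'.u.op g η)) = h ((amplify HB μ).op g (Φ η))
    rw [hhμ, hΦ, hΦ, amplify_op, hcomm, leftTranslate_fixedEmb]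

end Model

end

theorem theorem4p3 {G : Type uG} [Group G] [TopologicalSpace G]
    [IsTopologicalGroup G] [CompactSpace G] [T2Space G] [MeasurableSpace G] [BorelSpace G]
    {A : Type uA} [CStarAlgebra A] (α : CStarDynamics G A) (hα : α.IsFree) :
    -- a choice of `H`, `μ` and, in every faithful covariant representation, `s` exists
    (∃ (H : Type uG) (_ : NormedAddCommGroup H) (_ : InnerProductSpace ℂ H)
        (_ : CompleteSpace H) (μ : UnitaryRepr G H), μ.HasFiniteMultiplicities ∧
      ∀ (H₀ : Type u₀) [NormedAddCommGroup H₀] [InnerProductSpace ℂ H₀] [CompleteSpace H₀]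
        (ρ₀ : α.CovRep H₀), ρ₀.IsFaithful →
        ∃ s : LTwo G H₀ →ₗᵢ[ℂ] HTensor H₀ H,
          CStarDynamics.IsFreenessIsometry μ ρ₀ s ∧ CStarDynamics.IsNormalizedIsometry μ s) ∧
    -- for every choice of `H`, `μ` and `s`, and for every representation space `HB` of the fixed
    -- point algebra, `(p (HB ⊗ H), π_p, 1 ⊗ μ)` is a covariant representation `τ`, and all faithful
    -- covariant representations with trivial isotypic component `HB` are equivalent to it
    (∀ (H : Type uH) [NormedAddCommGroup H] [InnerProductSpace ℂ H] [CompleteSpace H]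
        (μ : UnitaryRepr G H), μ.HasFiniteMultiplicities →
      ∀ (H₀ : Type u₀) [NormedAddCommGroup H₀] [InnerProductSpace ℂ H₀] [CompleteSpace H₀]
        (ρ₀ : α.CovRep H₀), ρ₀.IsFaithful →
      ∀ s : LTwo G H₀ →ₗᵢ[ℂ] HTensor H₀ H, CStarDynamics.IsFreenessIsometry μ ρ₀ s →
      ∀ (HB : Type uB) [NormedAddCommGroup HB] [InnerProductSpace ℂ HB] [CompleteSpace HB]
        (πB : α.fixedAlgebra →⋆ₐ[ℂ] (HB →L[ℂ] HB)),
      ∃ (p : HTensor HB H →L[ℂ] HTensor HB H) (τ : α.CovRep (projRange p)),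
        CStarDynamics.IsModel μ ρ₀ s πB p τ ∧
        ∀ (HA : Type u₁) [NormedAddCommGroup HA] [InnerProductSpace ℂ HA] [CompleteSpace HA]
          (ρ : α.CovRep HA), ρ.IsFaithful → ρ.TrivialComponentIso πB →
          ρ.UnitarilyEquivalent τ) := by
  refine ⟨?_, ?_⟩
  · obtain ⟨Y⟩ := hα.nonempty_blockFrames
    exact ⟨Y.Space, inferInstance, inferInstance, inferInstance, Y.repr, Y.hasFiniteMultiplicities,
      fun H₀ _ _ _ ρ₀ _ => Y.exists_freenessIsometry ρ₀⟩
  · intro H _ _ _ μ _ H₀ _ _ _ ρ₀ hρ₀ s hs HB _ _ _ πB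
    obtain ⟨p, τ, hτ, huniq⟩ := hs.exists_model hρ₀ πB
    exact ⟨p, τ, hτ, fun HA _ _ _ ρ _ hiso => huniq HA ρ hiso⟩
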